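/- Let $G=(V_1\cup V_2,E)$ be a simple bipartite graph with $n_1=|V_1|\le n_2=|V_2|$ and $m=|E|$, let $\kappa$ be the cardinality of a maximum matching of $G$, and consider the following algorithm. 1. Compute a maximal matching $M_g$ of $G$; let $\kappa_g=|M_g|$ and let $V_g$ be the set of nodes matched by $M_g$. 2. Build a graph $G^*=(V_1\cup V_2,E^*)$, where $E^*=\bigcup_{v\in V_g}S_v$ and $S_v$ is as follows. If the degree of $v$ in $G$ is at most $2\kappa_g$, then $S_v$ consists of all edges of $G$ at $v$. Otherwise $S_v$ is an arbitrary set of exactly $2\kappa_g$ edges of $G$ at $v$ that contains every edge of $G$ joining $v$ to another node of $V_g$. 3. Run the Hopcroft–Karp algorithm on $G^*$: start with the empty matching; as long as there is an augmenting path in $G^*$, carry out a phase, that is, augment the current matching along an inclusion-maximal set of pairwise node-disjoint shortest augmenting paths. Then: (a) For every choice of $M_g$, of $E^*$ and of the paths in the phases, the matching with which the algorithm stops is a maximum matching of $G$. (b) The algorithm can be implemented on a unit-cost random access machine (zero-initialized work memory; only the arithmetic operations $+1$ and $-1$), with $n_1$, $n_2$ and linked adjacency lists of all nodes of $V_1$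 and $V_2$ as input, in such a way that the implementation always halts with a maximum matching of $G$ and its total number of steps is $$O\bigl(\min\{m,\,n_1\kappa\}+\sqrt{\kappa}\,\min\{m,\kappa^2\}\bigr)$$ whenever $m\ge\max\{1,n_1\}$ (in particular, whenever $m \geq 1$ and no node of $V_1$ is isolated). For arbitrary $G$, the number of steps is $O\bigl(1+n_1+\min\{m,n_1\kappa\}+\sqrt{\kappa}\,\min\{m,\kappa^2\}\bigr)$. The implied constants are absolute. -/

import Mathlib

namespace BipMatching

/-! ## Bipartite graphs and matchings

A simple bipartite graph on `V₁ = Fin n₁`, `V₂ = Fin n₂` is given by its set of edges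
`E : Finset (Fin n₁ × Fin n₂)`; the set of all nodes is `Fin n₁ ⊕ Fin n₂`. -/

section Graph

variable {n₁ n₂ : ℕ}

/-- `M` is a matching of the bipartite graph `E`. -/
def IsMatching (E M : Finset (Fin n₁ × Fin n₂)) : Prop :=
  M ⊆ E ∧ ∀ e ∈ M, ∀ f ∈ M, (e.1 = f.1 ∨ e.2 = f.2) → e = f

/-- `M` is a matching of `E` of maximum cardinality. -/
def IsMaximumMatching (E M : Finset (Fin n₁ × Fin n₂)) : Prop :=
  IsMatching E M ∧ ∀ N, IsMatching E N → N.card ≤ M.card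

open Classical in
/-- `κ`: the cardinality of a maximum matching of `E`. -/
noncomputable def matchingNumber (E : Finset (Fin n₁ × Fin n₂)) : ℕ :=
  (E.powerset.filter (IsMatching E)).sup Finset.card

/-- The node `v` is an end point of the edge `e`. -/
def Inc (v : Fin n₁ ⊕ Fin n₂) (e : Fin n₁ × Fin n₂) : Prop :=
  v = Sum.inl e.1 ∨ v = Sum.inr e.2

/-- The node `v` is matched by `M`. -/
def Covered (M : Finset (Fin n₁ × Fin n₂)) (v : Fin n₁ ⊕ Fin n₂) : Prop :=
  ∃ e ∈ M, Inc v e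

open Classical in
/-- All edges of `E` at the node `v`. -/
noncomputable def edgesAt (E : Finset (Fin n₁ × Fin n₂)) (v : Fin n₁ ⊕ Fin n₂) :
    Finset (Fin n₁ × Fin n₂) :=
  E.filter (fun e => Inc v e)

open Classical in
/-- For a node `v` matched by `M`: the edges of `E` that join `v` to a node matched by `M`. -/
noncomputable def innerEdgesAt (E M : Finset (Fin n₁ × Fin n₂)) (v : Fin n₁ ⊕ Fin n₂) :
    Finset (Fin n₁ × Fin n₂) :=
  (edgesAt E v).filter (fun e => Covered M (Sum.inl e.1) ∧ Covered M (Sum.inr e.2))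

/-- `Es` is an admissible edge set of the graph `G*` built from the graph `E` and the maximal
matching `M`: every matched node `v` contributes all its edges if its degree is at most `2 |M|`,
and otherwise exactly `2 |M|` of its edges, among them all the edges from `v` to matched nodes. -/
def IsReducedGraph (E M Es : Finset (Fin n₁ × Fin n₂)) : Prop :=
  ∃ S : Fin n₁ ⊕ Fin n₂ → Finset (Fin n₁ × Fin n₂),
    (∀ v, Covered M v →
      ((edgesAt E v).card ≤ 2 * M.card → S v = edgesAt E v) ∧
      (2 * M.card < (edgesAt E v).card →
        innerEdgesAt E M v ⊆ S v ∧ S v ⊆ edgesAt E v ∧ (S v).card = 2 * M.card)) ∧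
    ∀ e, e ∈ Es ↔ ∃ v, Covered M v ∧ e ∈ S v

/-! ## The Hopcroft–Karp algorithm -/

/-- The list `[(i₀, j₀), …, (iₖ, jₖ)]` stands for the path `i₀ j₀ i₁ j₁ … iₖ jₖ`, which has
`2 k + 1` edges.  It is an augmenting path of `H` with respect to `M` if its nodes are distinct,
`i₀` and `jₖ` are unmatched, the edges `(iₜ, jₜ)` are edges of `H` outside `M`, and the edges
`(iₜ₊₁, jₜ)` are edges of `M`.  (An augmenting path of a bipartite graph has one end in each
side, so listing it from its end in `V₁` loses nothing.) -/
def IsAugPath (H M : Finset (Fin n₁ × Fin n₂)) (P : List (Fin n₁ × Fin n₂)) : Prop :=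
  P ≠ [] ∧ (P.map Prod.fst).Nodup ∧ (P.map Prod.snd).Nodup ∧
  (∀ e ∈ P, e ∈ H ∧ e ∉ M) ∧
  P.IsChain (fun e f => (f.1, e.2) ∈ M) ∧
  (∀ e ∈ P.head?, ¬ Covered M (Sum.inl e.1)) ∧
  (∀ e ∈ P.getLast?, ¬ Covered M (Sum.inr e.2))

/-- The edges `(iₜ, jₜ)` and `(iₜ₊₁, jₜ)` of the path `i₀ j₀ i₁ j₁ … iₖ jₖ`. -/
def pathEdges (P : List (Fin n₁ × Fin n₂)) : Finset (Fin n₁ × Fin n₂) :=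
  P.toFinset ∪ ((P.tail.map Prod.fst).zip (P.map Prod.snd)).toFinset

/-- A shortest augmenting path. -/
def IsShortestAugPath (H M : Finset (Fin n₁ × Fin n₂)) (P : List (Fin n₁ × Fin n₂)) : Prop :=
  IsAugPath H M P ∧ ∀ Q, IsAugPath H M Q → P.length ≤ Q.length

/-- Two paths have no node in common. -/
def NodeDisjoint (P Q : List (Fin n₁ × Fin n₂)) : Prop :=
  ∀ e ∈ P, ∀ f ∈ Q, e.1 ≠ f.1 ∧ e.2 ≠ f.2

/-- One phase of the Hopcroft–Karp algorithm on `H` turns the matching `M` into `M'`: it augments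
`M` along an inclusion-maximal, nonempty set of pairwise node-disjoint shortest augmenting
paths. -/
def HKPhase (H M M' : Finset (Fin n₁ × Fin n₂)) : Prop :=
  ∃ Ps : Finset (List (Fin n₁ × Fin n₂)),
    Ps.Nonempty ∧ (∀ P ∈ Ps, IsShortestAugPath H M P) ∧
    (∀ P ∈ Ps, ∀ Q ∈ Ps, P ≠ Q → NodeDisjoint P Q) ∧
    (∀ Q, IsShortestAugPath H M Q → ∃ P ∈ Ps, ¬ NodeDisjoint P Q) ∧
    M' = symmDiff M (Ps.biUnion pathEdges)

/-- `M` is a result of the Hopcroft–Karp algorithm on `H`: starting from the empty matching,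
phases are carried out until there is no augmenting path. -/
def IsHKResult (H M : Finset (Fin n₁ × Fin n₂)) : Prop :=
  Relation.ReflTransGen (HKPhase H) ∅ M ∧ ∀ P, ¬ IsAugPath H M P

end Graph

/-! ## The machine model

A unit-cost random access machine with finitely many registers and arrays per program, all holding
natural numbers.  The only arithmetic is `+ 1` and `- 1`, so numbers never exceed the
input numbers and program constants by more than the number of steps. -/

/-- The memory: registers `reg r` and arrays `mem a` with cells `mem a i`. -/
structure State where
  reg : ℕ → ℕ
  mem : ℕ → ℕ → ℕ

/-- Elementary instructions. -/
inductive Instr where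
  /-- no operation -/
  | skip
  /-- register `r` gets the constant `c` -/
  | const (r c : ℕ)
  /-- register `r` gets the content of register `q` -/
  | copy (r q : ℕ)
  /-- add one to register `r` -/
  | inc (r : ℕ)
  /-- subtract one from register `r` (zero stays zero) -/
  | dec (r : ℕ)
  /-- register `r` gets the cell of the array `a` whose index is in register `i` -/
  | load (r a i : ℕ)
  /-- the cell of the array `a` whose index is in register `i` gets the content of register `r` -/
  | store (a i r : ℕ)

/-- The effect of an instruction. -/
def Instr.run : Instr → State → State
  | .skip, s => s
  | .const r c, s => { s with reg := Function.update s.reg r c }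
  | .copy r q, s => { s with reg := Function.update s.reg r (s.reg q) }
  | .inc r, s => { s with reg := Function.update s.reg r (s.reg r + 1) }
  | .dec r, s => { s with reg := Function.update s.reg r (s.reg r - 1) }
  | .load r a i, s => { s with reg := Function.update s.reg r (s.mem a (s.reg i)) }
  | .store a i r, s =>
      { s with mem := Function.update s.mem a (Function.update (s.mem a) (s.reg i) (s.reg r)) }

/-- Tests compare two registers. -/
inductive Test where
  | eq (r q : ℕ)
  | lt (r q : ℕ)

/-- The test succeeds. -/
def Test.Holds : Test → State → Prop
  | .eq r q, s => s.reg r = s.reg q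
  | .lt r q, s => s.reg r < s.reg q

/-- Structured programs. -/
inductive Prog where
  | instr (c : Instr)
  | seq (p q : Prog)
  | ite (b : Test) (p q : Prog)
  | loop (b : Test) (p : Prog)

/-- `Exec p s t s'`: the program `p`, started in `s`, halts in `s'` after exactly `t` steps.
Each instruction and each evaluation of a test is one step. -/
inductive Exec : Prog → State → ℕ → State → Prop
  | instr (c : Instr) (s : State) : Exec (.instr c) s 1 (c.run s)
  | seq {p q : Prog} {s s' s'' : State} {t t' : ℕ} :
      Exec p s t s' → Exec q s' t' s'' → Exec (.seq p q) s (t + t') s''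
  | iteTrue {b : Test} {p q : Prog} {s s' : State} {t : ℕ} :
      b.Holds s → Exec p s t s' → Exec (.ite b p q) s (1 + t) s'
  | iteFalse {b : Test} {p q : Prog} {s s' : State} {t : ℕ} :
      ¬ b.Holds s → Exec q s t s' → Exec (.ite b p q) s (1 + t) s'
  | loopDone {b : Test} {p : Prog} {s : State} :
      ¬ b.Holds s → Exec (.loop b p) s 1 s
  | loopStep {b : Test} {p : Prog} {s s' s'' : State} {t t' : ℕ} :
      b.Holds s → Exec p s t s' → Exec (.loop b p) s' t' s'' →
      Exec (.loop b p) s (1 + t + t') s''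

/-! ## Input and output -/

/-- The linked list that starts at the pointer `p` has the entries `l`: the cell at a pointer
`p ≠ 0` has the entry `key p` and the successor `next p`, and the pointer `0` is the empty list. -/
def IsLinkedList (next key : ℕ → ℕ) : ℕ → List ℕ → Prop
  | p, [] => p = 0
  | p, x :: l => p ≠ 0 ∧ key p = x ∧ IsLinkedList next key (next p) l

/-- Adjacency lists of the graph `E` in the arrays `a`, …, `a + 3`: the array `a` holds the
pointers to the neighbour lists of the nodes of `V₁`, the array `a + 1` those of `V₂`, and
the arrays `a + 2`, `a + 3` hold the successors and the entries of the list cells.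
The order of each list and the places of its cells are arbitrary. -/
def HoldsGraph {n₁ n₂ : ℕ} (a : ℕ) (E : Finset (Fin n₁ × Fin n₂)) (s : State) : Prop :=
  (∀ i : Fin n₁, ∃ l : List (Fin n₂), l.Nodup ∧ (∀ j, j ∈ l ↔ (i, j) ∈ E) ∧
    IsLinkedList (s.mem (a + 2)) (s.mem (a + 3)) (s.mem a i) (l.map Fin.val)) ∧
  (∀ j : Fin n₂, ∃ l : List (Fin n₁), l.Nodup ∧ (∀ i, i ∈ l ↔ (i, j) ∈ E) ∧
    IsLinkedList (s.mem (a + 2)) (s.mem (a + 3)) (s.mem (a + 1) j) (l.map Fin.val))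

/-- The array `a` holds the matching `M`: for a node `i` of `V₁` it has `j + 1` in the cell `i`
if `i` is matched to `j`, and `0` if `i` is unmatched. -/
def HoldsMatching {n₁ n₂ : ℕ} (a : ℕ) (M : Finset (Fin n₁ × Fin n₂)) (s : State) : Prop :=
  ∀ i : Fin n₁, (s.mem a i = 0 ∧ ∀ j, (i, j) ∉ M) ∨ ∃ j, (i, j) ∈ M ∧ s.mem a i = j + 1

/-- Initial memory for the input graph `E`: the registers `0`, `1` hold `n₁`, `n₂`, the arrays
`0`, …, `3` hold adjacency lists of `E`, and everything else is zero. -/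
def IsInput {n₁ n₂ : ℕ} (E : Finset (Fin n₁ × Fin n₂)) (s : State) : Prop :=
  s.reg 0 = n₁ ∧ s.reg 1 = n₂ ∧ (∀ r, 2 ≤ r → s.reg r = 0) ∧
  HoldsGraph 0 E s ∧ ∀ a, 4 ≤ a → ∀ i, s.mem a i = 0

/-- The program `while b do p`, started in the state `s` with the matching `M` in the array `a`,
ends in the state `s'` with the matching `M'`; each round is one Hopcroft–Karp phase on `H`, and
it stops when there is no augmenting path. -/
inductive HKTrace {n₁ n₂ : ℕ} (H : Finset (Fin n₁ × Fin n₂)) (a : ℕ) (b : Test) (p : Prog) :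
    State → Finset (Fin n₁ × Fin n₂) → State → Finset (Fin n₁ × Fin n₂) → Prop
  | done {s : State} {M : Finset (Fin n₁ × Fin n₂)} :
      HoldsMatching a M s → ¬ b.Holds s → (∀ P, ¬ IsAugPath H M P) → HKTrace H a b p s M s M
  | phase {s s₁ s' : State} {M M₁ M' : Finset (Fin n₁ × Fin n₂)} {t : ℕ} :
      HoldsMatching a M s → b.Holds s → Exec p s t s₁ → HKPhase H M M₁ →
      HKTrace H a b p s₁ M₁ s' M' → HKTrace H a b p s M s' M'

end BipMatching

namespace BipMatching

/-! ### Matchings, vertex covers and alternating layers -/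

section Combinatorics

variable {n₁ n₂ : ℕ} {E H M N : Finset (Fin n₁ × Fin n₂)}

/-! Correctness. If no augmenting path of G* is left, alternating reachability from the free nodes
of V₁ yields a König cover of G* with at most |M| nodes (`exists_cover_of_no_augPath`). If it covers
G as well, weak duality shows that M is maximum in G. Otherwise it misses an edge e of G. Since M_g
is maximal, e has an end v in V_g. As e is not in S_v, the set S_v consists of exactly 2κ_g edges of
G*; v is outside the cover, so the 2κ_g other ends are all inside. Hence |M| ≥ 2κ_g, and no matching
of G exceeds 2κ_g because V_g covers G (`IsReducedGraph.isMaximumMatching`).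

Number of phases. Let K be the number of V₁-nodes on a shortest augmenting path. Cutting at a layer
t < K gives a cover that exceeds |M| by at most the number of matching edges in layer t. Summing
over t bounds the deficit d of M by (K - 1) d ≤ |M| (`ShortestLabel.mul_deficit_le`). Every phase
increases K (`HKPhase.lt_length`). With q about √κ, at most q phases have K ≤ q; afterwards the
deficit is at most q and each phase gains an edge. So 2q phases suffice (`exec_hkLoop`).

Cost. E* has at most min{m, 4κ²} edges and a phase takes time linear in |E*|. For this, a phase
touches only non-isolated nodes of V₁ and the lists of G*, and the labels on V₂ are cleared along
these lists. Before the phases, n₂ must not enter either: nodes of V₂ are reached through their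
partners in V₁. The greedy scan of a node passes only matched neighbours before it stops, so it
reads at most min{deg, κ + 1} cells; a capped scan of a matched node of V₁ reads at most 3κ_g + 1
cells; and the complete lists of the matched nodes of V₂ have total length at most min{m, n₁κ}.

Programs are verified by a total correctness logic `Run`, in which loop invariants carry a budget of
steps. In the graph searches the budget sits on a set W of nodes not yet processed. -/

theorem covered_inl {i : Fin n₁} : Covered M (Sum.inl i) ↔ ∃ j, (i, j) ∈ M := by
  constructor
  · rintro ⟨⟨a, b⟩, he, h | h⟩
    · cases h; exact ⟨b, he⟩
    · cases h
  · rintro ⟨j, hj⟩; exact ⟨_, hj, Or.inl rfl⟩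

theorem covered_inr {j : Fin n₂} : Covered M (Sum.inr j) ↔ ∃ i, (i, j) ∈ M := by
  constructor
  · rintro ⟨⟨a, b⟩, he, h | h⟩
    · cases h
    · cases h; exact ⟨a, he⟩
  · rintro ⟨j, hj⟩; exact ⟨_, hj, Or.inr rfl⟩

theorem IsMatching.right_unique (h : IsMatching H M) {i : Fin n₁} {j j' : Fin n₂}
    (h1 : (i, j) ∈ M) (h2 : (i, j') ∈ M) : j = j' :=
  (Prod.mk.inj (h.2 _ h1 _ h2 (Or.inl rfl))).2

theorem IsMatching.left_unique (h : IsMatching H M) {i i' : Fin n₁} {j : Fin n₂}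
    (h1 : (i, j) ∈ M) (h2 : (i', j) ∈ M) : i = i' :=
  (Prod.mk.inj (h.2 _ h1 _ h2 (Or.inr rfl))).1

theorem IsMatching.empty : IsMatching H ∅ := by simp [IsMatching]

theorem IsMatching.injOn_fst (h : IsMatching H M) : Set.InjOn Prod.fst (M : Set (Fin n₁ × Fin n₂)) :=
  fun e he f hf hef => h.2 e he f hf (Or.inl hef)

theorem IsMatching.injOn_snd (h : IsMatching H M) : Set.InjOn Prod.snd (M : Set (Fin n₁ × Fin n₂)) :=
  fun e he f hf hef => h.2 e he f hf (Or.inr hef)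

theorem IsMatching.card_le_matchingNumber (h : IsMatching E M) : M.card ≤ matchingNumber E := by
  classical
  unfold matchingNumber
  refine Finset.le_sup (f := Finset.card) ?_
  rw [Finset.mem_filter]
  exact ⟨Finset.mem_powerset.2 h.1, h⟩

/-- Weak duality: distinct matching edges are covered by distinct nodes. -/
theorem IsMatching.card_le_cover (hN : IsMatching E N) {C₁ : Finset (Fin n₁)} {C₂ : Finset (Fin n₂)}
    (hC : ∀ e ∈ E, e.1 ∈ C₁ ∨ e.2 ∈ C₂) : N.card ≤ C₁.card + C₂.card := by
  classical
  have h1 : (N.filter fun e => e.1 ∈ C₁).card ≤ C₁.card :=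
    Finset.card_le_card_of_injOn Prod.fst (fun e he => (Finset.mem_filter.1 he).2)
      (hN.injOn_fst.mono fun e he => (Finset.mem_filter.1 he).1)
  have h2 : (N.filter fun e => ¬ e.1 ∈ C₁).card ≤ C₂.card :=
    Finset.card_le_card_of_injOn Prod.snd
      (fun e he => (hC e (hN.1 (Finset.mem_filter.1 he).1)).resolve_left (Finset.mem_filter.1 he).2)
      (hN.injOn_snd.mono fun e he => (Finset.mem_filter.1 he).1)
  have := Finset.card_filter_add_card_filter_not (s := N) (fun e => e.1 ∈ C₁)
  omega

/-! ### Distances from the unmatched nodes of `V₁` along alternating walks -/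

/-- `j` is the end of an alternating walk with `2 t + 1` edges from an unmatched node of `V₁`. -/
def AltReach (H M : Finset (Fin n₁ × Fin n₂)) : ℕ → Fin n₂ → Prop
  | 0, j => ∃ i, (∀ j', (i, j') ∉ M) ∧ (i, j) ∈ H
  | t + 1, j => ∃ i j', AltReach H M t j' ∧ (i, j') ∈ M ∧ (i, j) ∈ H

open Classical in
/-- One plus the least `t` with `AltReach H M t j`, and `0` if there is none. -/
noncomputable def label (H M : Finset (Fin n₁ × Fin n₂)) (j : Fin n₂) : ℕ :=
  if h : ∃ t, AltReach H M t j then Nat.find h + 1 else 0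

open Classical in
/-- The layer of a node of `V₁`; it is `1` for unmatched and `0` for unreachable nodes. -/
noncomputable def level (H M : Finset (Fin n₁ × Fin n₂)) (i : Fin n₁) : ℕ :=
  if h : ∃ j, (i, j) ∈ M then (if label H M h.choose = 0 then 0 else label H M h.choose + 1) else 1

theorem level_of_free {i : Fin n₁} (h : ∀ j, (i, j) ∉ M) : level H M i = 1 := by
  simp [level, h]

theorem level_of_mem (hM : IsMatching H M) {i : Fin n₁} {j : Fin n₂} (h : (i, j) ∈ M) :
    level H M i = if label H M j = 0 then 0 else label H M j + 1 := by
  have hex : ∃ j, (i, j) ∈ M := ⟨j, h⟩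
  have : hex.choose = j := hM.right_unique hex.choose_spec h
  simp only [level, hex, dif_pos]
  rw [this]

theorem level_eq_one (hM : IsMatching H M) {i : Fin n₁} : level H M i = 1 ↔ ∀ j, (i, j) ∉ M := by
  refine ⟨fun h j hj => ?_, level_of_free⟩
  rw [level_of_mem hM hj] at h
  split_ifs at h; omega

theorem label_le_of_reach {t : ℕ} {j : Fin n₂} (h : AltReach H M t j) :
    label H M j ≠ 0 ∧ label H M j ≤ t + 1 := by
  classical
  have hex : ∃ t, AltReach H M t j := ⟨t, h⟩
  simp only [label, hex, dif_pos]
  exact ⟨by omega, Nat.succ_le_succ (Nat.find_min' hex h)⟩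

theorem reach_of_label {j : Fin n₂} {t : ℕ} (h : label H M j = t + 1) : AltReach H M t j := by
  classical
  unfold label at h
  split_ifs at h with hex
  have := Nat.find_spec hex
  rwa [show Nat.find hex = t by omega] at this

/-- A walk that reaches `i` can be prolonged by the edge to `j`. This inequality drives all later
layer arguments; equality marks the edges that a shortest path may use. -/
theorem label_le_level (hM : IsMatching H M) {i : Fin n₁} {j : Fin n₂} (he : (i, j) ∈ H)
    (hi : level H M i ≠ 0) : label H M j ≠ 0 ∧ label H M j ≤ level H M i := by
  by_cases hf : ∀ j', (i, j') ∉ M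
  · rw [level_of_free hf]
    exact label_le_of_reach (t := 0) ⟨i, hf, he⟩
  · push Not at hf
    obtain ⟨j', hj'⟩ := hf
    have hl := level_of_mem hM hj'
    rw [hl] at hi ⊢
    split_ifs at hi ⊢ with h0
    · omega
    · obtain ⟨t, ht⟩ := Nat.exists_eq_succ_of_ne_zero h0
      rw [ht]
      exact label_le_of_reach (t := t + 1) ⟨i, j', reach_of_label ht, hj', he⟩

/-- The last edge of a shortest walk is tight: an earlier layer for its tail would give `j` a
smaller label. -/
theorem exists_of_label (hM : IsMatching H M) {j : Fin n₂} (hj : label H M j ≠ 0) :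
    ∃ i, (i, j) ∈ H ∧ level H M i = label H M j := by
  obtain ⟨t, ht⟩ := Nat.exists_eq_succ_of_ne_zero hj
  have hr := reach_of_label ht
  cases t with
  | zero =>
    obtain ⟨i, hf, he⟩ := hr
    exact ⟨i, he, by rw [level_of_free hf, ht]⟩
  | succ t =>
    obtain ⟨i, j', hj', hm, he⟩ := hr
    have h1 := label_le_of_reach hj'
    have hl := level_of_mem hM hm
    rw [if_neg h1.1] at hl
    have h2 := label_le_level hM he (by omega)
    exact ⟨i, he, by omega⟩

/-- An alternating path along the layers, listed from its last edge. -/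
def AltStack (H M : Finset (Fin n₁ × Fin n₂)) : List (Fin n₁ × Fin n₂) → Prop
  | [] => True
  | e :: fs => e ∈ H ∧ level H M e.1 = fs.length + 1 ∧ label H M e.2 = fs.length + 1 ∧
      (∀ f ∈ fs.head?, (e.1, f.2) ∈ M) ∧ AltStack H M fs

theorem exists_altStack (hM : IsMatching H M) {j : Fin n₂} (hj : label H M j ≠ 0) :
    ∃ i fs, AltStack H M ((i, j) :: fs) ∧ fs.length + 1 = label H M j := by
  obtain ⟨t, ht⟩ := Nat.exists_eq_succ_of_ne_zero hj
  induction t generalizing j with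
  | zero =>
    obtain ⟨i, he, hi⟩ := exists_of_label hM hj
    exact ⟨i, [], by simp [AltStack, he, hi, ht], by simp [ht]⟩
  | succ t ih =>
    obtain ⟨i, he, hi⟩ := exists_of_label hM hj
    have hnf : ¬ ∀ j', (i, j') ∉ M := fun h => by rw [← level_eq_one hM] at h; omega
    push Not at hnf
    obtain ⟨j', hj'⟩ := hnf
    have hl := level_of_mem hM hj'
    split_ifs at hl with h0
    · omega
    obtain ⟨i', fs, hs, hlen⟩ := ih h0 (by omega)
    exact ⟨i, (i', j') :: fs, ⟨he, by simp; omega, by simp; omega, by simpa using hj', hs⟩,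
      by simp; omega⟩

/-- The layers along the stack are 1, 2, 3, …; this is what makes the nodes of the path distinct. -/
theorem AltStack.level_map {fs : List (Fin n₁ × Fin n₂)} (h : AltStack H M fs) :
    fs.reverse.map (fun e => level H M e.1) = List.range' 1 fs.length := by
  induction fs with
  | nil => rfl
  | cons e fs ih =>
    obtain ⟨-, h1, -, -, h2⟩ := h
    simp [ih h2, h1, List.range'_concat, add_comm]

theorem AltStack.label_map {fs : List (Fin n₁ × Fin n₂)} (h : AltStack H M fs) :
    fs.reverse.map (fun e => label H M e.2) = List.range' 1 fs.length := by
  induction fs with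
  | nil => rfl
  | cons e fs ih =>
    obtain ⟨-, -, h1, -, h2⟩ := h
    simp [ih h2, h1, List.range'_concat, add_comm]

theorem AltStack.mem_edge (hM : IsMatching H M) {fs : List (Fin n₁ × Fin n₂)} (h : AltStack H M fs) :
    ∀ e ∈ fs, e ∈ H ∧ e ∉ M := by
  induction fs with
  | nil => simp
  | cons e fs ih =>
    obtain ⟨h0, h1, h2, -, h3⟩ := h
    intro f hf
    rcases List.mem_cons.1 hf with rfl | hf
    · refine ⟨h0, fun hm => ?_⟩
      have := level_of_mem hM (i := f.1) (j := f.2) hm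
      split_ifs at this <;> omega
    · exact ih h3 f hf

theorem AltStack.chain {fs : List (Fin n₁ × Fin n₂)} (h : AltStack H M fs) :
    fs.IsChain (fun f e => (f.1, e.2) ∈ M) := by
  induction fs with
  | nil => simp
  | cons e fs ih =>
    obtain ⟨-, -, -, h2, h3⟩ := h
    cases fs with
    | nil => simp
    | cons f fs => exact List.isChain_cons_cons.2 ⟨h2 f (by simp), ih h3⟩

theorem AltStack.level_last {fs : List (Fin n₁ × Fin n₂)} (h : AltStack H M fs) :
    ∀ e ∈ fs.getLast?, level H M e.1 = 1 := by
  induction fs with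
  | nil => simp
  | cons e fs ih =>
    obtain ⟨-, h1, -, -, h3⟩ := h
    cases fs with
    | nil => simpa using h1
    | cons f fs => rw [List.getLast?_cons_cons]; exact ih h3

theorem AltStack.isAugPath (hM : IsMatching H M) {i : Fin n₁} {j : Fin n₂}
    {fs : List (Fin n₁ × Fin n₂)} (h : AltStack H M ((i, j) :: fs)) (hj : ∀ i', (i', j) ∉ M) :
    IsAugPath H M ((i, j) :: fs).reverse := by
  refine ⟨by simp, ?_, ?_, ?_, ?_, ?_, ?_⟩
  · apply List.Nodup.of_map (level H M)
    rw [List.map_map]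
    have := h.level_map
    rw [show (level H M ∘ Prod.fst) = fun e : Fin n₁ × Fin n₂ => level H M e.1 from rfl, this]
    exact List.nodup_range'
  · apply List.Nodup.of_map (label H M)
    rw [List.map_map]
    have := h.label_map
    rw [show (label H M ∘ Prod.snd) = fun e : Fin n₁ × Fin n₂ => label H M e.2 from rfl, this]
    exact List.nodup_range'
  · intro e he
    exact h.mem_edge hM e (List.mem_reverse.1 he)
  · rw [List.isChain_reverse]
    exact h.chain
  · intro e he
    rw [List.head?_reverse] at he
    rw [covered_inl]
    push Not
    exact (level_eq_one hM).1 (h.level_last e he)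
  · intro e he
    rw [List.getLast?_reverse] at he
    simp at he
    subst he
    rw [covered_inr]
    push Not
    exact hj

theorem IsAugPath.edge {P : List (Fin n₁ × Fin n₂)} (h : IsAugPath H M P) {e : Fin n₁ × Fin n₂}
    (he : e ∈ P) : e ∈ H ∧ e ∉ M := h.2.2.2.1 e he

theorem IsAugPath.chain_get {P : List (Fin n₁ × Fin n₂)} (h : IsAugPath H M P) {k : ℕ}
    (hk : k + 1 < P.length) : (P[k + 1].1, P[k].2) ∈ M :=
  List.isChain_iff_getElem.1 h.2.2.2.2.1 k hk

theorem IsAugPath.length_pos {P : List (Fin n₁ × Fin n₂)} (h : IsAugPath H M P) : 0 < P.length :=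
  List.length_pos_of_ne_nil h.1

theorem IsAugPath.head_free {P : List (Fin n₁ × Fin n₂)} (h : IsAugPath H M P) (j : Fin n₂) :
    ((P[0]'h.length_pos).1, j) ∉ M := by
  have := h.2.2.2.2.2.1 (P[0]'h.length_pos)
    (by simp [List.head?_eq_getElem?])
  rw [covered_inl] at this
  exact fun hj => this ⟨j, hj⟩

theorem IsAugPath.last_free {P : List (Fin n₁ × Fin n₂)} (h : IsAugPath H M P) (i : Fin n₁) :
    (i, (P[P.length - 1]'(Nat.sub_lt h.length_pos one_pos)).2) ∉ M := by
  have := h.2.2.2.2.2.2 (P[P.length - 1]'(Nat.sub_lt h.length_pos one_pos))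
    (by simp [List.getLast?_eq_getElem?])
  rw [covered_inr] at this
  exact fun hj => this ⟨i, hj⟩

/-- Layers rise by at most one per round along any augmenting path, so no augmenting path is shorter
than the layers say. -/
theorem IsAugPath.label_le (hM : IsMatching H M) {P : List (Fin n₁ × Fin n₂)} (h : IsAugPath H M P)
    (k : ℕ) (hk : k < P.length) :
    (level H M P[k].1 ≠ 0 ∧ level H M P[k].1 ≤ k + 1) ∧
      (label H M P[k].2 ≠ 0 ∧ label H M P[k].2 ≤ k + 1) := by
  induction k with
  | zero =>
    have h1 : level H M P[0].1 = 1 := level_of_free h.head_free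
    have h2 := label_le_level hM (i := P[0].1) (j := P[0].2) (h.edge (List.getElem_mem hk)).1 (by omega)
    omega
  | succ k ih =>
    have ih := (ih (by omega)).2
    have h1 := level_of_mem hM (h.chain_get hk)
    rw [if_neg ih.1] at h1
    have h2 := label_le_level hM (i := P[k + 1].1) (j := P[k + 1].2)
      (h.edge (List.getElem_mem hk)).1 (by omega)
    omega

/-- `K` is the number of `V₁`-nodes on a shortest augmenting path. -/
def ShortestLabel (H M : Finset (Fin n₁ × Fin n₂)) (K : ℕ) : Prop :=
  K ≠ 0 ∧ (∃ j, (∀ i, (i, j) ∉ M) ∧ label H M j = K) ∧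
    ∀ j, (∀ i, (i, j) ∉ M) → label H M j ≠ 0 → K ≤ label H M j

theorem ShortestLabel.le_length (hM : IsMatching H M) {K : ℕ} (hK : ShortestLabel H M K)
    {P : List (Fin n₁ × Fin n₂)} (h : IsAugPath H M P) : K ≤ P.length := by
  have := h.label_le hM (P.length - 1) (Nat.sub_lt h.length_pos one_pos)
  have h2 := hK.2.2 _ h.last_free this.2.1
  have := h.length_pos
  omega

theorem ShortestLabel.exists_path (hM : IsMatching H M) {K : ℕ} (hK : ShortestLabel H M K) :
    ∃ P, IsAugPath H M P ∧ P.length = K := by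
  obtain ⟨j, hj, hl⟩ := hK.2.1
  obtain ⟨i, fs, hs, hlen⟩ := exists_altStack hM (j := j) (by rw [hl]; exact hK.1)
  exact ⟨_, hs.isAugPath hM hj, by simp; omega⟩

theorem ShortestLabel.isShortest_iff (hM : IsMatching H M) {K : ℕ} (hK : ShortestLabel H M K)
    {P : List (Fin n₁ × Fin n₂)} :
    IsShortestAugPath H M P ↔ IsAugPath H M P ∧ P.length = K := by
  constructor
  · intro h
    obtain ⟨Q, hQ, hl⟩ := hK.exists_path hM
    have h1 := h.2 Q hQ
    have h2 := hK.le_length hM h.1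
    exact ⟨h.1, by omega⟩
  · rintro ⟨h, rfl⟩
    exact ⟨h, fun Q hQ => hK.le_length hM hQ⟩

/-- Layers rise by at most one per round from 1, and the free end has label at least K after K
rounds; so no round can lose anything. -/
theorem ShortestLabel.levels (hM : IsMatching H M) {K : ℕ} (hK : ShortestLabel H M K)
    {P : List (Fin n₁ × Fin n₂)} (h : IsAugPath H M P) (hl : P.length = K) (k : ℕ)
    (hk : k < P.length) : level H M P[k].1 = k + 1 ∧ label H M P[k].2 = k + 1 := by
  -- Lower bound by induction on the distance `d` from the free end in V₂.
  have key : ∀ d, ∀ k (hk : k < P.length), k + d + 1 = P.length → k + 1 ≤ label H M P[k].2 := by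
    intro d
    induction d with
    | zero =>
      intro k hk hd
      have h1 := h.label_le hM k hk
      have h3 := h.last_free
      have h2 := hK.2.2 P[k].2 (by
        have : P.length - 1 = k := by omega
        simpa [this] using h3) h1.2.1
      omega
    | succ d ih =>
      intro k hk hd
      have h1 := ih (k + 1) (by omega) (by omega)
      have h2 := h.label_le hM (k + 1) (by omega)
      have h3 := level_of_mem hM (h.chain_get (k := k) (by omega))
      have h4 := label_le_level hM (i := P[k + 1].1) (j := P[k + 1].2)
        (h.edge (List.getElem_mem (by omega))).1 h2.1.1
      split_ifs at h3 <;> omega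
  have h1 := key (P.length - 1 - k) k hk (by omega)
  have h2 := h.label_le hM k hk
  have h4 := label_le_level hM (i := P[k].1) (j := P[k].2)
        (h.edge (List.getElem_mem hk)).1 h2.1.1
  omega

theorem label_eq_zero_of_no_augPath (hM : IsMatching H M) (h : ∀ P, ¬ IsAugPath H M P) {j : Fin n₂}
    (hj : ∀ i, (i, j) ∉ M) : label H M j = 0 := by
  by_contra h0
  obtain ⟨i, fs, hs, -⟩ := exists_altStack hM h0
  exact h _ (hs.isAugPath hM hj)

theorem no_augPath_of_label (hM : IsMatching H M)
    (h : ∀ j, (∀ i, (i, j) ∉ M) → label H M j = 0) (P : List (Fin n₁ × Fin n₂)) :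
    ¬ IsAugPath H M P := fun hP =>
  (hP.label_le hM (P.length - 1) (Nat.sub_lt hP.length_pos one_pos)).2.1 (h _ hP.last_free)

/-! ### Vertex covers from the layers -/

/-- Cut behind layer `t`: take the nodes of V₁ beyond the cut or unreachable, and the nodes of V₂ in
layers 1, …, t. An edge that escaped would violate `label_le_level`. All chosen nodes are matched,
and a matching edge is counted at both ends only if it joins layer `t` to layer `t + 1`. -/
theorem exists_cover (hM : IsMatching H M) {t : ℕ} (ht : t ≠ 0)
    (h : ∀ j, (∀ i, (i, j) ∉ M) → label H M j = 0 ∨ t < label H M j) :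
    ∃ (C₁ : Finset (Fin n₁)) (C₂ : Finset (Fin n₂)), (∀ e ∈ H, e.1 ∈ C₁ ∨ e.2 ∈ C₂) ∧
      C₁.card + C₂.card ≤ M.card + (M.filter fun e => label H M e.2 = t).card := by
  classical
  refine ⟨Finset.univ.filter fun i => level H M i = 0 ∨ t < level H M i,
    Finset.univ.filter fun j => label H M j ≠ 0 ∧ label H M j ≤ t, ?_, ?_⟩
  · rintro ⟨i, j⟩ he
    simp only [Finset.mem_filter, Finset.mem_univ, true_and]
    by_cases h0 : level H M i = 0
    · exact Or.inl (Or.inl h0)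
    · have := label_le_level hM he h0
      omega
  · have h1 : (Finset.univ.filter fun i => level H M i = 0 ∨ t < level H M i).card ≤
        (M.filter fun e => label H M e.2 = 0 ∨ t ≤ label H M e.2).card := by
      refine (Finset.card_le_card ?_).trans (Finset.card_image_le (f := Prod.fst))
      intro i hi
      simp only [Finset.mem_filter, Finset.mem_univ, true_and] at hi
      have hnf : ¬ ∀ j', (i, j') ∉ M := fun h => by rw [← level_eq_one hM] at h; omega
      push Not at hnf
      obtain ⟨j, hj⟩ := hnf
      have hl := level_of_mem hM hj
      refine Finset.mem_image.2 ⟨(i, j), Finset.mem_filter.2 ⟨hj, ?_⟩, rfl⟩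
      split_ifs at hl with h0
      · exact Or.inl h0
      · right; dsimp only; omega
    have h2 : (Finset.univ.filter fun j => label H M j ≠ 0 ∧ label H M j ≤ t).card ≤
        (M.filter fun e => label H M e.2 ≠ 0 ∧ label H M e.2 ≤ t).card := by
      refine (Finset.card_le_card ?_).trans (Finset.card_image_le (f := Prod.snd))
      intro j hj
      simp only [Finset.mem_filter, Finset.mem_univ, true_and] at hj
      by_cases hf : ∀ i, (i, j) ∉ M
      · have := h j hf; omega
      · push Not at hf
        obtain ⟨i, hi⟩ := hf
        exact Finset.mem_image.2 ⟨(i, j), Finset.mem_filter.2 ⟨hi, hj⟩, rfl⟩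
    have h3 := Finset.card_union_add_card_inter
      (M.filter fun e => label H M e.2 = 0 ∨ t ≤ label H M e.2)
      (M.filter fun e => label H M e.2 ≠ 0 ∧ label H M e.2 ≤ t)
    have h4 : ((M.filter fun e => label H M e.2 = 0 ∨ t ≤ label H M e.2) ∪
      (M.filter fun e => label H M e.2 ≠ 0 ∧ label H M e.2 ≤ t)).card ≤ M.card :=
      Finset.card_le_card (Finset.union_subset (Finset.filter_subset _ _) (Finset.filter_subset _ _))
    have h5 : ((M.filter fun e => label H M e.2 = 0 ∨ t ≤ label H M e.2) ∩
      (M.filter fun e => label H M e.2 ≠ 0 ∧ label H M e.2 ≤ t)).card ≤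
        (M.filter fun e => label H M e.2 = t).card := by
      refine Finset.card_le_card fun e he => ?_
      simp only [Finset.mem_inter, Finset.mem_filter] at he ⊢
      exact ⟨he.1.1, by omega⟩
    omega

theorem exists_cover_of_no_augPath (hM : IsMatching H M) (h : ∀ P, ¬ IsAugPath H M P) :
    ∃ (C₁ : Finset (Fin n₁)) (C₂ : Finset (Fin n₂)), (∀ e ∈ H, e.1 ∈ C₁ ∨ e.2 ∈ C₂) ∧
      C₁.card + C₂.card ≤ M.card := by
  classical
  -- Cut beyond all layers, so that no matching edge is counted twice.
  obtain ⟨C₁, C₂, h1, h2⟩ := exists_cover hM (t := Finset.univ.sup (label H M) + 1) (by omega)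
    (fun j hj => Or.inl (label_eq_zero_of_no_augPath hM h hj))
  refine ⟨C₁, C₂, h1, h2.trans_eq ?_⟩
  rw [Finset.filter_eq_empty_iff.2]
  · simp
  · intro e _ he
    have := Finset.le_sup (f := label H M) (Finset.mem_univ e.2)
    omega

/-- Each of the cuts 1, …, K - 1 lies before the first free node of V₂, so by duality its layer
contains at least as many matching edges as the deficit. The layers are disjoint parts of `M`. -/
theorem ShortestLabel.mul_deficit_le (hM : IsMatching H M) {K : ℕ} (hK : ShortestLabel H M K)
    (hN : IsMatching H N) : (K - 1) * (N.card - M.card) ≤ M.card := by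
  classical
  have key : ∀ t ∈ Finset.Icc 1 (K - 1), N.card - M.card ≤ (M.filter fun e => label H M e.2 = t).card := by
    intro t ht
    rw [Finset.mem_Icc] at ht
    obtain ⟨C₁, C₂, h1, h2⟩ := exists_cover hM (t := t) (by omega) (fun j hj => by
      by_cases h0 : label H M j = 0
      · exact Or.inl h0
      · have := hK.2.2 j hj h0; omega)
    have := hN.card_le_cover h1
    omega
  have h1 := Finset.sum_le_sum key
  rw [Finset.sum_const, Nat.card_Icc, smul_eq_mul, Nat.add_sub_cancel] at h1
  refine h1.trans ?_
  rw [← Finset.card_biUnion]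
  · exact Finset.card_le_card (Finset.biUnion_subset.2 fun t _ => Finset.filter_subset _ _)
  · intro s _ t _ hst
    rw [Function.onFun, Finset.disjoint_left]
    intro e h1 h2
    exact hst ((Finset.mem_filter.1 h1).2.symm.trans (Finset.mem_filter.1 h2).2)

/-! ### Augmenting along disjoint paths -/

theorem mem_pathEdges {P : List (Fin n₁ × Fin n₂)} {e : Fin n₁ × Fin n₂} :
    e ∈ pathEdges P ↔ e ∈ P ∨ ∃ k, ∃ h : k + 1 < P.length, e = (P[k + 1].1, P[k].2) := by
  unfold pathEdges
  rw [Finset.mem_union, List.mem_toFinset, List.mem_toFinset]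
  refine or_congr_right ?_
  rw [List.mem_iff_getElem]
  constructor
  · rintro ⟨k, hk, rfl⟩
    simp at hk
    exact ⟨k, by omega, by simp⟩
  · rintro ⟨k, hk, rfl⟩
    exact ⟨k, by simp; omega, by simp⟩

/-- A matching edge that touches the path lies on it, because the ends of the path are free and
every other node already has its matching edge on the path. -/
theorem IsAugPath.mem_pathEdges_of_mem (hM : IsMatching H M) {P : List (Fin n₁ × Fin n₂)}
    (hP : IsAugPath H M P) {e : Fin n₁ × Fin n₂} (he : e ∈ M) :
    e ∈ pathEdges P ↔ ∃ f ∈ P, e.1 = f.1 ∨ e.2 = f.2 := by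
  rw [mem_pathEdges]
  constructor
  · rintro (h | ⟨k, hk, rfl⟩)
    · exact absurd he (hP.edge h).2
    · exact ⟨P[k], List.getElem_mem _, Or.inr rfl⟩
  · rintro ⟨f, hf, h⟩
    obtain ⟨k, hk, rfl⟩ := List.getElem_of_mem hf
    right
    rcases h with h | h
    · cases k with
      | zero => exact absurd (by rw [← h]; exact he) (hP.head_free e.2)
      | succ k =>
        refine ⟨k, hk, hM.2 _ he _ (hP.chain_get hk) (Or.inl h)⟩
    · by_cases hk' : k + 1 < P.length
      · exact ⟨k, hk', hM.2 _ he _ (hP.chain_get hk') (Or.inr h)⟩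
      · have : P.length - 1 = k := by omega
        have h2 := hP.last_free e.1
        simp only [this, ← h] at h2
        exact absurd he h2

/-- Replaces the symmetric difference by a usable description: the listed edges of the paths enter,
and the old edges off all paths stay. -/
theorem mem_augment (hM : IsMatching H M) {Ps : Finset (List (Fin n₁ × Fin n₂))}
    (hPs : ∀ P ∈ Ps, IsAugPath H M P) {e : Fin n₁ × Fin n₂} :
    e ∈ symmDiff M (Ps.biUnion pathEdges) ↔
      (∃ P ∈ Ps, e ∈ P) ∨ (e ∈ M ∧ ∀ P ∈ Ps, ∀ f ∈ P, e.1 ≠ f.1 ∧ e.2 ≠ f.2) := by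
  rw [Finset.mem_symmDiff, Finset.mem_biUnion]
  by_cases he : e ∈ M
  · simp only [he, not_true_eq_false, and_false, or_false, true_and]
    constructor
    · intro h
      right
      intro P hP f hf
      have := mt ((hPs P hP).mem_pathEdges_of_mem hM he).2 fun h' => h ⟨P, hP, h'⟩
      push Not at this
      exact this f hf
    · rintro (⟨P, hP, h⟩ | h) ⟨Q, hQ, hQe⟩
      · exact absurd he ((hPs P hP).edge h).2
      · obtain ⟨f, hf, hef⟩ := ((hPs Q hQ).mem_pathEdges_of_mem hM he).1 hQe
        have := h Q hQ f hf
        tauto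
  · simp only [he, not_false_eq_true, and_true, false_and, false_or, or_false]
    refine exists_congr fun P => and_congr_right fun hP => ?_
    rw [mem_pathEdges]
    refine or_iff_left ?_
    rintro ⟨k, hk, rfl⟩
    exact he ((hPs P hP).chain_get hk)

theorem NodeDisjoint.symm {P Q : List (Fin n₁ × Fin n₂)} (h : NodeDisjoint P Q) : NodeDisjoint Q P :=
  fun e he f hf => ⟨(h f hf e he).1.symm, (h f hf e he).2.symm⟩

theorem IsAugPath.eq_of_mem {P : List (Fin n₁ × Fin n₂)} (hP : IsAugPath H M P)
    {e f : Fin n₁ × Fin n₂} (he : e ∈ P) (hf : f ∈ P) (h : e.1 = f.1 ∨ e.2 = f.2) : e = f := by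
  rcases h with h | h
  · exact List.inj_on_of_nodup_map hP.2.1 he hf h
  · exact List.inj_on_of_nodup_map hP.2.2.1 he hf h

theorem IsMatching.augment (hM : IsMatching H M) {Ps : Finset (List (Fin n₁ × Fin n₂))}
    (hPs : ∀ P ∈ Ps, IsAugPath H M P) (hd : ∀ P ∈ Ps, ∀ Q ∈ Ps, P ≠ Q → NodeDisjoint P Q) :
    IsMatching H (symmDiff M (Ps.biUnion pathEdges)) := by
  constructor
  · intro e he
    rw [mem_augment hM hPs] at he
    rcases he with ⟨P, hP, he⟩ | he
    · exact ((hPs P hP).edge he).1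
    · exact hM.1 he.1
  · intro e he f hf hef
    rw [mem_augment hM hPs] at he hf
    rcases he with ⟨P, hP, he⟩ | he <;> rcases hf with ⟨Q, hQ, hf⟩ | hf
    · by_cases hPQ : P = Q
      · subst hPQ
        exact (hPs P hP).eq_of_mem he hf hef
      · have := hd P hP Q hQ hPQ e he f hf
        tauto
    · have := hf.2 P hP e he
      rcases hef with h | h <;> simp [h] at this
    · have := he.2 Q hQ f hf
      tauto
    · exact hM.2 e he.1 f hf.1 hef

theorem HKPhase.isMatching (hM : IsMatching H M) {M' : Finset (Fin n₁ × Fin n₂)}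
    (h : HKPhase H M M') : IsMatching H M' := by
  obtain ⟨Ps, -, h1, h2, -, rfl⟩ := h
  exact hM.augment (fun P hP => (h1 P hP).1) h2

/-- Every matched node of V₁ stays matched, and the head of any path becomes matched; sizes are
compared through the projection to V₁. -/
theorem IsMatching.card_lt_augment (hM : IsMatching H M) {Ps : Finset (List (Fin n₁ × Fin n₂))}
    (h1' : ∀ P ∈ Ps, IsAugPath H M P) (h2 : ∀ P ∈ Ps, ∀ Q ∈ Ps, P ≠ Q → NodeDisjoint P Q)
    (hne : Ps.Nonempty) : M.card < (symmDiff M (Ps.biUnion pathEdges)).card := by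
  have hM' := hM.augment h1' h2
  obtain ⟨P, hP⟩ := hne
  set M' := symmDiff M (Ps.biUnion pathEdges) with hdef
  rw [← Finset.card_image_of_injOn hM.injOn_fst, ← Finset.card_image_of_injOn hM'.injOn_fst]
  apply Finset.card_lt_card
  rw [Finset.ssubset_iff_of_subset]
  · have hp := (h1' P hP).length_pos
    refine ⟨P[0].1, Finset.mem_image.2 ⟨P[0], ?_, rfl⟩, ?_⟩
    · exact (mem_augment hM h1').2 (Or.inl ⟨P, hP, List.getElem_mem _⟩)
    · rw [Finset.mem_image]
      rintro ⟨e, he, h⟩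
      exact (h1' P hP).head_free e.2 (by rw [← h]; exact he)
  · intro i hi
    obtain ⟨e, he, rfl⟩ := Finset.mem_image.1 hi
    by_cases hav : ∀ P ∈ Ps, ∀ f ∈ P, e.1 ≠ f.1 ∧ e.2 ≠ f.2
    · exact Finset.mem_image.2 ⟨e, (mem_augment hM h1').2 (Or.inr ⟨he, hav⟩), rfl⟩
    · push Not at hav
      obtain ⟨Q, hQ, f, hf, hef⟩ := hav
      have : e ∈ pathEdges Q := ((h1' Q hQ).mem_pathEdges_of_mem hM he).2 ⟨f, hf, by tauto⟩
      rw [mem_pathEdges] at this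
      rcases this with h | ⟨k, hk, rfl⟩
      · exact absurd he ((h1' Q hQ).edge h).2
      · exact Finset.mem_image.2 ⟨Q[k + 1],
          (mem_augment hM h1').2 (Or.inl ⟨Q, hQ, List.getElem_mem _⟩), rfl⟩

theorem HKPhase.card_lt (hM : IsMatching H M) {M' : Finset (Fin n₁ × Fin n₂)}
    (h : HKPhase H M M') : M.card < M'.card := by
  obtain ⟨Ps, hne, h1, h2, -, rfl⟩ := h
  exact hM.card_lt_augment (fun P hP => (h1 P hP).1) h2 hne

/-- Measure a new augmenting path Q in the old layers. It climbs at most one layer per round, since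
new matching edges stay within a layer; so it has length at least K. With length K it climbs in
every round, hence uses only old matching edges and was a shortest path before the phase. By
maximality it meets a chosen path P at some node. The new matching edge there is flat because it
belongs to P, yet Q either climbs along it or ends at a free node. -/
theorem HKPhase.lt_length (hM : IsMatching H M) {M' : Finset (Fin n₁ × Fin n₂)} {K : ℕ}
    (hK : ShortestLabel H M K) (h : HKPhase H M M') {Q : List (Fin n₁ × Fin n₂)}
    (hQ : IsAugPath H M' Q) : K < Q.length := by
  have hM' := h.isMatching hM
  obtain ⟨Ps, -, h1, h2, h3, rfl⟩ := h
  have h1' := fun P hP => (h1 P hP).1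
  set M' := symmDiff M (Ps.biUnion pathEdges) with hdef
  have hlev : ∀ P ∈ Ps, ∀ e ∈ P, level H M e.1 = label H M e.2 ∧ level H M e.1 ≠ 0 := by
    intro P hP e he
    obtain ⟨k, hk, rfl⟩ := List.getElem_of_mem he
    have := hK.levels hM (h1' P hP) ((hK.isShortest_iff hM).1 (h1 P hP)).2 k hk
    omega
  -- new matching edges do not climb by more than one layer
  have hnew : ∀ i j, (i, j) ∈ M' → label H M j ≠ 0 →
      level H M i ≠ 0 ∧ (level H M i = label H M j ∨ ((i, j) ∈ M ∧ level H M i = label H M j + 1)) := by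
    intro i j he h0
    rcases (mem_augment hM h1').1 he with ⟨P, hP, he⟩ | he
    · have := hlev P hP _ he
      exact ⟨this.2, Or.inl this.1⟩
    · have := level_of_mem hM he.1
      rw [if_neg h0] at this
      exact ⟨by omega, Or.inr ⟨he.1, this⟩⟩
  have hon : ∀ P ∈ Ps, ∀ e ∈ P, e ∈ M' := fun P hP e he =>
    (mem_augment hM h1').2 (Or.inl ⟨P, hP, he⟩)
  -- nodes left free by `M'` are free in `M`
  have hfree₁ : ∀ i, (∀ j, (i, j) ∉ M') → ∀ j, (i, j) ∉ M := by
    intro i hi j hj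
    have h4 := mt (mem_augment hM h1').2 (hi j)
    push Not at h4
    obtain ⟨P, hP, f, hf, hef⟩ := h4.2 hj
    have : (i, j) ∈ pathEdges P := ((h1' P hP).mem_pathEdges_of_mem hM hj).2 ⟨f, hf, by tauto⟩
    rw [mem_pathEdges] at this
    rcases this with h | ⟨k, hk, h⟩
    · exact (h4.1 P hP h)
    · exact hi P[k + 1].2 (by
        rw [(Prod.mk.inj h).1]; exact hon P hP _ (List.getElem_mem _))
  have hfree₂ : ∀ j, (∀ i, (i, j) ∉ M') → ∀ i, (i, j) ∉ M := by
    intro j hj i hi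
    have h4 := mt (mem_augment hM h1').2 (hj i)
    push Not at h4
    obtain ⟨P, hP, f, hf, hef⟩ := h4.2 hi
    have : (i, j) ∈ pathEdges P := ((h1' P hP).mem_pathEdges_of_mem hM hi).2 ⟨f, hf, by tauto⟩
    rw [mem_pathEdges] at this
    rcases this with h | ⟨k, hk, h⟩
    · exact (h4.1 P hP h)
    · exact hj P[k].1 (by
        rw [(Prod.mk.inj h).2]; exact hon P hP _ (List.getElem_mem _))
  have hup : ∀ k (hk : k < Q.length), (level H M Q[k].1 ≠ 0 ∧ level H M Q[k].1 ≤ k + 1) ∧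
      (label H M Q[k].2 ≠ 0 ∧ label H M Q[k].2 ≤ level H M Q[k].1) := by
    intro k
    induction k with
    | zero =>
      intro hk
      have h4 : level H M Q[0].1 = 1 := level_of_free (hfree₁ _ hQ.head_free)
      have h5 := label_le_level hM (i := Q[0].1) (j := Q[0].2) (hQ.edge (List.getElem_mem hk)).1
        (by omega)
      exact ⟨by omega, h5⟩
    | succ k ih =>
      intro hk
      have ih := ih (by omega)
      have h4 := hnew _ _ (hQ.chain_get hk) ih.2.1
      have h5 := label_le_level hM (i := Q[k + 1].1) (j := Q[k + 1].2)
        (hQ.edge (List.getElem_mem hk)).1 h4.1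
      exact ⟨by omega, h5⟩
  have hlen := hQ.length_pos
  have hlast := hK.2.2 _ (hfree₂ _ hQ.last_free)
    (hup (Q.length - 1) (Nat.sub_lt hlen one_pos)).2.1
  have hle : K ≤ Q.length := by
    have := hup (Q.length - 1) (Nat.sub_lt hlen one_pos)
    omega
  refine lt_of_le_of_ne hle fun hKQ => ?_
  -- In the case of equality, go back from the free end: the upper bounds `hup` are all attained.
  have heq : ∀ d, ∀ k (hk : k < Q.length), k + d + 1 = Q.length →
      level H M Q[k].1 = k + 1 ∧ label H M Q[k].2 = k + 1 := by
    intro d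
    induction d with
    | zero =>
      intro k hk hd
      have h4 := hup k hk
      have : Q.length - 1 = k := by omega
      simp only [this] at hlast
      omega
    | succ d ih =>
      intro k hk hd
      have h4 := ih (k + 1) (by omega) (by omega)
      have h5 := hup k hk
      have h6 := hnew _ _ (hQ.chain_get (k := k) (by omega)) h5.2.1
      omega
  have heq' : ∀ k (hk : k < Q.length), level H M Q[k].1 = k + 1 ∧ label H M Q[k].2 = k + 1 :=
    fun k hk => heq (Q.length - 1 - k) k hk (by omega)
  have hchain : ∀ k (hk : k + 1 < Q.length), (Q[k + 1].1, Q[k].2) ∈ M := by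
    intro k hk
    have h4 := heq' k (by omega)
    have h5 := heq' (k + 1) hk
    have h6 := hnew _ _ (hQ.chain_get hk) (by omega)
    rcases h6.2 with h | h
    · omega
    · exact h.1
  have hQM : IsAugPath H M Q := by
    refine ⟨hQ.1, hQ.2.1, hQ.2.2.1, ?_, ?_, ?_, ?_⟩
    · intro e he
      refine ⟨(hQ.edge he).1, fun hm => ?_⟩
      obtain ⟨k, hk, rfl⟩ := List.getElem_of_mem he
      have h4 := heq' k hk
      have h5 := level_of_mem hM (i := Q[k].1) (j := Q[k].2) hm
      split_ifs at h5 <;> omega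
    · exact List.isChain_iff_getElem.2 hchain
    · intro e he
      have := hQ.2.2.2.2.2.1 e he
      rw [covered_inl] at this ⊢
      push Not at this ⊢
      exact hfree₁ _ this
    · intro e he
      have := hQ.2.2.2.2.2.2 e he
      rw [covered_inr] at this ⊢
      push Not at this ⊢
      exact hfree₂ _ this
  -- Maximality of the chosen set enters here; `e` and `f` are edges of P and Q with a common node.
  obtain ⟨P, hP, hPQ⟩ := h3 Q ((hK.isShortest_iff hM).2 ⟨hQM, hKQ.symm⟩)
  unfold NodeDisjoint at hPQ
  push Not at hPQ
  obtain ⟨e, he, f, hf, hef⟩ := hPQ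
  obtain ⟨k, hk, rfl⟩ := List.getElem_of_mem hf
  have heM' := hon P hP e he
  have hle := hlev P hP e he
  by_cases h4 : e.1 = Q[k].1
  · cases k with
    | zero => exact hQ.head_free e.2 (by rw [← h4]; exact heM')
    | succ k =>
      have h5 := hM'.2 _ heM' _ (hQ.chain_get hk) (Or.inl h4)
      have h6 := heq' k (by omega)
      have h7 := heq' (k + 1) hk
      rw [h5] at hle
      dsimp only at hle
      omega
  · have h4 := hef h4
    by_cases hk' : k + 1 < Q.length
    · have h5 := hM'.2 _ heM' _ (hQ.chain_get hk') (Or.inr h4)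
      have h6 := heq' k hk
      have h7 := heq' (k + 1) hk'
      rw [h5] at hle
      dsimp only at hle
      omega
    · have : Q.length - 1 = k := by omega
      have h5 := hQ.last_free e.1
      simp only [this, ← h4] at h5
      exact h5 heM'

theorem HKPhase.shortestLabel_lt (hM : IsMatching H M) {M' : Finset (Fin n₁ × Fin n₂)} {K K' : ℕ}
    (hK : ShortestLabel H M K) (h : HKPhase H M M') (hK' : ShortestLabel H M' K') : K < K' := by
  obtain ⟨Q, hQ, hl⟩ := hK'.exists_path (h.isMatching hM)
  rw [← hl]
  exact h.lt_length hM hK hQ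

/-! ### The reduced graph -/

theorem exists_covered_of_maximal (h : Maximal (IsMatching E) M) {e : Fin n₁ × Fin n₂} (he : e ∈ E) :
    Covered M (Sum.inl e.1) ∨ Covered M (Sum.inr e.2) := by
  by_contra hcon
  push Not at hcon
  rw [covered_inl, covered_inr] at hcon
  push Not at hcon
  have hins : IsMatching E (insert e M) := by
    refine ⟨Finset.insert_subset he h.1.1, fun a ha b hb hab => ?_⟩
    rcases Finset.mem_insert.1 ha with rfl | ha' <;> rcases Finset.mem_insert.1 hb with rfl | hb'
    · rfl
    · rcases hab with h' | h'
      · exact absurd hb' (by have := hcon.1 b.2; rw [h'] at this; exact this)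
      · exact absurd hb' (by have := hcon.2 b.1; rw [h'] at this; exact this)
    · rcases hab with h' | h'
      · exact absurd ha' (by have := hcon.1 a.2; rw [← h'] at this; exact this)
      · exact absurd ha' (by have := hcon.2 a.1; rw [← h'] at this; exact this)
    · exact h.1.2 a ha' b hb' hab
  exact hcon.1 e.2 (h.2 hins (Finset.subset_insert e M) (Finset.mem_insert_self e M))

theorem card_le_two_mul_of_maximal (h : Maximal (IsMatching E) M) (hN : IsMatching E N) :
    N.card ≤ 2 * M.card := by
  classical
  have := hN.card_le_cover (C₁ := M.image Prod.fst) (C₂ := M.image Prod.snd) (fun e he => by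
    rcases exists_covered_of_maximal h he with h | h
    · obtain ⟨j, hj⟩ := covered_inl.1 h
      exact Or.inl (Finset.mem_image.2 ⟨_, hj, rfl⟩)
    · obtain ⟨j, hj⟩ := covered_inr.1 h
      exact Or.inr (Finset.mem_image.2 ⟨_, hj, rfl⟩))
  have h1 := Finset.card_image_le (s := M) (f := Prod.fst)
  have h2 := Finset.card_image_le (s := M) (f := Prod.snd)
  omega

theorem mem_edgesAt {v : Fin n₁ ⊕ Fin n₂} {e : Fin n₁ × Fin n₂} :
    e ∈ edgesAt E v ↔ e ∈ E ∧ Inc v e := by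
  simp [edgesAt]

theorem mem_edgesAt_inl {i : Fin n₁} {e : Fin n₁ × Fin n₂} :
    e ∈ edgesAt E (Sum.inl i) ↔ e ∈ E ∧ e.1 = i := by
  simp [edgesAt, Inc, eq_comm]

theorem mem_edgesAt_inr {j : Fin n₂} {e : Fin n₁ × Fin n₂} :
    e ∈ edgesAt E (Sum.inr j) ↔ e ∈ E ∧ e.2 = j := by
  simp [edgesAt, Inc, eq_comm]

theorem IsReducedGraph.subset {Es : Finset (Fin n₁ × Fin n₂)} (h : IsReducedGraph E M Es) :
    Es ⊆ E := by
  obtain ⟨S, hS, hEs⟩ := h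
  intro e he
  obtain ⟨v, hv, hev⟩ := (hEs e).1 he
  have h1 := hS v hv
  have h2 : S v ⊆ edgesAt E v := by
    rcases le_or_gt (edgesAt E v).card (2 * M.card) with h | h
    · rw [h1.1 h]
    · exact (h1.2 h).2.1
  exact (mem_edgesAt.1 (h2 hev)).1

/-- An edge of `E` missed by the König cover of `Es` forces `2 * Mg.card` nodes into the cover,
namely the other ends of a full set `S v`; no matching of `E` is larger than that. -/
theorem IsReducedGraph.isMaximumMatching {Es : Finset (Fin n₁ × Fin n₂)} {Mg : Finset (Fin n₁ × Fin n₂)}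
    (hg : Maximal (IsMatching E) Mg) (h : IsReducedGraph E Mg Es) (hM : IsMatching Es M)
    (hno : ∀ P, ¬ IsAugPath Es M P) : IsMaximumMatching E M := by
  classical
  have hsub := h.subset
  refine ⟨⟨hM.1.trans hsub, hM.2⟩, fun N hN => ?_⟩
  obtain ⟨C₁, C₂, hC, hcard⟩ := exists_cover_of_no_augPath hM hno
  by_cases hE : ∀ e ∈ E, e.1 ∈ C₁ ∨ e.2 ∈ C₂
  · exact (hN.card_le_cover hE).trans hcard
  refine (card_le_two_mul_of_maximal hg hN).trans (le_trans ?_ hcard)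
  push Not at hE
  obtain ⟨e, he, he1, he2⟩ := hE
  obtain ⟨S, hS, hEs⟩ := h
  have hne : ∀ v, Covered Mg v → e ∉ S v := fun v hv hev => by
    have := hC e ((hEs e).2 ⟨v, hv, hev⟩)
    tauto
  -- A node of small degree contributes all its edges and would have put `e` into `Es`.
  have hbig : ∀ v, Covered Mg v → Inc v e → (S v).card = 2 * Mg.card ∧ S v ⊆ edgesAt E v := by
    intro v hv hi
    have h1 := hS v hv
    rcases le_or_gt (edgesAt E v).card (2 * Mg.card) with h | h
    · exfalso
      apply hne v hv
      rw [h1.1 h]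
      exact mem_edgesAt.2 ⟨he, hi⟩
    · exact ⟨(h1.2 h).2.2, (h1.2 h).2.1⟩
  rcases exists_covered_of_maximal hg he with hv | hv
  · obtain ⟨h1, h2⟩ := hbig _ hv (Or.inl rfl)
    have : (S (Sum.inl e.1)).card ≤ C₂.card := by
      refine Finset.card_le_card_of_injOn Prod.snd (fun f hf => ?_) (fun f hf g hg hfg => ?_)
      · have h3 := mem_edgesAt_inl.1 (h2 hf)
        have h4 := hC f ((hEs f).2 ⟨_, hv, hf⟩)
        rw [h3.2] at h4
        exact h4.resolve_left he1
      · have h3 := mem_edgesAt_inl.1 (h2 hf)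
        have h4 := mem_edgesAt_inl.1 (h2 hg)
        exact Prod.ext (h3.2.trans h4.2.symm) hfg
    omega
  · obtain ⟨h1, h2⟩ := hbig _ hv (Or.inr rfl)
    have : (S (Sum.inr e.2)).card ≤ C₁.card := by
      refine Finset.card_le_card_of_injOn Prod.fst (fun f hf => ?_) (fun f hf g hg hfg => ?_)
      · have h3 := mem_edgesAt_inr.1 (h2 hf)
        have h4 := hC f ((hEs f).2 ⟨_, hv, hf⟩)
        rw [h3.2] at h4
        exact h4.resolve_right he2
      · have h3 := mem_edgesAt_inr.1 (h2 hf)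
        have h4 := mem_edgesAt_inr.1 (h2 hg)
        exact Prod.ext hfg (h3.2.trans h4.2.symm)
    omega

theorem IsHKResult.isMaximumMatching {Es Mg : Finset (Fin n₁ × Fin n₂)}
    (hg : Maximal (IsMatching E) Mg) (h : IsReducedGraph E Mg Es) (hM : IsHKResult Es M) :
    IsMaximumMatching E M := by
  refine h.isMaximumMatching hg ?_ hM.2
  obtain ⟨hr, -⟩ := hM
  induction hr with
  | refl => exact IsMatching.empty
  | tail _ hp ih => exact hp.isMatching ih

end Combinatorics


/-! ### A program logic with step counts -/

section Machine

/-- The program `p`, started in `s`, halts, and its final state and number of steps satisfy `Q`. -/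
def Run (p : Prog) (s : State) (Q : State → ℕ → Prop) : Prop :=
  ∃ t s', Exec p s t s' ∧ Q s' t

theorem Run.mono {p : Prog} {s : State} {Q Q' : State → ℕ → Prop} (h : Run p s Q)
    (hQ : ∀ s' t, Q s' t → Q' s' t) : Run p s Q' := by
  obtain ⟨t, s', he, hq⟩ := h
  exact ⟨t, s', he, hQ _ _ hq⟩

theorem run_seq {p q : Prog} {s : State} {Q : State → ℕ → Prop}
    (h : Run p s fun s' t => Run q s' fun s'' t' => Q s'' (t + t')) : Run (.seq p q) s Q := by
  obtain ⟨t, s', he, t', s'', he', hq⟩ := h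
  exact ⟨_, _, he.seq he', hq⟩

theorem run_ite {b : Test} {p q : Prog} {s : State} {Q : State → ℕ → Prop}
    (h1 : b.Holds s → Run p s fun s' t => Q s' (1 + t))
    (h2 : ¬ b.Holds s → Run q s fun s' t => Q s' (1 + t)) : Run (.ite b p q) s Q := by
  by_cases hb : b.Holds s
  · obtain ⟨t, s', he, hq⟩ := h1 hb
    exact ⟨_, _, .iteTrue hb he, hq⟩
  · obtain ⟨t, s', he, hq⟩ := h2 hb
    exact ⟨_, _, .iteFalse hb he, hq⟩

/-- Straight-line code. -/
def block : List Instr → Prog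
  | [] => .instr .skip
  | c :: l => .seq (.instr c) (block l)

/-- The effect of straight-line code. -/
abbrev runList (l : List Instr) (s : State) : State := l.foldl (fun s c => c.run s) s

/-- The closing `skip` costs one step, so a block always costs its length plus one; the cost
constants below contain these extra steps. -/
theorem exec_block (l : List Instr) (s : State) :
    Exec (block l) s (l.length + 1) (l.foldl (fun s c => c.run s) s) := by
  induction l generalizing s with
  | nil => exact .instr .skip s
  | cons c l ih =>
    have := (Exec.instr c s).seq (ih (c.run s))
    rwa [add_comm 1] at this

theorem run_block {l : List Instr} {s : State} {Q : State → ℕ → Prop}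
    (h : Q (l.foldl (fun s c => c.run s) s) (l.length + 1)) : Run (block l) s Q :=
  ⟨_, _, exec_block l s, h⟩

theorem run_block_seq {l : List Instr} {q : Prog} {s : State} {Q : State → ℕ → Prop}
    (h : Run q (l.foldl (fun s c => c.run s) s) fun s' t => Q s' (l.length + 1 + t)) :
    Run (.seq (block l) q) s Q :=
  run_seq (run_block h)

/-- Loop rule: `I s n` says that the invariant holds and that `n` steps suffice for the remaining
rounds. -/
theorem run_loop {b : Test} {p : Prog} (I : State → ℕ → Prop) {s : State} {n : ℕ} (h : I s n)
    (step : ∀ s n, I s n → b.Holds s → Run p s fun s' t => ∃ n', I s' n' ∧ n' + t + 1 ≤ n)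
    {Q : State → ℕ → Prop}
    (done : ∀ s' n' t, I s' n' → ¬ b.Holds s' → n' + t ≤ n + 1 → Q s' t) :
    Run (.loop b p) s Q := by
  -- Each round pays at least for its test, so the budget falls strictly; this also proves
  -- termination. The `+ 1` is the last, failing test.
  suffices H : ∀ n s, I s n → ∃ t s' n', Exec (.loop b p) s t s' ∧ I s' n' ∧ ¬ b.Holds s' ∧
      n' + t ≤ n + 1 by
    obtain ⟨t, s', n', he, hi, hb, ht⟩ := H n s h
    exact ⟨t, s', he, done _ _ _ hi hb ht⟩
  intro n
  induction n using Nat.strong_induction_on with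
  | _ n ih =>
    intro s hs
    by_cases hb : b.Holds s
    · obtain ⟨t, s', he, n', hi, hn⟩ := step s n hs hb
      obtain ⟨t', s'', n'', he', hi', hb', ht'⟩ := ih n' (by omega) s' hi
      exact ⟨_, _, n'', .loopStep hb he he', hi', hb', by omega⟩
    · exact ⟨1, s, n, .loopDone hb, hs, hb, le_refl _⟩

/-- Loop rule for counting loops. -/
theorem run_for {b : Test} {p : Prog} {N : ℕ} (I : ℕ → State → Prop) (cost : Fin N → ℕ) {s : State}
    (h : I 0 s) (hb : ∀ a s, a ≤ N → I a s → (b.Holds s ↔ a < N))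
    (step : ∀ (a : Fin N) s, I a s → Run p s fun s' t => I (a + 1) s' ∧ t ≤ cost a)
    {Q : State → ℕ → Prop} (done : ∀ s' t, I N s' → t ≤ 1 + ∑ a, (cost a + 1) → Q s' t) :
    Run (.loop b p) s Q := by
  -- The costs are extended by zero to all of ℕ, so that the spent part is a sum over an initial
  -- segment.
  let c : ℕ → ℕ := fun a => if h : a < N then cost ⟨a, h⟩ + 1 else 0
  have hc : ∀ a : Fin N, c a = cost a + 1 := fun a => by simp [c]
  have hsum : ∑ a, (cost a + 1) = ∑ a ∈ Finset.range N, c a := by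
    rw [Finset.sum_range]; exact Finset.sum_congr rfl fun a _ => (hc a).symm
  rw [hsum] at done
  refine run_loop (fun s n => ∃ a, a ≤ N ∧ I a s ∧
    n + ∑ x ∈ Finset.range a, c x = ∑ x ∈ Finset.range N, c x) (n := ∑ x ∈ Finset.range N, c x)
    ⟨0, by omega, h, by simp⟩ ?_ ?_
  · rintro s n ⟨a, ha, hI, hn⟩ hbs
    have haN := (hb a s ha hI).1 hbs
    refine (step ⟨a, haN⟩ s hI).mono fun s' t hst => ?_
    have h1 := hc ⟨a, haN⟩
    have h2 := Finset.sum_range_succ c a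
    have h3 : ∑ x ∈ Finset.range (a + 1), c x ≤ ∑ x ∈ Finset.range N, c x :=
      Finset.sum_le_sum_of_subset (Finset.range_subset_range.2 haN)
    simp only at h1
    exact ⟨∑ x ∈ Finset.range N, c x - ∑ x ∈ Finset.range (a + 1), c x,
      ⟨a + 1, haN, hst.1, by omega⟩, by have := hst.2; omega⟩
  · rintro s' n' t ⟨a, ha, hI, hn⟩ hbs ht
    have : a = N := by
      by_contra hne
      exact hbs ((hb a s' ha hI).2 (by omega))
    subst this
    exact done _ _ hI (by omega)

/-- Only the arrays in `A` differ. -/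
def MemFrame (A : List ℕ) (s s' : State) : Prop := ∀ a, a ∉ A → s'.mem a = s.mem a

/-- Only the registers in `R` differ. -/
def RegFrame (R : List ℕ) (s s' : State) : Prop := ∀ r, r ∉ R → s'.reg r = s.reg r

theorem MemFrame.refl (A : List ℕ) (s : State) : MemFrame A s s := fun _ _ => rfl

theorem RegFrame.refl (A : List ℕ) (s : State) : RegFrame A s s := fun _ _ => rfl

end Machine

/-! ### Partner arrays and adjacency lists -/

section Representation

variable {n₁ n₂ : ℕ} {E M : Finset (Fin n₁ × Fin n₂)}

theorem IsLinkedList.eq_nil {nx ky : ℕ → ℕ} {l : List ℕ} (h : IsLinkedList nx ky 0 l) : l = [] := by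
  cases l with
  | nil => rfl
  | cons x l => exact absurd rfl h.1

theorem IsLinkedList.exists_cons {nx ky : ℕ → ℕ} {m p : ℕ} {l : List (Fin m)}
    (h : IsLinkedList nx ky p (l.map Fin.val)) (hp : p ≠ 0) :
    ∃ x l', l = x :: l' ∧ ky p = x ∧ IsLinkedList nx ky (nx p) (l'.map Fin.val) := by
  cases l with
  | nil => exact absurd h hp
  | cons x l' => exact ⟨x, l', rfl, h.2.1, h.2.2⟩

/-- The array `f` holds for each node of `V₁` one plus its partner in `M`, or `0`. -/
def Mates₁ (M : Finset (Fin n₁ × Fin n₂)) (f : ℕ → ℕ) : Prop :=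
  ∀ i : Fin n₁, (f i = 0 ∧ ∀ j, (i, j) ∉ M) ∨ ∃ j, (i, j) ∈ M ∧ f i = j + 1

/-- The array `f` holds for each node of `V₂` one plus its partner in `M`, or `0`. -/
def Mates₂ (M : Finset (Fin n₁ × Fin n₂)) (f : ℕ → ℕ) : Prop :=
  ∀ j : Fin n₂, (f j = 0 ∧ ∀ i, (i, j) ∉ M) ∨ ∃ i, (i, j) ∈ M ∧ f j = i + 1

theorem Mates₁.eq_zero {f : ℕ → ℕ} (h : Mates₁ M f) {i : Fin n₁} : f i = 0 ↔ ∀ j, (i, j) ∉ M := by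
  rcases h i with h | ⟨j, hj, h⟩
  · simp [h]
  · simp only [h, Nat.add_eq_zero_iff, one_ne_zero, and_false, false_iff]
    exact fun h => h j hj

theorem Mates₂.eq_zero {f : ℕ → ℕ} (h : Mates₂ M f) {j : Fin n₂} : f j = 0 ↔ ∀ i, (i, j) ∉ M := by
  rcases h j with h | ⟨i, hi, h⟩
  · simp [h]
  · simp only [h, Nat.add_eq_zero_iff, one_ne_zero, and_false, false_iff]
    exact fun h => h i hi

theorem Mates₁.exists_of_ne {f : ℕ → ℕ} (h : Mates₁ M f) {i : Fin n₁} (hi : f i ≠ 0) :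
    ∃ j, (i, j) ∈ M ∧ f i = j + 1 := by
  rcases h i with h | h
  · exact absurd h.1 hi
  · exact h

theorem Mates₂.exists_of_ne {f : ℕ → ℕ} (h : Mates₂ M f) {j : Fin n₂} (hj : f j ≠ 0) :
    ∃ i, (i, j) ∈ M ∧ f j = i + 1 := by
  rcases h j with h | h
  · exact absurd h.1 hj
  · exact h

theorem Mates₁.eq_of_mem {f : ℕ → ℕ} (h : Mates₁ M f) (hM : IsMatching E M) {i : Fin n₁} {j : Fin n₂}
    (hij : (i, j) ∈ M) : f i = j + 1 := by
  rcases h i with h | ⟨j', hj', h⟩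
  · exact absurd hij (h.2 j)
  · rw [h, hM.right_unique hij hj']

/-- The lists `adj i` enumerate the neighbours of the nodes of `V₁`. -/
def AdjLists₁ (E : Finset (Fin n₁ × Fin n₂)) (adj : Fin n₁ → List (Fin n₂)) : Prop :=
  ∀ i, (adj i).Nodup ∧ ∀ j, j ∈ adj i ↔ (i, j) ∈ E

/-- The lists `adj j` enumerate the neighbours of the nodes of `V₂`. -/
def AdjLists₂ (E : Finset (Fin n₁ × Fin n₂)) (adj : Fin n₂ → List (Fin n₁)) : Prop :=
  ∀ j, (adj j).Nodup ∧ ∀ i, i ∈ adj j ↔ (i, j) ∈ E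

theorem AdjLists₁.length {adj : Fin n₁ → List (Fin n₂)} (h : AdjLists₁ E adj) (i : Fin n₁) :
    (adj i).length = (edgesAt E (Sum.inl i)).card := by
  classical
  have : edgesAt E (Sum.inl i) = (adj i).toFinset.image (fun j => (i, j)) := by
    ext ⟨a, b⟩
    simp only [mem_edgesAt_inl, Finset.mem_image, List.mem_toFinset, (h i).2, Prod.mk.injEq]
    constructor
    · rintro ⟨h1, rfl⟩; exact ⟨b, h1, rfl, rfl⟩
    · rintro ⟨j, h1, rfl, rfl⟩; exact ⟨h1, rfl⟩
  rw [this, Finset.card_image_of_injective _ (Prod.mk_right_injective i),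
    List.toFinset_card_of_nodup (h i).1]

theorem AdjLists₂.length {adj : Fin n₂ → List (Fin n₁)} (h : AdjLists₂ E adj) (j : Fin n₂) :
    (adj j).length = (edgesAt E (Sum.inr j)).card := by
  classical
  have : edgesAt E (Sum.inr j) = (adj j).toFinset.image (fun i => (i, j)) := by
    ext ⟨a, b⟩
    simp only [mem_edgesAt_inr, Finset.mem_image, List.mem_toFinset, (h j).2, Prod.mk.injEq]
    constructor
    · rintro ⟨h1, rfl⟩; exact ⟨a, h1, rfl, rfl⟩
    · rintro ⟨i, h1, rfl, rfl⟩; exact ⟨h1, rfl⟩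
  rw [this, Finset.card_image_of_injective _ (Prod.mk_left_injective j),
    List.toFinset_card_of_nodup (h j).1]

theorem sum_card_edgesAt_inl (s : Finset (Fin n₁)) :
    ∑ i ∈ s, (edgesAt E (Sum.inl i)).card ≤ E.card := by
  classical
  rw [← Finset.card_biUnion]
  · exact Finset.card_le_card (Finset.biUnion_subset.2 fun i _ e he => (mem_edgesAt.1 he).1)
  · intro a _ b _ hab
    rw [Function.onFun, Finset.disjoint_left]
    intro e h1 h2
    exact hab ((mem_edgesAt_inl.1 h1).2.symm.trans (mem_edgesAt_inl.1 h2).2)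

theorem sum_card_edgesAt_inr (s : Finset (Fin n₂)) :
    ∑ j ∈ s, (edgesAt E (Sum.inr j)).card ≤ E.card := by
  classical
  rw [← Finset.card_biUnion]
  · exact Finset.card_le_card (Finset.biUnion_subset.2 fun i _ e he => (mem_edgesAt.1 he).1)
  · intro a _ b _ hab
    rw [Function.onFun, Finset.disjoint_left]
    intro e h1 h2
    exact hab ((mem_edgesAt_inr.1 h1).2.symm.trans (mem_edgesAt_inr.1 h2).2)

theorem HoldsGraph.exists_adj₁ {a : ℕ} {s : State} (h : HoldsGraph a E s) :
    ∃ adj : Fin n₁ → List (Fin n₂), AdjLists₁ E adj ∧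
      ∀ i : Fin n₁, IsLinkedList (s.mem (a + 2)) (s.mem (a + 3)) (s.mem a i) ((adj i).map Fin.val) := by
  choose adj h1 h2 h3 using h.1
  exact ⟨adj, fun i => ⟨h1 i, h2 i⟩, h3⟩

theorem HoldsGraph.exists_adj₂ {a : ℕ} {s : State} (h : HoldsGraph a E s) :
    ∃ adj : Fin n₂ → List (Fin n₁), AdjLists₂ E adj ∧
      ∀ j : Fin n₂, IsLinkedList (s.mem (a + 2)) (s.mem (a + 3)) (s.mem (a + 1) j)
        ((adj j).map Fin.val) := by
  choose adj h1 h2 h3 using h.2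
  exact ⟨adj, fun i => ⟨h1 i, h2 i⟩, h3⟩

end Representation


/-! ### The greedy maximal matching -/

section Greedy

/-- Register 2 is 0 in all programs, so `.lt 2 r` asks whether register `r` is nonzero. Registers 3,
4 and 5 hold the node, the list pointer and the neighbour; register 7 accumulates twice the size of
the matching, the cap of the next stage. Arrays 8 and 11 hold the partners from the two sides,
shifted by one. Setting the pointer to 0 leaves the scan. -/
def greedyScan : Prog :=
  .loop (.lt 2 4) (.seq (block [.load 5 3 4, .load 6 11 5]) (.ite (.eq 6 2)
    (block [.inc 5, .store 8 3 5, .dec 5, .inc 3, .store 11 5 3, .dec 3, .inc 7, .inc 7, .const 4 0])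
    (block [.load 4 2 4])))

def greedyProg : Prog :=
  .seq (block [.const 3 0]) (.loop (.lt 3 0)
    (.seq (block [.load 4 0 3]) (.seq greedyScan (block [.inc 3]))))

variable {n₁ n₂ : ℕ} {E M : Finset (Fin n₁ × Fin n₂)}

structure GreedyInv (E : Finset (Fin n₁ × Fin n₂)) (s₀ : State) (M : Finset (Fin n₁ × Fin n₂))
    (s : State) : Prop where
  isM : IsMatching E M
  r0 : s.reg 0 = n₁
  r2 : s.reg 2 = 0
  r7 : s.reg 7 = 2 * M.card
  m1 : Mates₁ M (s.mem 8)
  m2 : Mates₂ M (s.mem 11)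
  mf : MemFrame [8, 11] s₀ s
  rf : RegFrame [3, 4, 5, 6, 7] s₀ s

theorem Mates₁.insert {f : ℕ → ℕ} (h : Mates₁ M f) {i : Fin n₁} {j : Fin n₂} (hi : ∀ j, (i, j) ∉ M) :
    Mates₁ (insert (i, j) M) (Function.update f i (j + 1)) := by
  intro a
  by_cases ha : a = i
  · subst ha
    exact Or.inr ⟨j, by simp, by simp⟩
  · have hne : (a : ℕ) ≠ i := fun h => ha (Fin.ext h)
    rcases h a with h | ⟨b, hb, h⟩
    · exact Or.inl ⟨by simpa [hne] using h.1, fun b => by simpa [ha] using h.2 b⟩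
    · exact Or.inr ⟨b, by simp [hb], by simpa [hne] using h⟩

theorem Mates₂.insert {f : ℕ → ℕ} (h : Mates₂ M f) {i : Fin n₁} {j : Fin n₂} (hi : ∀ i, (i, j) ∉ M) :
    Mates₂ (insert (i, j) M) (Function.update f j (i + 1)) := by
  intro a
  by_cases ha : a = j
  · subst ha
    exact Or.inr ⟨i, by simp, by simp⟩
  · have hne : (a : ℕ) ≠ j := fun h => ha (Fin.ext h)
    rcases h a with h | ⟨b, hb, h⟩
    · exact Or.inl ⟨by simpa [hne] using h.1, fun b => by simpa [ha] using h.2 b⟩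
    · exact Or.inr ⟨b, by simp [hb], by simpa [hne] using h⟩

theorem IsMatching.insert (h : IsMatching E M) {i : Fin n₁} {j : Fin n₂} (he : (i, j) ∈ E)
    (hi : ∀ j, (i, j) ∉ M) (hj : ∀ i, (i, j) ∉ M) : IsMatching E (insert (i, j) M) := by
  refine ⟨Finset.insert_subset he h.1, ?_⟩
  rintro ⟨a, b⟩ hab ⟨c, d⟩ hcd hor
  rw [Finset.mem_insert, Prod.mk.injEq] at hab hcd
  rcases hab with ⟨rfl, rfl⟩ | hab <;> rcases hcd with ⟨rfl, rfl⟩ | hcd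
  · rfl
  · rcases hor with h | h <;> dsimp only at h <;> subst h
    · exact absurd hcd (hi _)
    · exact absurd hcd (hj _)
  · rcases hor with h | h <;> dsimp only at h <;> subst h
    · exact absurd hab (hi _)
    · exact absurd hab (hj _)
  · exact h.2 _ hab _ hcd hor

theorem length_le_card_of_covered {l : List (Fin n₂)} (hl : l.Nodup)
    (hc : ∀ j ∈ l, ∃ i, (i, j) ∈ M) : l.length ≤ M.card := by
  classical
  rw [← List.toFinset_card_of_nodup hl]
  refine (Finset.card_le_card fun j hj => ?_).trans (Finset.card_image_le (s := M) (f := Prod.snd))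
  obtain ⟨i, hi⟩ := hc j (List.mem_toFinset.1 hj)
  exact Finset.mem_image.2 ⟨_, hi, rfl⟩

/-- The cells passed without success hold distinct matched neighbours, of which there are at most κ;
so at most κ + 1 cells are read. One round costs 15 steps at most. -/
theorem run_greedyScan {s₀ s : State} {adj : Fin n₁ → List (Fin n₂)} (hadj : AdjLists₁ E adj)
    {i : Fin n₁} (hI : GreedyInv E s₀ M s) (h3 : s.reg 3 = i) (hlt : ∀ e ∈ M, e.1 < i)
    (hcov : ∀ e ∈ E, e.1 < i → (∃ j, (e.1, j) ∈ M) ∨ ∃ i', (i', e.2) ∈ M)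
    (hl : IsLinkedList (s₀.mem 2) (s₀.mem 3) (s.reg 4) ((adj i).map Fin.val)) :
    Run greedyScan s fun s' t => t ≤ 1 + 15 * min (adj i).length (matchingNumber E + 1) ∧
      ∃ M', GreedyInv E s₀ M' s' ∧ s'.reg 3 = i ∧ (∀ e ∈ M', e.1 ≤ i) ∧
        ∀ e ∈ E, e.1 ≤ i → (∃ j, (e.1, j) ∈ M') ∨ ∃ i', (i', e.2) ∈ M' := by
  classical
  set D := min (adj i).length (matchingNumber E + 1) with hD
  -- Either the scan goes on, with a prefix `pre` of matched neighbours behind it, or `i` has just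
  -- been matched and the pointer is 0.
  refine run_loop (fun s n => s.reg 3 = i ∧ ∃ M, GreedyInv E s₀ M s ∧
    (∀ e ∈ E, e.1 < i → (∃ j, (e.1, j) ∈ M) ∨ ∃ i', (i', e.2) ∈ M) ∧
    ((∃ pre rem, adj i = pre ++ rem ∧ (∀ e ∈ M, e.1 < i) ∧ (∀ j ∈ pre, ∃ i', (i', j) ∈ M) ∧
      IsLinkedList (s₀.mem 2) (s₀.mem 3) (s.reg 4) (rem.map Fin.val) ∧
      n + 15 * pre.length = 15 * D) ∨
     (s.reg 4 = 0 ∧ (∀ e ∈ M, e.1 ≤ i) ∧ ∃ j, (i, j) ∈ M))) (n := 15 * D)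
    ⟨h3, M, hI, hcov, Or.inl ⟨[], adj i, rfl, hlt, by simp, hl, by simp⟩⟩ ?_ ?_
  · rintro s n ⟨h3, M, hI, hcov, ⟨pre, rem, hpr, hlt, hpre, hl, hn⟩ | h4⟩ hb
    swap
    · simp only [Test.Holds, hI.r2, h4.1] at hb
      exact absurd hb (lt_irrefl _)
    simp only [Test.Holds, hI.r2] at hb
    obtain ⟨j, rem', rfl, hky, hl'⟩ := hl.exists_cons hb.ne'
    -- Before the round there is an unread cell, and the prefix has at most κ entries.
    have hprelen : pre.length < D := by
      have h1 : pre.length < (adj i).length := by rw [hpr]; simp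
      have hnd := (hadj i).1
      rw [hpr] at hnd
      have h2 := length_le_card_of_covered (List.nodup_append.1 hnd).1 hpre
      have h3 := hI.isM.card_le_matchingNumber
      rw [hD, lt_min_iff]
      omega
    have hje : (i, j) ∈ E := by
      rw [← (hadj i).2, hpr]; simp
    have hm3 : s.mem 3 = s₀.mem 3 := hI.mf 3 (by simp)
    have hm2 : s.mem 2 = s₀.mem 2 := hI.mf 2 (by simp)
    have hfree : ∀ j, (i, j) ∉ M := fun j hj => lt_irrefl _ (hlt _ hj)
    refine run_block_seq (run_ite (fun hb' => ?_) fun hb' => ?_)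
    · simp only [Test.Holds, List.foldl, Instr.run, Function.update_apply] at hb'
      simp [hI.r2, hm3, hky, hI.m2.eq_zero] at hb'
      refine run_block ⟨0, ⟨by simp [Instr.run, h3], insert (i, j) M, ?_, ?_, Or.inr ⟨?_, ?_, ?_⟩⟩, ?_⟩
      · refine ⟨hI.isM.insert hje hfree hb', ?_, ?_, ?_, ?_, ?_, ?_, ?_⟩
        · simp [Instr.run, hI.r0]
        · simp [Instr.run, hI.r2]
        · rw [Finset.card_insert_of_notMem (hfree j)]
          simp [Instr.run, hI.r7]
          omega
        · simpa [Instr.run, hm3, hky, h3] using hI.m1.insert hfree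
        · simpa [Instr.run, hm3, hky, h3] using hI.m2.insert hb'
        · intro b hb
          simp at hb
          simp [Instr.run, hb, hI.mf b (by simp [hb])]
        · intro r hr
          simp at hr
          simp [Instr.run, hr, hI.rf r (by simp [hr])]
      · intro e he hei
        rcases hcov e he hei with ⟨a, ha⟩ | ⟨a, ha⟩
        · exact Or.inl ⟨a, Finset.mem_insert_of_mem ha⟩
        · exact Or.inr ⟨a, Finset.mem_insert_of_mem ha⟩
      · simp [Instr.run]
      · intro e he
        rcases Finset.mem_insert.1 he with rfl | he
        · exact le_refl _
        · exact (hlt e he).le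
      · exact ⟨j, Finset.mem_insert_self _ _⟩
      · simp
        omega
    · simp only [Test.Holds, List.foldl, Instr.run, Function.update_apply] at hb'
      simp [hI.r2, hm3, hky, hI.m2.eq_zero] at hb'
      refine run_block ⟨n - 15, ⟨by simp [Instr.run, h3], M, ?_, hcov, Or.inl ⟨pre ++ [j], rem',
        by simp [hpr], hlt, ?_, ?_, ?_⟩⟩, ?_⟩
      · refine ⟨hI.isM, ?_, ?_, ?_, ?_, ?_, ?_, ?_⟩
        · simp [Instr.run, hI.r0]
        · simp [Instr.run, hI.r2]
        · simp [Instr.run, hI.r7]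
        · simpa [Instr.run] using hI.m1
        · simpa [Instr.run] using hI.m2
        · intro b hb
          simp [Instr.run, hI.mf b hb]
        · intro r hr
          simp at hr
          simp [Instr.run, hr, hI.rf r (by simp [hr])]
      · intro j' hj'
        rcases List.mem_append.1 hj' with h | h
        · exact hpre j' h
        · rw [List.mem_singleton.1 h]; exact hb'
      · simpa [Instr.run, hm2] using hl'
      · simp
        omega
      · simp
        omega
  · rintro s' n' t ⟨h3, M, hI, hcov, h⟩ hb ht
    simp only [Test.Holds, hI.r2, not_lt, Nat.le_zero] at hb
    refine ⟨by omega, M, hI, h3, ?_, ?_⟩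
    · rcases h with ⟨pre, rem, -, h, -⟩ | h
      · exact fun e he => (h e he).le
      · exact h.2.1
    · intro e he hei
      rcases hei.lt_or_eq with hei | hei
      · exact hcov e he hei
      · rcases h with ⟨pre, rem, hpr, -, h, hl, -⟩ | h
        · rw [hb] at hl
          have := hl.eq_nil
          simp only [List.map_eq_nil_iff] at this
          subst this
          refine Or.inr (h e.2 ?_)
          rw [← List.append_nil pre, ← hpr, (hadj i).2, ← hei]
          exact he
        · left; rw [hei]; exact h.2.2

theorem maximal_of_covered (hM : IsMatching E M)
    (h : ∀ e ∈ E, (∃ j, (e.1, j) ∈ M) ∨ ∃ i', (i', e.2) ∈ M) : Maximal (IsMatching E) M := by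
  refine ⟨hM, fun N hN hMN e he => ?_⟩
  rcases h e (hN.1 he) with ⟨j, hj⟩ | ⟨i, hi⟩
  · rw [hN.2 e he _ (hMN hj) (Or.inl rfl)]; exact hj
  · rw [hN.2 e he _ (hMN hi) (Or.inr rfl)]; exact hi

theorem run_greedyProg {s₀ : State} {adj : Fin n₁ → List (Fin n₂)} (hadj : AdjLists₁ E adj)
    (hs : IsInput E s₀)
    (hl : ∀ i : Fin n₁, IsLinkedList (s₀.mem 2) (s₀.mem 3) (s₀.mem 0 i) ((adj i).map Fin.val)) :
    Run greedyProg s₀ fun s t =>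
      t ≤ 3 + ∑ i, (6 + 15 * min (adj i).length (matchingNumber E + 1)) ∧
      ∃ M, Maximal (IsMatching E) M ∧ GreedyInv E s₀ M s := by
  refine run_block_seq (run_for (N := n₁) (fun a s => s.reg 3 = a ∧ ∃ M, GreedyInv E s₀ M s ∧
      (∀ e ∈ M, e.1 < a) ∧ ∀ e ∈ E, e.1 < a → (∃ j, (e.1, j) ∈ M) ∨ ∃ i', (i', e.2) ∈ M)
      (fun i => 5 + 15 * min (adj i).length (matchingNumber E + 1)) ?_ ?_ ?_ ?_)
  · refine ⟨by simp [Instr.run], ∅, ⟨IsMatching.empty, ?_, ?_, ?_, ?_, ?_, ?_, ?_⟩, by simp, by simp⟩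
    · simp [Instr.run, hs.1]
    · simp [Instr.run, hs.2.2.1 2]
    · simp [Instr.run, hs.2.2.1 7]
    · exact fun i => Or.inl ⟨by simp [Instr.run, hs.2.2.2.2 8], by simp⟩
    · exact fun i => Or.inl ⟨by simp [Instr.run, hs.2.2.2.2 11], by simp⟩
    · exact fun b hb => by simp [Instr.run]
    · intro r hr
      simp at hr
      simp [Instr.run, hr]
  · rintro a s ha ⟨h3, M, hI, -⟩
    simp [Test.Holds, h3, hI.r0]
  · rintro i s ⟨h3, M, hI, hlt, hcov⟩
    have hm0 : s.mem 0 = s₀.mem 0 := hI.mf 0 (by simp)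
    refine run_block_seq (run_seq ((run_greedyScan (i := i) (M := M) (s₀ := s₀) hadj ?_ ?_ hlt hcov ?_).mono ?_))
    · refine ⟨hI.isM, ?_, ?_, ?_, ?_, ?_, ?_, ?_⟩
      · simp [Instr.run, hI.r0]
      · simp [Instr.run, hI.r2]
      · simp [Instr.run, hI.r7]
      · simpa [Instr.run] using hI.m1
      · simpa [Instr.run] using hI.m2
      · intro b hb
        simp [Instr.run, hI.mf b hb]
      · intro r hr
        simp at hr
        simp [Instr.run, hr, hI.rf r (by simp [hr])]
    · simp [Instr.run, h3]
    · simpa [Instr.run, h3, hm0] using hl i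
    · rintro s' t ⟨ht, M', hI, h3, hle, hcov⟩
      refine run_block ⟨⟨by simp [Instr.run, h3], M', ⟨hI.isM, ?_, ?_, ?_, ?_, ?_, ?_, ?_⟩, ?_, ?_⟩, ?_⟩
      · simp [Instr.run, hI.r0]
      · simp [Instr.run, hI.r2]
      · simp [Instr.run, hI.r7]
      · simpa [Instr.run] using hI.m1
      · simpa [Instr.run] using hI.m2
      · intro b hb
        simp [Instr.run, hI.mf b hb]
      · intro r hr
        simp at hr
        simp [Instr.run, hr, hI.rf r (by simp [hr])]
      · exact fun e he => Nat.lt_succ_of_le (hle e he)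
      · exact fun e he hei => hcov e he (Nat.lt_succ_iff.1 hei)
      · simp
        omega
  · rintro s t ⟨h3, M, hI, -, hcov⟩ ht
    refine ⟨?_, M, maximal_of_covered hI.isM fun e he => hcov e he e.1.2, hI⟩
    have : ∀ i, 5 + 15 * min (adj i).length (matchingNumber E + 1) + 1 =
      6 + 15 * min (adj i).length (matchingNumber E + 1) := fun i => by omega
    simp only [this] at ht
    simp only [List.length_cons, List.length_nil]
    omega

end Greedy


/-! ### Building the reduced graph: the nodes of V₂ -/

section Build

/-- Add the edge given by the registers `ri`, `rj` to the adjacency lists in the arrays `4`, …, `7`,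
and update the degrees in the arrays `12` and `13`. -/
def addEdge (ri rj : ℕ) : Prog :=
  block [.inc 8, .load 9 4 ri, .store 6 8 9, .store 7 8 rj, .store 4 ri 8,
    .inc 8, .load 9 5 rj, .store 6 8 9, .store 7 8 ri, .store 5 rj 8,
    .load 9 12 ri, .inc 9, .store 12 ri 9, .load 9 13 rj, .inc 9, .store 13 rj 9]

/-- Register 10 holds a matched node w of V₂. Its list is read twice, and the edges to matched nodes
are added in this first pass, so that the cap 2κ_g in `outerScan₂` cannot crowd them out. -/
def innerScan : Prog :=
  .loop (.lt 2 4) (.seq (block [.load 5 3 4, .load 4 2 4, .load 6 8 5])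
    (.ite (.eq 6 2) (block []) (addEdge 5 10)))

def outerScan₂ : Prog :=
  .loop (.lt 2 4) (.seq (block [.load 5 3 4, .load 4 2 4, .load 6 8 5])
    (.ite (.eq 6 2) (.seq (block [.load 6 13 10]) (.ite (.lt 6 7) (addEdge 5 10) (block [])))
      (block [])))

/-- Edges to matched nodes are skipped, as the treatment of V₂ has already added them. The scan
stops as soon as the cap is reached, since a list of a node of V₁ may be too long to be read
completely. -/
def outerScan₁ : Prog :=
  .loop (.lt 2 4) (.seq (block [.load 5 3 4, .load 4 2 4, .load 6 11 5])
    (.ite (.eq 6 2) (.seq (block [.load 6 12 3])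
      (.ite (.lt 6 7) (addEdge 3 5) (block [.const 4 0]))) (block [])))

/-- The matched nodes of V₂ are found as partners of nodes of V₁; a loop over V₂ itself would cost
n₂ steps. -/
def buildLoop₂ : Prog :=
  .loop (.lt 3 0) (.seq (block [.load 10 8 3]) (.seq
    (.ite (.eq 10 2) (block []) (.seq (block [.dec 10, .load 4 1 10])
      (.seq innerScan (.seq (block [.load 4 1 10]) outerScan₂)))) (block [.inc 3])))

def buildLoop₁ : Prog :=
  .loop (.lt 3 0) (.seq (block [.load 10 8 3]) (.seq
    (.ite (.eq 10 2) (block []) (.seq (block [.load 4 0 3]) outerScan₁)) (block [.inc 3])))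

def buildProg : Prog :=
  .seq (block [.const 3 0]) (.seq buildLoop₂ (.seq (block [.const 3 0]) buildLoop₁))

variable {n₁ n₂ : ℕ} {E Es Mg : Finset (Fin n₁ × Fin n₂)}

/-- A linked list all of whose cells are at most `F`. -/
def LinkedListBelow (F : ℕ) (nx ky : ℕ → ℕ) : ℕ → List ℕ → Prop
  | p, [] => p = 0
  | p, x :: l => p ≠ 0 ∧ p ≤ F ∧ ky p = x ∧ LinkedListBelow F nx ky (nx p) l

theorem LinkedListBelow.isLinkedList {F : ℕ} {nx ky : ℕ → ℕ} {p : ℕ} {l : List ℕ}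
    (h : LinkedListBelow F nx ky p l) : IsLinkedList nx ky p l := by
  induction l generalizing p with
  | nil => exact h
  | cons x l ih => exact ⟨h.1, h.2.2.1, ih h.2.2.2⟩

/-- The purpose of the bound `F`: cells allocated above it do not disturb existing lists. -/
theorem LinkedListBelow.mono {F F' : ℕ} {nx ky nx' ky' : ℕ → ℕ} {p : ℕ} {l : List ℕ}
    (h : LinkedListBelow F nx ky p l) (hF : F ≤ F') (hq : ∀ q ≤ F, nx' q = nx q ∧ ky' q = ky q) :
    LinkedListBelow F' nx' ky' p l := by
  induction l generalizing p with
  | nil => exact h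
  | cons x l ih =>
    obtain ⟨h1, h2, h3, h4⟩ := h
    refine ⟨h1, h2.trans hF, by rw [(hq p h2).2, h3], ?_⟩
    rw [(hq p h2).1]
    exact ih h4

/-- Adjacency lists of the graph `Es` with all cells at most `F`. -/
def GraphBelow (Es : Finset (Fin n₁ × Fin n₂)) (F : ℕ) (m : ℕ → ℕ → ℕ) : Prop :=
  (∀ i : Fin n₁, ∃ l : List (Fin n₂), l.Nodup ∧ (∀ j, j ∈ l ↔ (i, j) ∈ Es) ∧
    LinkedListBelow F (m 6) (m 7) (m 4 i) (l.map Fin.val)) ∧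
  (∀ j : Fin n₂, ∃ l : List (Fin n₁), l.Nodup ∧ (∀ i, i ∈ l ↔ (i, j) ∈ Es) ∧
    LinkedListBelow F (m 6) (m 7) (m 5 j) (l.map Fin.val))

theorem GraphBelow.holdsGraph {F : ℕ} {s : State} (h : GraphBelow Es F s.mem) : HoldsGraph 4 Es s :=
  ⟨fun i => (h.1 i).imp fun _ hl => ⟨hl.1, hl.2.1, hl.2.2.isLinkedList⟩,
    fun j => (h.2 j).imp fun _ hl => ⟨hl.1, hl.2.1, hl.2.2.isLinkedList⟩⟩

theorem GraphBelow.insert {F : ℕ} {m m' : ℕ → ℕ → ℕ} (h : GraphBelow Es F m) {i : Fin n₁} {j : Fin n₂}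
    (hij : (i, j) ∉ Es) (h4 : m' 4 = Function.update (m 4) i (F + 1))
    (h5 : m' 5 = Function.update (m 5) j (F + 2))
    (h6 : m' 6 = Function.update (Function.update (m 6) (F + 1) (m 4 i)) (F + 2) (m 5 j))
    (h7 : m' 7 = Function.update (Function.update (m 7) (F + 1) j) (F + 2) i) :
    GraphBelow (insert (i, j) Es) (F + 2) m' := by
  have hq : ∀ q ≤ F, m' 6 q = m 6 q ∧ m' 7 q = m 7 q := by
    intro q hq
    have h1 : q ≠ F + 1 := by omega
    have h2 : q ≠ F + 2 := by omega
    simp [h6, h7, h1, h2]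
  constructor
  · intro a
    obtain ⟨l, hnd, hl, hll⟩ := h.1 a
    have hll' := hll.mono (show F ≤ F + 2 by omega) hq
    by_cases ha : a = i
    · subst ha
      refine ⟨j :: l, List.nodup_cons.2 ⟨by rwa [hl], hnd⟩, by simp [hl], ?_⟩
      simp only [List.map_cons, LinkedListBelow]
      refine ⟨by simp [h4], by simp [h4], by simp [h4, h7], ?_⟩
      have : m' 6 (m' 4 a) = m 4 a := by simp [h4, h6]
      rw [this]
      exact hll'
    · have hne : (a : ℕ) ≠ i := fun h => ha (Fin.ext h)
      refine ⟨l, hnd, by simp [hl, ha], ?_⟩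
      rwa [h4, Function.update_of_ne hne]
  · intro b
    obtain ⟨l, hnd, hl, hll⟩ := h.2 b
    have hll' := hll.mono (show F ≤ F + 2 by omega) hq
    by_cases hb : b = j
    · subst hb
      refine ⟨i :: l, List.nodup_cons.2 ⟨by rwa [hl], hnd⟩, by simp [hl], ?_⟩
      simp only [List.map_cons, LinkedListBelow]
      refine ⟨by simp [h5], by simp [h5], by simp [h5, h7], ?_⟩
      have : m' 6 (m' 5 b) = m 5 b := by simp [h5, h6]
      rw [this]
      exact hll'
    · have hne : (b : ℕ) ≠ j := fun h => hb (Fin.ext h)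
      refine ⟨l, hnd, by simp [hl, hb], ?_⟩
      rwa [h5, Function.update_of_ne hne]

theorem edgesAt_insert_of_inc {v : Fin n₁ ⊕ Fin n₂} {e : Fin n₁ × Fin n₂} (he : e ∉ Es) (h : Inc v e) :
    (edgesAt (insert e Es) v).card = (edgesAt Es v).card + 1 := by
  have : edgesAt (insert e Es) v = insert e (edgesAt Es v) := by
    ext f
    simp only [mem_edgesAt, Finset.mem_insert]
    constructor
    · rintro ⟨rfl | h1, h2⟩ <;> simp_all
    · rintro (rfl | h1) <;> simp_all
  rw [this, Finset.card_insert_of_notMem fun h => he (mem_edgesAt.1 h).1]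

theorem edgesAt_insert_of_not_inc {v : Fin n₁ ⊕ Fin n₂} {e : Fin n₁ × Fin n₂} (h : ¬ Inc v e) :
    edgesAt (insert e Es) v = edgesAt Es v := by
  ext f
  simp only [mem_edgesAt, Finset.mem_insert]
  constructor
  · rintro ⟨rfl | h1, h2⟩
    · exact absurd h2 h
    · exact ⟨h1, h2⟩
  · rintro ⟨h1, h2⟩; exact ⟨Or.inr h1, h2⟩

/-- Here `s₁` is the state after the greedy stage, register 8 is the last list cell in use, and
arrays 12 and 13 hold the degrees in `Es`. The field `mf` keeps the input lists intact. -/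
structure BuildInv (E Mg : Finset (Fin n₁ × Fin n₂)) (s₁ : State) (Es : Finset (Fin n₁ × Fin n₂))
    (s : State) : Prop where
  sub : Es ⊆ E
  r0 : s.reg 0 = n₁
  r2 : s.reg 2 = 0
  r7 : s.reg 7 = 2 * Mg.card
  m1 : Mates₁ Mg (s.mem 8)
  m2 : Mates₂ Mg (s.mem 11)
  gr : GraphBelow Es (s.reg 8) s.mem
  c1 : ∀ i : Fin n₁, s.mem 12 i = (edgesAt Es (Sum.inl i)).card
  c2 : ∀ j : Fin n₂, s.mem 13 j = (edgesAt Es (Sum.inr j)).card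
  mf : MemFrame [4, 5, 6, 7, 12, 13] s₁ s
  rf : RegFrame [3, 4, 5, 6, 8, 9, 10] s₁ s

theorem BuildInv.congr {s₁ s s' : State} (h : BuildInv E Mg s₁ Es s) (hm : s'.mem = s.mem)
    (hr : RegFrame [3, 4, 5, 6, 10] s s') : BuildInv E Mg s₁ Es s' := by
  obtain ⟨h1, h2, h3, h4, h5, h6, h7, h8, h9, h10, h11⟩ := h
  refine ⟨h1, ?_, ?_, ?_, ?_, ?_, ?_, ?_, ?_, ?_, ?_⟩
  · rw [hr 0 (by simp), h2]
  · rw [hr 2 (by simp), h3]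
  · rw [hr 7 (by simp), h4]
  · rwa [hm]
  · rwa [hm]
  · rwa [hm, hr 8 (by simp)]
  · rwa [hm]
  · rwa [hm]
  · intro a ha; rw [hm, h10 a ha]
  · intro a ha
    rw [hr a (by simp at ha ⊢; tauto), h11 a ha]

theorem run_addEdge {s₁ s : State} (h : BuildInv E Mg s₁ Es s) {i : Fin n₁} {j : Fin n₂} {ri rj : ℕ}
    (hi : s.reg ri = i) (hj : s.reg rj = j) (hri : ri ≠ 8 ∧ ri ≠ 9) (hrj : rj ≠ 8 ∧ rj ≠ 9)
    (he : (i, j) ∈ E) (hn : (i, j) ∉ Es) :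
    Run (addEdge ri rj) s fun s' t => t = 17 ∧ BuildInv E Mg s₁ (insert (i, j) Es) s' ∧
      RegFrame [8, 9] s s' := by
  refine run_block ⟨by simp, ⟨Finset.insert_subset he h.sub, ?_, ?_, ?_, ?_, ?_, ?_, ?_, ?_, ?_, ?_⟩, ?_⟩
  · simp [Instr.run, h.r0]
  · simp [Instr.run, h.r2]
  · simp [Instr.run, h.r7]
  · simpa [Instr.run] using h.m1
  · simpa [Instr.run] using h.m2
  · simp only [List.foldl, Instr.run]
    simp [hri, hrj, hi, hj]
    apply h.gr.insert hn <;> simp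
  · intro a
    simp [Instr.run, hri, hrj, hi, hj]
    by_cases ha : a = i
    · subst ha
      rw [edgesAt_insert_of_inc hn (Or.inl rfl)]
      simp [h.c1]
    · have hne : (a : ℕ) ≠ i := fun h => ha (Fin.ext h)
      rw [edgesAt_insert_of_not_inc (by simp [Inc, ha])]
      simp [h.c1, hne]
  · intro b
    simp [Instr.run, hri, hrj, hi, hj]
    by_cases hb : b = j
    · subst hb
      rw [edgesAt_insert_of_inc hn (Or.inr rfl)]
      simp [h.c2]
    · have hne : (b : ℕ) ≠ j := fun h => hb (Fin.ext h)
      rw [edgesAt_insert_of_not_inc (by simp [Inc, hb])]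
      simp [h.c2, hne]
  · intro a ha
    rw [← h.mf a ha]
    simp at ha
    simp [Instr.run, ha]
  · intro r hr
    rw [← h.rf r hr]
    simp at hr
    simp [Instr.run, hr]
  · intro r hr
    simp at hr
    simp [Instr.run, hr]

/-- The node `w` of `V₂` has its final set of edges. -/
def Filled₂ (E Mg Es : Finset (Fin n₁ × Fin n₂)) (w : Fin n₂) : Prop :=
  (∀ x, (∃ j, (x, j) ∈ Mg) → (x, w) ∈ E → (x, w) ∈ Es) ∧
    (edgesAt Es (Sum.inr w)).card = min (edgesAt E (Sum.inr w)).card (2 * Mg.card)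

theorem Filled₂.insert {w : Fin n₂} (h : Filled₂ E Mg Es w) {e : Fin n₁ × Fin n₂} (he : e.2 ≠ w) :
    Filled₂ E Mg (insert e Es) w :=
  ⟨fun x hx hxw => Finset.mem_insert_of_mem (h.1 x hx hxw), by
    rw [edgesAt_insert_of_not_inc (by simp [Inc, he.symm])]; exact h.2⟩

theorem card_edgesAt_mono (h : Es ⊆ E) (v : Fin n₁ ⊕ Fin n₂) :
    (edgesAt Es v).card ≤ (edgesAt E v).card :=
  Finset.card_le_card fun _ he => mem_edgesAt.2 ⟨h (mem_edgesAt.1 he).1, (mem_edgesAt.1 he).2⟩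

/-- A capped scan leaves out an edge only when the cap is attained. -/
theorem card_edgesAt_eq_min (h : Es ⊆ E) {v : Fin n₁ ⊕ Fin n₂} {c : ℕ} (hc : (edgesAt Es v).card ≤ c)
    (h' : ∀ e ∈ E, Inc v e → e ∈ Es ∨ (edgesAt Es v).card = c) :
    (edgesAt Es v).card = min (edgesAt E v).card c := by
  have h1 := card_edgesAt_mono h v
  by_cases hcard : (edgesAt Es v).card = c
  · omega
  · have : edgesAt Es v = edgesAt E v := by
      ext e
      simp only [mem_edgesAt]
      exact ⟨fun he => ⟨h he.1, he.2⟩, fun he => ⟨(h' e he.1 he.2).resolve_right hcard, he.2⟩⟩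
    rw [this] at hc ⊢
    omega

/-- As long as only edges to matched nodes are present, the degree is at most κ_g and the cap 2κ_g
is respected. -/
theorem card_edgesAt_inr_le {w : Fin n₂} (h : ∀ e ∈ Es, e.2 = w → ∃ j, (e.1, j) ∈ Mg) :
    (edgesAt Es (Sum.inr w)).card ≤ Mg.card := by
  classical
  refine le_trans ?_ (Finset.card_image_le (s := Mg) (f := Prod.fst))
  refine Finset.card_le_card_of_injOn Prod.fst (fun e he => ?_) (fun e he f hf hef => ?_)
  · have he := mem_edgesAt_inr.1 he
    obtain ⟨j, hj⟩ := h e he.1 he.2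
    exact Finset.mem_coe.2 (Finset.mem_image.2 ⟨_, hj, rfl⟩)
  · exact Prod.ext hef ((mem_edgesAt_inr.1 he).2.trans (mem_edgesAt_inr.1 hf).2.symm)

theorem card_edgesAt_inl_le {v : Fin n₁} (h : ∀ e ∈ Es, e.1 = v → ∃ i, (i, e.2) ∈ Mg) :
    (edgesAt Es (Sum.inl v)).card ≤ Mg.card := by
  classical
  refine le_trans ?_ (Finset.card_image_le (s := Mg) (f := Prod.snd))
  refine Finset.card_le_card_of_injOn Prod.snd (fun e he => ?_) (fun e he f hf hef => ?_)
  · have he := mem_edgesAt_inl.1 he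
    obtain ⟨j, hj⟩ := h e he.1 he.2
    exact Finset.mem_coe.2 (Finset.mem_image.2 ⟨_, hj, rfl⟩)
  · exact Prod.ext ((mem_edgesAt_inl.1 he).2.trans (mem_edgesAt_inl.1 hf).2.symm) hef

/-- What is known before, between and after the two scans at the node `w`, where `D` is the set of
nodes of `V₂` that are done. -/
structure ScanInv₂ (E Mg : Finset (Fin n₁ × Fin n₂)) (s₁ : State) (D : Fin n₂ → Prop) (i : Fin n₁)
    (w : Fin n₂) (nx ky : ℕ → ℕ) (Es : Finset (Fin n₁ × Fin n₂)) (rem : List (Fin n₁)) (s : State) :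
    Prop where
  b : BuildInv E Mg s₁ Es s
  r3 : s.reg 3 = i
  r10 : s.reg 10 = w
  filled : ∀ w', D w' → Filled₂ E Mg Es w'
  nd : rem.Nodup
  adj : ∀ x ∈ rem, (x, w) ∈ E
  ll : IsLinkedList nx ky (s.reg 4) (rem.map Fin.val)

theorem run_innerScan {s₁ s : State} {D : Fin n₂ → Prop} {i : Fin n₁} {w : Fin n₂}
    (hw : ¬ D w) {rem₀ : List (Fin n₁)} (hrem : ∀ x, (x, w) ∈ E → x ∈ rem₀)
    (h : ScanInv₂ E Mg s₁ D i w (s₁.mem 2) (s₁.mem 3) Es rem₀ s) (hD : ∀ e ∈ Es, D e.2) :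
    Run innerScan s fun s' t => t ≤ 1 + 23 * rem₀.length ∧
      ∃ Es', ScanInv₂ E Mg s₁ D i w (s₁.mem 2) (s₁.mem 3) Es' [] s' ∧
        (∀ e ∈ Es', D e.2 ∨ (e.2 = w ∧ ∃ j, (e.1, j) ∈ Mg)) ∧
        ∀ x, (∃ j, (x, j) ∈ Mg) → (x, w) ∈ E → (x, w) ∈ Es' := by
  -- The clause `e.1 ∉ rem` guarantees that the edge about to be added is new, as `run_addEdge`
  -- requires.
  refine run_loop (fun s n => ∃ Es rem, ScanInv₂ E Mg s₁ D i w (s₁.mem 2) (s₁.mem 3) Es rem s ∧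
    (∀ e ∈ Es, D e.2 ∨ (e.2 = w ∧ (∃ j, (e.1, j) ∈ Mg) ∧ e.1 ∉ rem)) ∧
    (∀ x, (∃ j, (x, j) ∈ Mg) → (x, w) ∈ E → (x, w) ∈ Es ∨ x ∈ rem) ∧ n = 23 * rem.length)
    (n := 23 * rem₀.length)
    ⟨Es, rem₀, h, fun e he => Or.inl (hD e he), fun x _ hx => Or.inr (hrem x hx), rfl⟩ ?_ ?_
  · rintro s n ⟨Es, rem, h, hA, hB, rfl⟩ hb
    simp only [Test.Holds, h.b.r2] at hb
    obtain ⟨x, rem', rfl, hky, hl'⟩ := h.ll.exists_cons hb.ne'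
    have hm3 : s.mem 3 = s₁.mem 3 := h.b.mf 3 (by simp)
    have hm2 : s.mem 2 = s₁.mem 2 := h.b.mf 2 (by simp)
    have hnd := List.nodup_cons.1 h.nd
    have hadj := h.adj x (by simp)
    have hI := h.b.congr (s' := runList [.load 5 3 4, .load 4 2 4, .load 6 8 5] s) (by simp [Instr.run])
        (fun r hr => by simp at hr; simp [Instr.run, hr])
    have h5 : (runList [.load 5 3 4, .load 4 2 4, .load 6 8 5] s).reg 5 = x := by simp [Instr.run, hm3, hky]
    refine run_block_seq (run_ite (fun hb' => ?_) fun hb' => ?_)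
    · simp only [Test.Holds, List.foldl, Instr.run, Function.update_apply] at hb'
      simp [h.b.r2, hm3, hky, h.b.m1.eq_zero] at hb'
      refine run_block ⟨23 * rem'.length, ⟨Es, rem', ⟨hI, ?_, ?_, h.filled, hnd.2, ?_, ?_⟩, ?_, ?_, rfl⟩, ?_⟩
      · simp [Instr.run, h.r3]
      · simp [Instr.run, h.r10]
      · exact fun y hy => h.adj y (List.mem_cons_of_mem _ hy)
      · simpa [Instr.run, hm2] using hl'
      · intro e he
        rcases hA e he with h1 | h1
        · exact Or.inl h1
        · exact Or.inr ⟨h1.1, h1.2.1, fun h2 => h1.2.2 (List.mem_cons_of_mem _ h2)⟩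
      · intro y hy hyw
        rcases hB y hy hyw with h1 | h1
        · exact Or.inl h1
        · rcases List.mem_cons.1 h1 with rfl | h1
          · obtain ⟨j, hj⟩ := hy
            exact absurd hj (hb' j)
          · exact Or.inr h1
      · simp
        omega
    · simp only [Test.Holds, List.foldl, Instr.run, Function.update_apply] at hb'
      simp [h.b.r2, hm3, hky, h.b.m1.eq_zero] at hb'
      have hxw : (x, w) ∉ Es := fun h1 => by
        rcases hA _ h1 with h2 | h2
        · exact hw h2
        · exact h2.2.2 (by simp)
      refine (run_addEdge hI (i := x) (j := w) h5 (by simp [Instr.run, h.r10]) (by simp) (by simp)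
        hadj hxw).mono ?_
      rintro s' t ⟨rfl, hI', hrf⟩
      refine ⟨23 * rem'.length, ⟨insert (x, w) Es, rem', ⟨hI', ?_, ?_, ?_, hnd.2, ?_, ?_⟩, ?_, ?_, rfl⟩, ?_⟩
      · rw [hrf 3 (by simp)]; simp [Instr.run, h.r3]
      · rw [hrf 10 (by simp)]; simp [Instr.run, h.r10]
      · exact fun w' hw' => (h.filled w' hw').insert fun h1 => hw (by rwa [← h1] at hw')
      · exact fun y hy => h.adj y (List.mem_cons_of_mem _ hy)
      · rw [hrf 4 (by simp)]; simpa [Instr.run, hm2] using hl'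
      · intro e he
        rcases Finset.mem_insert.1 he with rfl | he
        · exact Or.inr ⟨rfl, hb', hnd.1⟩
        · rcases hA e he with h1 | h1
          · exact Or.inl h1
          · exact Or.inr ⟨h1.1, h1.2.1, fun h2 => h1.2.2 (List.mem_cons_of_mem _ h2)⟩
      · intro y hy hyw
        rcases hB y hy hyw with h1 | h1
        · exact Or.inl (Finset.mem_insert_of_mem h1)
        · rcases List.mem_cons.1 h1 with rfl | h1
          · exact Or.inl (Finset.mem_insert_self _ _)
          · exact Or.inr h1
      · simp
        omega
  · rintro s' n' t ⟨Es, rem, h, hA, hB, rfl⟩ hb ht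
    simp only [Test.Holds, h.b.r2, not_lt, Nat.le_zero] at hb
    have hll := h.ll
    rw [hb] at hll
    have := hll.eq_nil
    simp only [List.map_eq_nil_iff] at this
    subst this
    refine ⟨by omega, Es, h, fun e he => ?_, fun x hx hxw => by simpa using hB x hx hxw⟩
    exact (hA e he).imp id fun h1 => ⟨h1.1, h1.2.1⟩

theorem run_outerScan₂ {s₁ s : State} {D : Fin n₂ → Prop} {i : Fin n₁} {w : Fin n₂}
    (hw : ¬ D w) {rem₀ : List (Fin n₁)} (hrem : ∀ x, (x, w) ∈ E → x ∈ rem₀)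
    (h : ScanInv₂ E Mg s₁ D i w (s₁.mem 2) (s₁.mem 3) Es rem₀ s)
    (hD : ∀ e ∈ Es, D e.2 ∨ (e.2 = w ∧ ∃ j, (e.1, j) ∈ Mg))
    (hin : ∀ x, (∃ j, (x, j) ∈ Mg) → (x, w) ∈ E → (x, w) ∈ Es) :
    Run outerScan₂ s fun s' t => t ≤ 1 + 26 * rem₀.length ∧
      ∃ Es', ScanInv₂ E Mg s₁ D i w (s₁.mem 2) (s₁.mem 3) Es' [] s' ∧
        (∀ e ∈ Es', D e.2 ∨ e.2 = w) ∧ Filled₂ E Mg Es' w := by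
  have hcard : (edgesAt Es (Sum.inr w)).card ≤ 2 * Mg.card := by
    have := card_edgesAt_inr_le (Es := Es) (Mg := Mg) (w := w) fun e he hew => by
      rcases hD e he with h1 | h1
      · rw [hew] at h1; exact absurd h1 hw
      · exact h1.2
    omega
  -- Edges from matched nodes may recur in `rem` since the list is read again, but the scan skips
  -- them; so freshness is only claimed for the others.
  refine run_loop (fun s n => ∃ Es rem, ScanInv₂ E Mg s₁ D i w (s₁.mem 2) (s₁.mem 3) Es rem s ∧
    (∀ e ∈ Es, D e.2 ∨ (e.2 = w ∧ ((∃ j, (e.1, j) ∈ Mg) ∨ e.1 ∉ rem))) ∧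
    (∀ x, (∃ j, (x, j) ∈ Mg) → (x, w) ∈ E → (x, w) ∈ Es) ∧
    (edgesAt Es (Sum.inr w)).card ≤ 2 * Mg.card ∧
    (∀ x, (x, w) ∈ E → (x, w) ∈ Es ∨ x ∈ rem ∨ (edgesAt Es (Sum.inr w)).card = 2 * Mg.card) ∧
    n = 26 * rem.length)
    (n := 26 * rem₀.length)
    ⟨Es, rem₀, h, fun e he => (hD e he).imp id fun h1 => ⟨h1.1, Or.inl h1.2⟩, hin, hcard,
      fun x hx => Or.inr (Or.inl (hrem x hx)), rfl⟩ ?_ ?_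
  · rintro s n ⟨Es, rem, h, hA, hin, hcard, hB, rfl⟩ hb
    simp only [Test.Holds, h.b.r2] at hb
    obtain ⟨x, rem', rfl, hky, hl'⟩ := h.ll.exists_cons hb.ne'
    have hm3 : s.mem 3 = s₁.mem 3 := h.b.mf 3 (by simp)
    have hm2 : s.mem 2 = s₁.mem 2 := h.b.mf 2 (by simp)
    have hnd := List.nodup_cons.1 h.nd
    have hadj := h.adj x (by simp)
    have hA' : ∀ e ∈ Es, D e.2 ∨ (e.2 = w ∧ ((∃ j, (e.1, j) ∈ Mg) ∨ e.1 ∉ rem')) := fun e he =>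
      (hA e he).imp id fun h1 => ⟨h1.1, h1.2.imp id fun h2 h3 => h2 (List.mem_cons_of_mem _ h3)⟩
    have hskip : ((x, w) ∈ Es ∨ (edgesAt Es (Sum.inr w)).card = 2 * Mg.card) →
        ∀ y, (y, w) ∈ E → (y, w) ∈ Es ∨ y ∈ rem' ∨ (edgesAt Es (Sum.inr w)).card = 2 * Mg.card := by
      intro hx y hy
      rcases hB y hy with h1 | h1 | h1
      · exact Or.inl h1
      · rcases List.mem_cons.1 h1 with rfl | h1
        · exact hx.imp id Or.inr
        · exact Or.inr (Or.inl h1)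
      · exact Or.inr (Or.inr h1)
    have hI := h.b.congr (s' := runList [.load 5 3 4, .load 4 2 4, .load 6 8 5] s) (by simp [Instr.run])
        (fun r hr => by simp at hr; simp [Instr.run, hr])
    refine run_block_seq (run_ite (fun hb' => ?_) fun hb' => ?_)
    · simp only [Test.Holds, List.foldl, Instr.run, Function.update_apply] at hb'
      simp [h.b.r2, hm3, hky, h.b.m1.eq_zero] at hb'
      have hI := hI.congr (s' := runList [.load 6 13 10]
        (runList [.load 5 3 4, .load 4 2 4, .load 6 8 5] s)) (by simp [Instr.run])
        (fun r hr => by simp at hr; simp [Instr.run, hr])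
      refine run_block_seq (run_ite (fun hb'' => ?_) fun hb'' => ?_)
      · simp only [Test.Holds, List.foldl, Instr.run, Function.update_apply] at hb''
        simp [h.b.r7, h.r10, h.b.c2] at hb''
        have hxw : (x, w) ∉ Es := fun h1 => by
          rcases hA _ h1 with h2 | ⟨-, ⟨j, h2⟩ | h2⟩
          · exact hw h2
          · exact hb' j h2
          · exact h2 (by simp)
        refine (run_addEdge hI (i := x) (j := w) (by simp [Instr.run, hm3, hky])
          (by simp [Instr.run, h.r10]) (by simp) (by simp) hadj hxw).mono ?_
        rintro s' t ⟨rfl, hI', hrf⟩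
        have hc := edgesAt_insert_of_inc (v := Sum.inr w) hxw (Or.inr rfl)
        refine ⟨26 * rem'.length, ⟨insert (x, w) Es, rem', ⟨hI', ?_, ?_, ?_, hnd.2, ?_, ?_⟩, ?_, ?_,
          ?_, ?_, rfl⟩, ?_⟩
        · rw [hrf 3 (by simp)]; simp [Instr.run, h.r3]
        · rw [hrf 10 (by simp)]; simp [Instr.run, h.r10]
        · exact fun w' hw' => (h.filled w' hw').insert fun h1 => hw (by rwa [← h1] at hw')
        · exact fun y hy => h.adj y (List.mem_cons_of_mem _ hy)
        · rw [hrf 4 (by simp)]; simpa [Instr.run, hm2] using hl'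
        · intro e he
          rcases Finset.mem_insert.1 he with rfl | he
          · exact Or.inr ⟨rfl, Or.inr hnd.1⟩
          · exact hA' e he
        · exact fun y hy hyw => Finset.mem_insert_of_mem (hin y hy hyw)
        · omega
        · intro y hy
          rcases hB y hy with h1 | h1 | h1
          · exact Or.inl (Finset.mem_insert_of_mem h1)
          · rcases List.mem_cons.1 h1 with rfl | h1
            · exact Or.inl (Finset.mem_insert_self _ _)
            · exact Or.inr (Or.inl h1)
          · omega
        · simp
          omega
      · simp only [Test.Holds, List.foldl, Instr.run, Function.update_apply] at hb''
        simp [h.b.r7, h.r10, h.b.c2] at hb''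
        refine run_block ⟨26 * rem'.length, ⟨Es, rem', ⟨hI, ?_, ?_, h.filled, hnd.2, ?_, ?_⟩, hA', hin,
          hcard, hskip (Or.inr (by omega)), rfl⟩, ?_⟩
        · simp [Instr.run, h.r3]
        · simp [Instr.run, h.r10]
        · exact fun y hy => h.adj y (List.mem_cons_of_mem _ hy)
        · simpa [Instr.run, hm2] using hl'
        · simp
          omega
    · simp only [Test.Holds, List.foldl, Instr.run, Function.update_apply] at hb'
      simp [h.b.r2, hm3, hky, h.b.m1.eq_zero] at hb'
      refine run_block ⟨26 * rem'.length, ⟨Es, rem', ⟨hI, ?_, ?_, h.filled, hnd.2, ?_, ?_⟩, hA', hin,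
          hcard, hskip (Or.inl (hin x hb' hadj)), rfl⟩, ?_⟩
      · simp [Instr.run, h.r3]
      · simp [Instr.run, h.r10]
      · exact fun y hy => h.adj y (List.mem_cons_of_mem _ hy)
      · simpa [Instr.run, hm2] using hl'
      · simp
        omega
  · rintro s' n' t ⟨Es, rem, h, hA, hin, hcard, hB, rfl⟩ hb ht
    simp only [Test.Holds, h.b.r2, not_lt, Nat.le_zero] at hb
    have hll := h.ll
    rw [hb] at hll
    have := hll.eq_nil
    simp only [List.map_eq_nil_iff] at this
    subst this
    refine ⟨by omega, Es, h, fun e he => (hA e he).imp id fun h1 => h1.1, hin, ?_⟩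
    refine card_edgesAt_eq_min h.b.sub hcard ?_
    rintro ⟨a, b⟩ he hinc
    have : b = w := by
      rcases hinc with h1 | h1
      · cases h1
      · cases h1; rfl
    subst this
    simpa using hB a he

/-- The inner sum has at most one term, the degree of the partner of `i`; 49 = 23 + 26 is the cost
per cell of the two scans. -/
theorem run_buildLoop₂ {s₁ s : State} (hMg : IsMatching E Mg) {adj : Fin n₂ → List (Fin n₁)}
    (hadj : AdjLists₂ E adj)
    (hl : ∀ j : Fin n₂, IsLinkedList (s₁.mem 2) (s₁.mem 3) (s₁.mem 1 j) ((adj j).map Fin.val))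
    (h : BuildInv E Mg s₁ ∅ s) (h3 : s.reg 3 = 0) :
    Run buildLoop₂ s fun s' t =>
      t ≤ 1 + ∑ i, (13 + 49 * ∑ e ∈ Mg with e.1 = i, (edgesAt E (Sum.inr e.2)).card) ∧
      ∃ Es, BuildInv E Mg s₁ Es s' ∧ (∀ e ∈ Es, ∃ i, (i, e.2) ∈ Mg) ∧
        ∀ w, (∃ i, (i, w) ∈ Mg) → Filled₂ E Mg Es w := by
  refine run_for (N := n₁) (fun a s => s.reg 3 = a ∧ ∃ Es, BuildInv E Mg s₁ Es s ∧
    (∀ e ∈ Es, ∃ i : Fin n₁, i < a ∧ (i, e.2) ∈ Mg) ∧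
    ∀ w, (∃ i : Fin n₁, i < a ∧ (i, w) ∈ Mg) → Filled₂ E Mg Es w)
    (fun i => 12 + 49 * ∑ e ∈ Mg with e.1 = i, (edgesAt E (Sum.inr e.2)).card) ?_ ?_ ?_ ?_
  · exact ⟨h3, ∅, h, by simp, by simp⟩
  · rintro a s ha ⟨h3, M, hI, -⟩
    simp [Test.Holds, h3, hI.r0]
  · rintro i s ⟨h3, Es, hI, hA, hB⟩
    have hm1 : s.mem 1 = s₁.mem 1 := hI.mf 1 (by simp)
    refine run_block_seq (run_seq (run_ite (fun hb => ?_) fun hb => ?_))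
    · simp only [Test.Holds, List.foldl, Instr.run, Function.update_apply] at hb
      simp [hI.r2, h3, hI.m1.eq_zero] at hb
      refine run_block (run_block ⟨⟨?_, Es, ?_, ?_, ?_⟩, ?_⟩)
      · simp [Instr.run, h3]
      · exact hI.congr (by simp [Instr.run]) (fun r hr => by simp at hr; simp [Instr.run, hr])
      · exact fun e he => (hA e he).imp fun a ha => ⟨by omega, ha.2⟩
      · rintro w ⟨a, ha, haw⟩
        refine hB w ⟨a, ?_, haw⟩
        have : a ≠ i := by
          rintro rfl
          exact hb w haw
        have : (a : ℕ) ≠ i := fun h => this (Fin.ext h)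
        omega
      · simp
        omega
    · simp only [Test.Holds, List.foldl, Instr.run, Function.update_apply] at hb
      simp only [hI.r2, h3, ite_true] at hb
      obtain ⟨w, hiw, hw⟩ := hI.m1.exists_of_ne (i := i) (by simpa using hb)
      have hnD : ¬ ∃ a : Fin n₁, a < (i : ℕ) ∧ (a, w) ∈ Mg := by
        rintro ⟨a, ha, haw⟩
        rw [hMg.left_unique haw hiw] at ha
        exact lt_irrefl _ ha
      have hrem : ∀ x, (x, w) ∈ E → x ∈ adj w := fun x => ((hadj w).2 x).2
      have hcost : (adj w).length ≤ ∑ e ∈ Mg with e.1 = i, (edgesAt E (Sum.inr e.2)).card := by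
        rw [hadj.length]
        exact Finset.single_le_sum (f := fun e : Fin n₁ × Fin n₂ => (edgesAt E (Sum.inr e.2)).card)
          (fun _ _ => Nat.zero_le _) (a := (i, w)) (by simpa using hiw)
      refine run_block_seq (run_seq ((run_innerScan
        (D := fun w => ∃ a : Fin n₁, a < (i : ℕ) ∧ (a, w) ∈ Mg) (i := i) (s₁ := s₁) (Es := Es) hnD hrem
        ⟨?_, ?_, ?_, hB, (hadj w).1, fun x hx => ((hadj w).2 x).1 hx, ?_⟩ hA).mono ?_))
      · exact hI.congr (by simp [Instr.run]) (fun r hr => by simp at hr; simp [Instr.run, hr])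
      · simp [Instr.run, h3]
      · simp [Instr.run, h3, hw]
      · simpa [Instr.run, h3, hw, hm1] using hl w
      rintro s' t ⟨ht, Es', hS, hA', hB'⟩
      have hm1 : s'.mem 1 = s₁.mem 1 := hS.b.mf 1 (by simp)
      refine run_block_seq ((run_outerScan₂ (D := fun w => ∃ a : Fin n₁, a < (i : ℕ) ∧ (a, w) ∈ Mg)
        (i := i) (s₁ := s₁) (Es := Es') hnD hrem
        ⟨?_, ?_, ?_, hS.filled, (hadj w).1, fun x hx => ((hadj w).2 x).1 hx, ?_⟩ hA' hB').mono ?_)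
      · exact hS.b.congr (by simp [Instr.run]) (fun r hr => by simp at hr; simp [Instr.run, hr])
      · simp [Instr.run, hS.r3]
      · simp [Instr.run, hS.r10]
      · simpa [Instr.run, hS.r10, hm1] using hl w
      rintro s'' t' ⟨ht', Es'', hS', hA'', hF⟩
      refine run_block ⟨⟨?_, Es'', ?_, ?_, ?_⟩, ?_⟩
      · simp [Instr.run, hS'.r3]
      · exact hS'.b.congr (by simp [Instr.run]) (fun r hr => by simp at hr; simp [Instr.run, hr])
      · intro e he
        rcases hA'' e he with ⟨a, ha⟩ | h1
        · exact ⟨a, by omega, ha.2⟩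
        · exact ⟨i, by omega, by rw [h1]; exact hiw⟩
      · rintro w' ⟨a, ha, haw⟩
        by_cases hw' : w' = w
        · rw [hw']; exact hF
        · refine hS'.filled w' ⟨a, ?_, haw⟩
          have : a ≠ i := by
            rintro rfl
            exact hw' (hMg.right_unique haw hiw)
          have : (a : ℕ) ≠ i := fun h => this (Fin.ext h)
          omega
      · simp only [List.length_cons, List.length_nil]
        omega
  · rintro s' t ⟨-, Es, hI, hA, hB⟩ ht
    refine ⟨?_, Es, hI, fun e he => (hA e he).imp fun _ h => h.2, fun w ⟨i, hi⟩ => hB w ⟨i, i.2, hi⟩⟩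
    have : ∀ x, 12 + x + 1 = 13 + x := fun x => by omega
    simp only [this] at ht
    exact ht

end Build


/-! ### Building the reduced graph: the nodes of V₁ -/

section Build

variable {n₁ n₂ : ℕ} {E Es Mg : Finset (Fin n₁ × Fin n₂)}

/-- A cell read by the scan holds one of at most κ_g matched neighbours, or adds one of at most 2κ_g
edges, or ends the scan. Added edges lead to unmatched nodes, so the nodes of V₂ that are filled
stay filled. -/
theorem run_outerScan₁ {s₁ s : State} {i : Fin n₁} {rem₀ : List (Fin n₂)} (hnd₀ : rem₀.Nodup)
    (hrem : ∀ x, x ∈ rem₀ ↔ (i, x) ∈ E) (hI : BuildInv E Mg s₁ Es s) (h3 : s.reg 3 = i)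
    (hll : IsLinkedList (s₁.mem 2) (s₁.mem 3) (s.reg 4) (rem₀.map Fin.val))
    (hF : ∀ w, (∃ a, (a, w) ∈ Mg) → Filled₂ E Mg Es w)
    (hA : ∀ e ∈ Es, (∃ a, (a, e.2) ∈ Mg) ∨ e.1 < i)
    (hB : ∀ a < i, (∃ j, (a, j) ∈ Mg) →
      (edgesAt Es (Sum.inl a)).card = min (edgesAt E (Sum.inl a)).card (2 * Mg.card)) :
    Run outerScan₁ s fun s' t => t ≤ 1 + 26 * min rem₀.length (3 * Mg.card + 1) ∧
      ∃ Es', BuildInv E Mg s₁ Es' s' ∧ s'.reg 3 = i ∧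
        (∀ w, (∃ a, (a, w) ∈ Mg) → Filled₂ E Mg Es' w) ∧
        (∀ e ∈ Es', (∃ a, (a, e.2) ∈ Mg) ∨ e.1 ≤ i) ∧
        ∀ a ≤ i, (∃ j, (a, j) ∈ Mg) →
          (edgesAt Es' (Sum.inl a)).card = min (edgesAt E (Sum.inl a)).card (2 * Mg.card) := by
  classical
  have hcard : (edgesAt Es (Sum.inl i)).card ≤ 2 * Mg.card := by
    have := card_edgesAt_inl_le (Es := Es) (Mg := Mg) (v := i) fun e he hei => by
      rcases hA e he with h1 | h1
      · exact h1
      · rw [hei] at h1; exact absurd h1 (lt_irrefl _)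
    omega
  refine run_loop (fun s n => ∃ Es rem, BuildInv E Mg s₁ Es s ∧ s.reg 3 = i ∧ rem.Nodup ∧
    (∀ x ∈ rem, (i, x) ∈ E) ∧ IsLinkedList (s₁.mem 2) (s₁.mem 3) (s.reg 4) (rem.map Fin.val) ∧
    (∀ w, (∃ a, (a, w) ∈ Mg) → Filled₂ E Mg Es w) ∧
    (∀ e ∈ Es, (∃ a, (a, e.2) ∈ Mg) ∨ e.1 < i ∨ (e.1 = i ∧ e.2 ∉ rem)) ∧
    (∀ a < i, (∃ j, (a, j) ∈ Mg) →
      (edgesAt Es (Sum.inl a)).card = min (edgesAt E (Sum.inl a)).card (2 * Mg.card)) ∧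
    (edgesAt Es (Sum.inl i)).card ≤ 2 * Mg.card ∧
    (∀ x, (i, x) ∈ E → (∃ a, (a, x) ∈ Mg) ∨ (i, x) ∈ Es ∨ x ∈ rem ∨
      (edgesAt Es (Sum.inl i)).card = 2 * Mg.card) ∧
    -- Rounds still possible: matched neighbours ahead, free places under the cap, and the round
    -- that finds the cap reached.
    n = 26 * min rem.length (rem.countP (fun j => ∃ a, (a, j) ∈ Mg) +
      (2 * Mg.card - (edgesAt Es (Sum.inl i)).card) + 1))
    (n := 26 * min rem₀.length (rem₀.countP (fun j => ∃ a, (a, j) ∈ Mg) +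
      (2 * Mg.card - (edgesAt Es (Sum.inl i)).card) + 1))
    ⟨Es, rem₀, hI, h3, hnd₀, fun x hx => (hrem x).1 hx, hll, hF,
      fun e he => (hA e he).imp id Or.inl, hB, hcard,
      fun x hx => Or.inr (Or.inr (Or.inl ((hrem x).2 hx))), rfl⟩ ?_ ?_
  · clear hll hA hB hcard hF hI h3
    rintro s n ⟨Es, rem, hI, h3, hnd, hadj, hll, hF, hA, hB, hcard, hC, rfl⟩ hb
    simp only [Test.Holds, hI.r2] at hb
    obtain ⟨x, rem', rfl, hky, hl'⟩ := hll.exists_cons hb.ne'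
    have hm3 : s.mem 3 = s₁.mem 3 := hI.mf 3 (by simp)
    have hm2 : s.mem 2 = s₁.mem 2 := hI.mf 2 (by simp)
    have hnd := List.nodup_cons.1 hnd
    have hxE := hadj x (by simp)
    have hadj' : ∀ y ∈ rem', (i, y) ∈ E := fun y hy => hadj y (List.mem_cons_of_mem _ hy)
    have hA' : ∀ e ∈ Es, (∃ a, (a, e.2) ∈ Mg) ∨ e.1 < i ∨ (e.1 = i ∧ e.2 ∉ rem') := fun e he =>
      (hA e he).imp id fun h1 => h1.imp id fun h2 =>
        ⟨h2.1, fun h3 => h2.2 (List.mem_cons_of_mem _ h3)⟩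
    have hI1 := hI.congr (s' := runList [.load 5 3 4, .load 4 2 4, .load 6 11 5] s)
      (by simp [Instr.run]) (fun r hr => by simp at hr; simp [Instr.run, hr])
    refine run_block_seq (run_ite (fun hb' => ?_) fun hb' => ?_)
    · simp only [Test.Holds, List.foldl, Instr.run, Function.update_apply] at hb'
      simp [hI.r2, hm3, hky, hI.m2.eq_zero] at hb'
      have hnc : ¬ ∃ a, (a, x) ∈ Mg := fun ⟨a, ha⟩ => hb' a ha
      have hI2 := hI1.congr (s' := runList [.load 6 12 3]
        (runList [.load 5 3 4, .load 4 2 4, .load 6 11 5] s)) (by simp [Instr.run])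
        (fun r hr => by simp at hr; simp [Instr.run, hr])
      refine run_block_seq (run_ite (fun hb'' => ?_) fun hb'' => ?_)
      · simp only [Test.Holds, List.foldl, Instr.run, Function.update_apply] at hb''
        simp [hI.r7, h3, hI.c1] at hb''
        have hxw : (i, x) ∉ Es := fun h1 => by
          rcases hA _ h1 with h2 | h2 | h2
          · exact hnc h2
          · exact lt_irrefl _ h2
          · exact h2.2 (by simp)
        refine (run_addEdge hI2 (i := i) (j := x) (by simp [Instr.run, h3])
          (by simp [Instr.run, hm3, hky]) (by simp) (by simp) hxE hxw).mono ?_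
        rintro s' t ⟨rfl, hI', hrf⟩
        have hc := edgesAt_insert_of_inc (v := Sum.inl i) hxw (Or.inl rfl)
        refine ⟨_, ⟨insert (i, x) Es, rem', hI', ?_, hnd.2, hadj', ?_, ?_, ?_, ?_, ?_, ?_, rfl⟩, ?_⟩
        · rw [hrf 3 (by simp)]; simp [Instr.run, h3]
        · rw [hrf 4 (by simp)]; simpa [Instr.run, hm2] using hl'
        · exact fun w hw => (hF w hw).insert fun h1 => hnc (by rwa [← h1] at hw)
        · intro e he
          rcases Finset.mem_insert.1 he with rfl | he
          · exact Or.inr (Or.inr ⟨rfl, hnd.1⟩)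
          · exact hA' e he
        · intro a ha hca
          rw [edgesAt_insert_of_not_inc (by simp [Inc, ha.ne])]
          exact hB a ha hca
        · omega
        · intro y hy
          rcases hC y hy with h1 | h1 | h1 | h1
          · exact Or.inl h1
          · exact Or.inr (Or.inl (Finset.mem_insert_of_mem h1))
          · rcases List.mem_cons.1 h1 with rfl | h1
            · exact Or.inr (Or.inl (Finset.mem_insert_self _ _))
            · exact Or.inr (Or.inr (Or.inl h1))
          · omega
        · simp only [List.countP_cons, List.length_cons, List.length_nil, hnc, decide_false]
          simp only [Bool.false_eq_true, if_false]
          omega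
      · simp only [Test.Holds, List.foldl, Instr.run, Function.update_apply] at hb''
        simp [hI.r7, h3, hI.c1] at hb''
        -- The cap is reached: the pointer is set to 0, which abandons the rest of the list.
        refine run_block ⟨0, ⟨Es, [], ?_, ?_, List.nodup_nil, by simp, ?_, hF, ?_, hB, hcard, ?_, ?_⟩, ?_⟩
        · exact hI2.congr (by simp [Instr.run]) (fun r hr => by simp at hr; simp [Instr.run, hr])
        · simp [Instr.run, h3]
        · simp [Instr.run, IsLinkedList]
        · exact fun e he => (hA e he).imp id fun h1 => h1.imp id fun h2 => ⟨h2.1, by simp⟩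
        · exact fun y hy => Or.inr (Or.inr (Or.inr (by omega)))
        · simp
        · simp only [List.length_cons, List.length_nil]
          omega
    · simp only [Test.Holds, List.foldl, Instr.run, Function.update_apply] at hb'
      simp [hI.r2, hm3, hky, hI.m2.eq_zero] at hb'
      refine run_block ⟨_, ⟨Es, rem', hI1, ?_, hnd.2, hadj', ?_, hF, hA', hB, hcard, ?_, rfl⟩, ?_⟩
      · simp [Instr.run, h3]
      · simpa [Instr.run, hm2] using hl'
      · intro y hy
        rcases hC y hy with h1 | h1 | h1 | h1
        · exact Or.inl h1
        · exact Or.inr (Or.inl h1)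
        · rcases List.mem_cons.1 h1 with rfl | h1
          · exact Or.inl hb'
          · exact Or.inr (Or.inr (Or.inl h1))
        · exact Or.inr (Or.inr (Or.inr h1))
      · simp only [List.countP_cons, List.length_cons, List.length_nil, hb', decide_true, if_true]
        omega
  · rintro s' n' t ⟨Es', rem, hI', h3', hnd, hadj, hll', hF', hA', hB', hcard', hC, rfl⟩ hb ht
    simp only [Test.Holds, hI'.r2, not_lt, Nat.le_zero] at hb
    rw [hb] at hll'
    have := hll'.eq_nil
    simp only [List.map_eq_nil_iff] at this
    subst this
    have hcount : rem₀.countP (fun j => ∃ a, (a, j) ∈ Mg) ≤ Mg.card := by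
      rw [List.countP_eq_length_filter]
      exact length_le_card_of_covered (hnd₀.filter _) fun j hj => by
        simpa using (List.mem_filter.1 hj).2
    refine ⟨by omega, Es', hI', h3', hF', ?_, ?_⟩
    · exact fun e he => (hA' e he).imp id fun h1 => h1.elim le_of_lt fun h2 => h2.1.le
    · intro a ha hca
      rcases ha.lt_or_eq with ha | rfl
      · exact hB' a ha hca
      · refine card_edgesAt_eq_min hI'.sub hcard' ?_
        rintro ⟨c, d⟩ he hinc
        have : c = a := by
          rcases hinc with h1 | h1
          · cases h1; rfl
          · cases h1
        subst this
        rcases hC d he with h1 | h1 | h1 | h1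
        -- Both ends are matched, so the first pass over V₂ has already added the edge.
        · exact Or.inl ((hF' d h1).1 c hca he)
        · exact Or.inl h1
        · simp at h1
        · exact Or.inr h1

theorem run_buildLoop₁ {s₁ s : State} {adj : Fin n₁ → List (Fin n₂)} (hadj : AdjLists₁ E adj)
    (hl : ∀ i : Fin n₁, IsLinkedList (s₁.mem 2) (s₁.mem 3) (s₁.mem 0 i) ((adj i).map Fin.val))
    (h : BuildInv E Mg s₁ Es s) (h3 : s.reg 3 = 0) (hA : ∀ e ∈ Es, ∃ i, (i, e.2) ∈ Mg)
    (hF : ∀ w, (∃ a, (a, w) ∈ Mg) → Filled₂ E Mg Es w) :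
    Run buildLoop₁ s fun s' t =>
      t ≤ 1 + ∑ i, (11 + 26 * min (adj i).length (3 * Mg.card + 1)) ∧
      ∃ Es', BuildInv E Mg s₁ Es' s' ∧ (∀ w, (∃ a, (a, w) ∈ Mg) → Filled₂ E Mg Es' w) ∧
        ∀ a, (∃ j, (a, j) ∈ Mg) →
          (edgesAt Es' (Sum.inl a)).card = min (edgesAt E (Sum.inl a)).card (2 * Mg.card) := by
  refine run_for (N := n₁) (fun k s => s.reg 3 = k ∧ ∃ Es, BuildInv E Mg s₁ Es s ∧
    (∀ e ∈ Es, (∃ i, (i, e.2) ∈ Mg) ∨ e.1 < k) ∧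
    (∀ w, (∃ a, (a, w) ∈ Mg) → Filled₂ E Mg Es w) ∧
    ∀ a : Fin n₁, a < k → (∃ j, (a, j) ∈ Mg) →
      (edgesAt Es (Sum.inl a)).card = min (edgesAt E (Sum.inl a)).card (2 * Mg.card))
    (fun i => 10 + 26 * min (adj i).length (3 * Mg.card + 1)) ?_ ?_ ?_ ?_
  · exact ⟨h3, Es, h, fun e he => Or.inl (hA e he), hF, by simp⟩
  · rintro a s ha ⟨h3, M, hI, -⟩
    simp [Test.Holds, h3, hI.r0]
  · clear h3 h hA hF
    rintro i s ⟨h3, Es, hI, hA, hF, hB⟩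
    have hm0 : s.mem 0 = s₁.mem 0 := hI.mf 0 (by simp)
    refine run_block_seq (run_seq (run_ite (fun hb => ?_) fun hb => ?_))
    · simp only [Test.Holds, List.foldl, Instr.run, Function.update_apply] at hb
      simp [hI.r2, h3, hI.m1.eq_zero] at hb
      refine run_block (run_block ⟨⟨?_, Es, ?_, ?_, hF, ?_⟩, ?_⟩)
      · simp [Instr.run, h3]
      · exact hI.congr (by simp [Instr.run]) (fun r hr => by simp at hr; simp [Instr.run, hr])
      · exact fun e he => (hA e he).imp id fun ha => by omega
      · rintro a ha ⟨w, haw⟩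
        refine hB a ?_ ⟨w, haw⟩
        have : a ≠ i := by
          rintro rfl
          exact hb w haw
        have : (a : ℕ) ≠ i := fun h => this (Fin.ext h)
        omega
      · simp
        omega
    · refine run_block_seq ((run_outerScan₁ (i := i) (s₁ := s₁) (Es := Es) (hadj i).1 (hadj i).2
        ?_ ?_ ?_ hF hA hB).mono ?_)
      · exact hI.congr (by simp [Instr.run]) (fun r hr => by simp at hr; simp [Instr.run, hr])
      · simp [Instr.run, h3]
      · simpa [Instr.run, h3, hm0] using hl i
      rintro s' t ⟨ht, Es', hI', h3', hF', hA', hB'⟩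
      refine run_block ⟨⟨?_, Es', ?_, ?_, hF', ?_⟩, ?_⟩
      · simp [Instr.run, h3']
      · exact hI'.congr (by simp [Instr.run]) (fun r hr => by simp at hr; simp [Instr.run, hr])
      · exact fun e he => (hA' e he).imp id fun h1 => Nat.lt_succ_of_le h1
      · exact fun a ha => hB' a (Nat.lt_succ_iff.1 ha)
      · simp only [List.length_cons, List.length_nil]
        omega
  · rintro s' t ⟨-, Es, hI, hA, hF, hB⟩ ht
    refine ⟨?_, Es, hI, hF, fun a => hB a a.2⟩
    have : ∀ x, 10 + x + 1 = 11 + x := fun x => by omega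
    simp only [this] at ht
    exact ht

/-- The witness for `S v` is the set of all edges of `Es` at `v`: an edge added on behalf of one
matched node never pushes another matched node over its cap. -/
theorem isReducedGraph_of_filled (hMg : Maximal (IsMatching E) Mg) (hsub : Es ⊆ E)
    (h2 : ∀ w, (∃ a, (a, w) ∈ Mg) → Filled₂ E Mg Es w)
    (h1 : ∀ a, (∃ j, (a, j) ∈ Mg) →
      (edgesAt Es (Sum.inl a)).card = min (edgesAt E (Sum.inl a)).card (2 * Mg.card)) :
    IsReducedGraph E Mg Es := by
  have hcard : ∀ v, Covered Mg v →
      (edgesAt Es v).card = min (edgesAt E v).card (2 * Mg.card) := by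
    rintro (i | j) hv
    · exact h1 i (covered_inl.1 hv)
    · exact (h2 j (covered_inr.1 hv)).2
  have hss : ∀ v, edgesAt Es v ⊆ edgesAt E v := fun v e he =>
    mem_edgesAt.2 ⟨hsub (mem_edgesAt.1 he).1, (mem_edgesAt.1 he).2⟩
  refine ⟨fun v => edgesAt Es v, fun v hv => ⟨fun hle => ?_, fun hlt => ⟨?_, hss v, ?_⟩⟩, fun e => ?_⟩
  · exact Finset.eq_of_subset_of_card_le (hss v) (by rw [hcard v hv]; omega)
  · intro e he
    have he' : e ∈ edgesAt E v ∧ Covered Mg (Sum.inl e.1) ∧ Covered Mg (Sum.inr e.2) := by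
      simpa [innerEdgesAt] using he
    have hE := mem_edgesAt.1 he'.1
    exact mem_edgesAt.2 ⟨(h2 e.2 (covered_inr.1 he'.2.2)).1 e.1 (covered_inl.1 he'.2.1) hE.1, hE.2⟩
  · rw [hcard v hv]; omega
  · constructor
    · intro he
      rcases exists_covered_of_maximal hMg (hsub he) with h | h
      · exact ⟨_, h, mem_edgesAt.2 ⟨he, Or.inl rfl⟩⟩
      · exact ⟨_, h, mem_edgesAt.2 ⟨he, Or.inr rfl⟩⟩
    · rintro ⟨v, -, he⟩
      exact (mem_edgesAt.1 he).1

theorem run_buildProg {s₀ s₁ : State} (hs₀ : IsInput E s₀) (hMg : Maximal (IsMatching E) Mg)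
    (hg : GreedyInv E s₀ Mg s₁) {adj₁ : Fin n₁ → List (Fin n₂)} (hadj₁ : AdjLists₁ E adj₁)
    (hl₁ : ∀ i : Fin n₁, IsLinkedList (s₁.mem 2) (s₁.mem 3) (s₁.mem 0 i) ((adj₁ i).map Fin.val))
    {adj₂ : Fin n₂ → List (Fin n₁)} (hadj₂ : AdjLists₂ E adj₂)
    (hl₂ : ∀ j : Fin n₂, IsLinkedList (s₁.mem 2) (s₁.mem 3) (s₁.mem 1 j) ((adj₂ j).map Fin.val)) :
    Run buildProg s₁ fun s t =>
      t ≤ 6 + (∑ i, (13 + 49 * ∑ e ∈ Mg with e.1 = i, (edgesAt E (Sum.inr e.2)).card)) +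
        ∑ i, (11 + 26 * min (adj₁ i).length (3 * Mg.card + 1)) ∧
      ∃ Es, IsReducedGraph E Mg Es ∧ BuildInv E Mg s₁ Es s := by
  have hz : ∀ a, 4 ≤ a → a ≠ 8 → a ≠ 11 → ∀ i, s₁.mem a i = 0 := fun a h4 h8 h11 i => by
    rw [hg.mf a (by simp [h8, h11])]; exact hs₀.2.2.2.2 a h4 i
  have h8 : s₁.reg 8 = 0 := by rw [hg.rf 8 (by simp)]; exact hs₀.2.2.1 8 (by simp)
  have hempty : ∀ v, (edgesAt (∅ : Finset (Fin n₁ × Fin n₂)) v).card = 0 := fun v => by simp [edgesAt]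
  have hI : BuildInv E Mg s₁ ∅ (runList [.const 3 0] s₁) := by
    refine ⟨by simp, ?_, ?_, ?_, ?_, ?_, ⟨?_, ?_⟩, ?_, ?_, ?_, ?_⟩
    · simp [Instr.run, hg.r0]
    · simp [Instr.run, hg.r2]
    · simp [Instr.run, hg.r7]
    · simpa [Instr.run] using hg.m1
    · simpa [Instr.run] using hg.m2
    · exact fun i => ⟨[], by simp, by simp, by simp [Instr.run, LinkedListBelow, hz]⟩
    · exact fun i => ⟨[], by simp, by simp, by simp [Instr.run, LinkedListBelow, hz]⟩
    · exact fun i => by simp [Instr.run, hz, hempty]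
    · exact fun i => by simp [Instr.run, hz, hempty]
    · exact fun a ha => by simp [Instr.run]
    · intro r hr
      simp at hr
      simp [Instr.run, hr]
  refine run_block_seq (run_seq ((run_buildLoop₂ hMg.1 hadj₂ hl₂ hI (by simp [Instr.run])).mono ?_))
  rintro s t ⟨ht, Es, hI, hA, hF⟩
  refine run_block_seq ((run_buildLoop₁ hadj₁ hl₁
    (hI.congr (by simp [Instr.run]) (fun r hr => by simp at hr; simp [Instr.run, hr]))
    (by simp [Instr.run]) hA hF).mono ?_)
  rintro s' t' ⟨ht', Es', hI', hF', hB'⟩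
  refine ⟨?_, Es', isReducedGraph_of_filled hMg hI'.sub hF' hB', hI'⟩
  simp only [List.length_cons, List.length_nil]
  omega

end Build


/-! ### Breadth first search for the layers -/

section Search

/-- Clear the labels and put the unmatched active nodes of `V₁` into the queue. -/
def bfsInit : Prog :=
  .seq (block [.const 3 0, .const 12 0, .const 13 0, .const 14 0, .const 15 0])
    (.loop (.lt 3 11) (.seq (block [.load 17 14 3, .load 4 4 17]) (.seq
      (.loop (.lt 2 4) (block [.load 5 7 4, .load 4 6 4, .store 15 5 2])) (.seq
      (block [.load 6 9 17]) (.seq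
      (.ite (.eq 6 2) (block [.store 16 15 17, .inc 15]) (block []))
      (block [.inc 3]))))))

/-- Array 15 holds the labels, register 13 the current layer, and register 12 becomes this layer
once a free node of V₂ is met. Array 16 is the queue, with head, end of the current layer and tail
in registers 14, 16 and 15. -/
def bfsScan : Prog :=
  .loop (.lt 2 4) (.seq (block [.load 5 7 4, .load 4 6 4, .load 6 15 5])
    (.ite (.eq 6 2) (.seq (block [.store 15 5 13, .load 6 10 5])
      (.ite (.eq 6 2) (block [.copy 12 13]) (block [.dec 6, .store 16 15 6, .inc 15])))
      (block [])))

def bfsLevel : Prog :=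
  .loop (.lt 14 16) (.seq (block [.load 17 16 14, .inc 14, .load 4 4 17]) bfsScan)

/-- The layer in which a free node appears is still completed; moving the head to the tail then
empties the queue and ends the search. -/
def bfsLoop : Prog :=
  .loop (.lt 14 15) (.seq (block [.copy 16 15, .inc 13]) (.seq bfsLevel
    (.ite (.lt 2 12) (block [.copy 14 15]) (block []))))

/-- Compute the labels of `V₂` up to the first layer with an unmatched node; the number of this
layer is left in the register `12`. -/
def bfsProg : Prog := .seq bfsInit bfsLoop

variable {n₁ n₂ : ℕ} {H M : Finset (Fin n₁ × Fin n₂)}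

/-- The cells `a`, …, `b - 1` of the array `m` hold the list `l`. -/
def Seg {n : ℕ} (m : ℕ → ℕ) : ℕ → ℕ → List (Fin n) → Prop
  | a, b, [] => a = b
  | a, b, x :: l => m a = x ∧ Seg m (a + 1) b l

theorem Seg.length {n : ℕ} {m : ℕ → ℕ} {a b : ℕ} {l : List (Fin n)} (h : Seg m a b l) :
    a + l.length = b := by
  induction l generalizing a with
  | nil => exact h
  | cons x l ih => have := ih h.2; simp; omega

theorem Seg.update {n : ℕ} {m : ℕ → ℕ} {a b c v : ℕ} {l : List (Fin n)} (h : Seg m a b l)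
    (hc : b ≤ c) : Seg (Function.update m c v) a b l := by
  induction l generalizing a with
  | nil => exact h
  | cons x l ih =>
    have := h.2.length
    exact ⟨by rw [Function.update_of_ne (by omega)]; exact h.1, ih h.2⟩

theorem Seg.push {n : ℕ} {m : ℕ → ℕ} {a b : ℕ} {l : List (Fin n)} (h : Seg m a b l) (x : Fin n) :
    Seg (Function.update m b x) a (b + 1) (l ++ [x]) := by
  induction l generalizing a with
  | nil => cases h; simp [Seg]
  | cons y l ih =>
    have := h.2.length
    exact ⟨by rw [Function.update_of_ne (by omega)]; exact h.1, ih h.2⟩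

/-- The memory while the Hopcroft–Karp algorithm runs: the adjacency lists of `H`, the list `act` of
the nodes of `V₁` that are not isolated, and the matching `M` from both sides. -/
structure HKInv (H : Finset (Fin n₁ × Fin n₂)) (adj : Fin n₁ → List (Fin n₂)) (act : List (Fin n₁))
    (M : Finset (Fin n₁ × Fin n₂)) (s : State) : Prop where
  isM : IsMatching H M
  r2 : s.reg 2 = 0
  ll : ∀ i : Fin n₁, IsLinkedList (s.mem 6) (s.mem 7) (s.mem 4 i) ((adj i).map Fin.val)
  ac : Seg (s.mem 14) 0 (s.reg 11) act
  m1 : Mates₁ M (s.mem 9)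
  m2 : Mates₂ M (s.mem 10)

theorem HKInv.congr {adj : Fin n₁ → List (Fin n₂)} {act : List (Fin n₁)} {s s' : State}
    (h : HKInv H adj act M s) (h2 : s'.reg 2 = s.reg 2) (h11 : s'.reg 11 = s.reg 11)
    (hm : ∀ a ∈ [4, 6, 7, 9, 10, 14], s'.mem a = s.mem a) : HKInv H adj act M s' := by
  obtain ⟨h0, h1, h3, h4, h5, h6⟩ := h
  refine ⟨h0, by rw [h2, h1], ?_, ?_, ?_, ?_⟩
  · rwa [hm 4 (by simp), hm 6 (by simp), hm 7 (by simp)]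
  · rwa [hm 14 (by simp), h11]
  · rwa [hm 9 (by simp)]
  · rwa [hm 10 (by simp)]

/-- `adj` and `act` list the neighbours of the nodes and the active nodes of `V₁`. -/
structure Lists (H : Finset (Fin n₁ × Fin n₂)) (adj : Fin n₁ → List (Fin n₂))
    (act : List (Fin n₁)) : Prop where
  adj : AdjLists₁ H adj
  nd : act.Nodup
  mem : ∀ i, i ∈ act ↔ ∃ j, (i, j) ∈ H

/-- Active nodes have degree at least 1, so a constant per node is paid by the edges. This keeps n₁
out of the cost of a phase. -/
theorem Lists.sum_le {adj : Fin n₁ → List (Fin n₂)} {act : List (Fin n₁)} (h : Lists H adj act)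
    (a b : ℕ) : ∑ i ∈ act.toFinset, (a * (adj i).length + b) ≤ (a + b) * H.card := by
  have h1 : ∀ i ∈ act.toFinset, a * (adj i).length + b ≤ (a + b) * (edgesAt H (Sum.inl i)).card := by
    intro i hi
    obtain ⟨j, hj⟩ := (h.mem i).1 (List.mem_toFinset.1 hi)
    have : 0 < (adj i).length := List.length_pos_of_mem (((h.adj i).2 j).2 hj)
    rw [← h.adj.length, add_mul]
    nlinarith
  refine (Finset.sum_le_sum h1).trans ?_
  rw [← Finset.mul_sum]
  exact Nat.mul_le_mul_left _ (sum_card_edgesAt_inl _)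

/-- By `hz`, old labels sit only at nodes with an edge, so walking through the lists of the active
nodes clears all of them without touching the rest of V₂. -/
theorem run_bfsInit {adj : Fin n₁ → List (Fin n₂)} {act : List (Fin n₁)} (hL : Lists H adj act)
    {s : State} (h : HKInv H adj act M s) (hz : ∀ j : Fin n₂, s.mem 15 j ≠ 0 → ∃ i, (i, j) ∈ H) :
    Run bfsInit s fun s' t => t ≤ 7 + 18 * H.card ∧ HKInv H adj act M s' ∧
      (∀ j : Fin n₂, s'.mem 15 j = 0) ∧ s'.reg 12 = 0 ∧ s'.reg 13 = 0 ∧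
      ∃ Q, Seg (s'.mem 16) (s'.reg 14) (s'.reg 15) Q ∧ Q.Nodup ∧
        ∀ i, i ∈ Q ↔ i ∈ act ∧ ∀ j, (i, j) ∉ M := by
  have hsum : (act.map fun i => 5 * (adj i).length + 13).sum ≤ 18 * H.card := by
    rw [← List.sum_toFinset _ hL.nd]
    exact hL.sum_le 5 13
  refine run_block_seq (run_loop (fun s n => ∃ rest Q, HKInv H adj act M s ∧ s.reg 12 = 0 ∧
    s.reg 13 = 0 ∧ s.reg 14 = 0 ∧ Seg (s.mem 14) (s.reg 3) (s.reg 11) rest ∧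
    Seg (s.mem 16) 0 (s.reg 15) Q ∧ rest.Nodup ∧ (∀ i ∈ rest, i ∈ act) ∧ Q.Nodup ∧
    (∀ i, i ∈ Q ↔ i ∈ act ∧ i ∉ rest ∧ ∀ j, (i, j) ∉ M) ∧
    (∀ j : Fin n₂, s.mem 15 j ≠ 0 → ∃ i ∈ rest, (i, j) ∈ H) ∧
    n = (rest.map fun i => 5 * (adj i).length + 13).sum)
    (n := (act.map fun i => 5 * (adj i).length + 13).sum)
    ⟨act, [], h.congr (by simp [Instr.run]) (by simp [Instr.run]) (by simp [Instr.run]),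
      by simp [Instr.run], by simp [Instr.run], by simp [Instr.run], ?_, ?_, hL.nd, fun _ h => h,
      List.nodup_nil, fun i => ⟨by simp, fun h => absurd h.1 h.2.1⟩, ?_, rfl⟩ ?_ ?_)
  · simpa [Instr.run] using h.ac
  · simp [Instr.run, Seg]
  · intro j hj
    obtain ⟨i, hi⟩ := hz j (by simpa [Instr.run] using hj)
    exact ⟨i, (hL.mem i).2 ⟨j, hi⟩, hi⟩
  · clear h hz
    rintro s n ⟨rest, Q, h, h12, h13, h14, hac, hQ, hnd, hsub, hQnd, hQm, hz, rfl⟩ hb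
    cases rest with
    | nil => simp only [Test.Holds] at hb; simp only [Seg] at hac; omega
    | cons i rest =>
      obtain ⟨hi, hac⟩ := hac
      have hnd := List.nodup_cons.1 hnd
      refine run_block_seq (run_seq ?_)
      set s₁ := runList [.load 17 14 3, .load 4 4 17] s with hs₁
      have h1 : HKInv H adj act M s₁ :=
        h.congr (by simp [hs₁, Instr.run]) (by simp [hs₁, Instr.run]) (by simp [hs₁, Instr.run])
      refine run_loop (fun s' n => ∃ rem, RegFrame [4, 5] s₁ s' ∧ MemFrame [15] s₁ s' ∧
        IsLinkedList (s₁.mem 6) (s₁.mem 7) (s'.reg 4) (rem.map Fin.val) ∧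
        (∀ j : Fin n₂, s'.mem 15 j ≠ 0 → j ∈ rem ∨ ∃ i ∈ rest, (i, j) ∈ H) ∧ n = 5 * rem.length)
        (n := 5 * (adj i).length) ⟨adj i, RegFrame.refl _ _, MemFrame.refl _ _, ?_, ?_, rfl⟩ ?_ ?_
      · simpa [hs₁, Instr.run, hi] using h.ll i
      · intro j hj
        obtain ⟨a, ha, haj⟩ := hz j (by simpa [hs₁, Instr.run] using hj)
        rcases List.mem_cons.1 ha with rfl | ha
        · exact Or.inl (((hL.adj a).2 j).2 haj)
        · exact Or.inr ⟨a, ha, haj⟩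
      · rintro s' n ⟨rem, hrf, hmf, hll, hl, rfl⟩ hb
        have hr2 : s'.reg 2 = 0 := by rw [hrf 2 (by simp), h1.r2]
        simp only [Test.Holds, hr2] at hb
        obtain ⟨x, rem', rfl, hky, hl'⟩ := hll.exists_cons hb.ne'
        have hm7 : s'.mem 7 = s₁.mem 7 := hmf 7 (by simp)
        have hm6 : s'.mem 6 = s₁.mem 6 := hmf 6 (by simp)
        refine run_block ⟨_, ⟨rem', ?_, ?_, ?_, ?_, rfl⟩, ?_⟩
        · intro r hr
          rw [← hrf r hr]
          simp at hr
          simp [Instr.run, hr]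
        · intro r hr
          rw [← hmf r hr]
          simp at hr
          simp [Instr.run, hr]
        · simpa [Instr.run, hm6] using hl'
        · intro j hj
          simp only [List.foldl, Instr.run, hm7, hm6] at hj
          simp [hky, Function.update_apply, hr2] at hj
          rcases hl j hj.2 with h | h
          · rcases List.mem_cons.1 h with rfl | h
            · exact absurd rfl hj.1
            · exact Or.inl h
          · exact Or.inr h
        · simp
          omega
      · rintro s' n' t ⟨rem, hrf, hmf, hll, hl, rfl⟩ hb ht
        have hr2 : s'.reg 2 = 0 := by rw [hrf 2 (by simp), h1.r2]
        simp only [Test.Holds, hr2, not_lt, Nat.le_zero] at hb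
        rw [hb] at hll
        have := hll.eq_nil
        simp only [List.map_eq_nil_iff] at this
        subst this
        have h' : HKInv H adj act M s' := h1.congr (hrf 2 (by simp)) (hrf 11 (by simp))
          (fun a ha => hmf a (by simp at ha ⊢; omega))
        have hl : ∀ j : Fin n₂, s'.mem 15 j ≠ 0 → ∃ i ∈ rest, (i, j) ∈ H := fun j hj => by
          simpa using hl j hj
        have h17 : s'.reg 17 = i := by rw [hrf 17 (by simp)]; simp [hs₁, Instr.run, hi]
        have h3 : s'.reg 3 = s.reg 3 := by rw [hrf 3 (by simp)]; simp [hs₁, Instr.run]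
        have h11 : s'.reg 11 = s.reg 11 := by rw [hrf 11 (by simp)]; simp [hs₁, Instr.run]
        have h12 : s'.reg 12 = 0 := by rw [hrf 12 (by simp)]; simp [hs₁, Instr.run, h12]
        have h13 : s'.reg 13 = 0 := by rw [hrf 13 (by simp)]; simp [hs₁, Instr.run, h13]
        have h14 : s'.reg 14 = 0 := by rw [hrf 14 (by simp)]; simp [hs₁, Instr.run, h14]
        have h15 : s'.reg 15 = s.reg 15 := by rw [hrf 15 (by simp)]; simp [hs₁, Instr.run]
        have hm14 : s'.mem 14 = s.mem 14 := by rw [hmf 14 (by simp)]; simp [hs₁, Instr.run]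
        have hm16 : s'.mem 16 = s.mem 16 := by rw [hmf 16 (by simp)]; simp [hs₁, Instr.run]
        refine run_block_seq (run_seq (run_ite (fun hb' => ?_) fun hb' => ?_))
        · simp only [Test.Holds, List.foldl, Instr.run, Function.update_apply] at hb'
          simp [hr2, h17, h'.m1.eq_zero] at hb'
          refine run_block (run_block ⟨_, ⟨rest, Q ++ [i], ?_, ?_, ?_, ?_, ?_, ?_, hnd.2, ?_, ?_, ?_,
            ?_, rfl⟩, ?_⟩)
          · exact h'.congr (by simp [Instr.run]) (by simp [Instr.run]) (by simp [Instr.run])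
          · simp [Instr.run, h12]
          · simp [Instr.run, h13]
          · simp [Instr.run, h14]
          · simpa [Instr.run, hm14, h3, h11] using hac
          · simpa [Instr.run, hm16, h15, h17] using hQ.push i
          · exact fun a ha => hsub a (List.mem_cons_of_mem _ ha)
          · rw [List.nodup_append]
            refine ⟨hQnd, by simp, ?_⟩
            rintro a ha b hb rfl
            rw [List.mem_singleton.1 hb] at ha
            exact ((hQm i).1 ha).2.1 (by simp)
          · intro a
            rw [List.mem_append, List.mem_singleton, hQm]
            constructor
            · rintro (h1 | rfl)
              · exact ⟨h1.1, fun h2 => h1.2.1 (List.mem_cons_of_mem _ h2), h1.2.2⟩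
              · exact ⟨hsub a (by simp), hnd.1, hb'⟩
            · rintro ⟨h1, h2, h3⟩
              by_cases hai : a = i
              · exact Or.inr hai
              · exact Or.inl ⟨h1, by simp [hai, h2], h3⟩
          · intro j hj
            exact hl j (by simpa [Instr.run] using hj)
          · simp
            omega
        · simp only [Test.Holds, List.foldl, Instr.run, Function.update_apply] at hb'
          simp [hr2, h17, h'.m1.eq_zero] at hb'
          refine run_block (run_block ⟨_, ⟨rest, Q, ?_, ?_, ?_, ?_, ?_, ?_, hnd.2, ?_, hQnd, ?_,
            ?_, rfl⟩, ?_⟩)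
          · exact h'.congr (by simp [Instr.run]) (by simp [Instr.run]) (by simp [Instr.run])
          · simp [Instr.run, h12]
          · simp [Instr.run, h13]
          · simp [Instr.run, h14]
          · simpa [Instr.run, hm14, h3, h11] using hac
          · simpa [Instr.run, hm16, h15, h17] using hQ
          · exact fun a ha => hsub a (List.mem_cons_of_mem _ ha)
          · intro a
            rw [hQm]
            constructor
            · rintro h1
              exact ⟨h1.1, fun h2 => h1.2.1 (List.mem_cons_of_mem _ h2), h1.2.2⟩
            · rintro ⟨h1, h2, h3⟩
              refine ⟨h1, ?_, h3⟩
              rw [List.mem_cons]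
              rintro (rfl | h4)
              · obtain ⟨j, hj⟩ := hb'
                exact h3 j hj
              · exact h2 h4
          · intro j hj
            exact hl j (by simpa [Instr.run] using hj)
          · simp
            omega
  · rintro s' n' t ⟨rest, Q, h, h12, h13, h14, hac, hQ, hnd, hsub, hQnd, hQm, hz, rfl⟩ hb ht
    have : rest = [] := by
      have := hac.length
      simp only [Test.Holds] at hb
      exact List.length_eq_zero_iff.1 (by omega)
    subst this
    refine ⟨?_, h, fun j => ?_, h12, h13, Q, by rwa [h14], hQnd, fun i => by simpa using hQm i⟩
    · simp only [List.map_nil, List.sum_nil, List.length_cons, List.length_nil] at ht ⊢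
      omega
    · by_contra h0
      simpa using hz j h0

/-- The state of the search while the layer `L` is processed.  `rest` and `next` are the remaining
nodes of the layer and the nodes of the next one, the nodes in `W` have not been taken from the
queue, and the pairs in `P` are still to be looked at. -/
structure LevelInv (H : Finset (Fin n₁ × Fin n₂)) (adj : Fin n₁ → List (Fin n₂)) (act : List (Fin n₁))
    (M : Finset (Fin n₁ × Fin n₂)) (L : ℕ) (rest next : List (Fin n₁)) (W : Finset (Fin n₁))
    (P : Fin n₁ → Fin n₂ → Prop) (s : State) : Prop where
  hk : HKInv H adj act M s
  hL : L ≠ 0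
  r13 : s.reg 13 = L
  seg₁ : Seg (s.mem 16) (s.reg 14) (s.reg 16) rest
  seg₂ : Seg (s.mem 16) (s.reg 16) (s.reg 15) next
  lab : ∀ j : Fin n₂, (s.mem 15 j = label H M j ∧ label H M j ≤ L) ∨
    (s.mem 15 j = 0 ∧ L ≤ label H M j)
  pend : ∀ i j, level H M i = L → (i, j) ∈ H → label H M j = L → s.mem 15 j = L ∨ P i j
  next_iff : ∀ i, i ∈ next ↔ ∃ j, (i, j) ∈ M ∧ s.mem 15 j = L
  kk : (s.reg 12 = 0 ∧ ∀ j : Fin n₂, (∀ i, (i, j) ∉ M) → s.mem 15 j ≠ L) ∨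
    (s.reg 12 = L ∧ ∃ j, (∀ i, (i, j) ∉ M) ∧ label H M j = L)
  lev : ∀ i ∈ rest, level H M i = L
  nd : (rest ++ next).Nodup
  sub : ∀ i ∈ rest ++ next, i ∈ W
  unl : ∀ i j, (i, j) ∈ M → s.mem 15 j = 0 → i ∈ W ∧ i ∉ rest ++ next

theorem run_bfsScan {adj : Fin n₁ → List (Fin n₂)} {act : List (Fin n₁)}
    {s : State} {L : ℕ} {rest next : List (Fin n₁)} {W : Finset (Fin n₁)} {i : Fin n₁}
    (hlev : level H M i = L) {rem₀ : List (Fin n₂)} (hrem : ∀ j ∈ rem₀, (i, j) ∈ H)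
    (h : LevelInv H adj act M L rest next W (fun a j => a ∈ rest ∨ (a = i ∧ j ∈ rem₀)) s)
    (hll : IsLinkedList (s.mem 6) (s.mem 7) (s.reg 4) (rem₀.map Fin.val)) :
    Run bfsScan s fun s' t => t ≤ 1 + 14 * rem₀.length ∧
      ∃ next', LevelInv H adj act M L rest next' W (fun a _ => a ∈ rest) s' := by
  refine run_loop (fun s' n => ∃ rem next, s'.mem 6 = s.mem 6 ∧ s'.mem 7 = s.mem 7 ∧
    (∀ j ∈ rem, (i, j) ∈ H) ∧
    LevelInv H adj act M L rest next W (fun a j => a ∈ rest ∨ (a = i ∧ j ∈ rem)) s' ∧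
    IsLinkedList (s.mem 6) (s.mem 7) (s'.reg 4) (rem.map Fin.val) ∧ n = 14 * rem.length)
    (n := 14 * rem₀.length) ⟨rem₀, next, rfl, rfl, hrem, h, hll, rfl⟩ ?_ ?_
  · clear h hrem hll
    rintro s' n ⟨rem, next, hm6, hm7, hrem, h, hll, rfl⟩ hb
    simp only [Test.Holds, h.hk.r2] at hb
    obtain ⟨x, rem', rfl, hky, hl'⟩ := hll.exists_cons hb.ne'
    have hr2 := h.hk.r2
    have hx := hrem x (by simp)
    have hrem' : ∀ j ∈ rem', (i, j) ∈ H := fun j hj => hrem j (List.mem_cons_of_mem _ hj)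
    have hlx := label_le_level h.hk.isM hx (by rw [hlev]; exact h.hL)
    rw [hlev] at hlx
    refine run_block_seq (run_ite (fun hb' => ?_) fun hb' => ?_)
    · simp only [Test.Holds, List.foldl, Instr.run, Function.update_apply] at hb'
      simp [hr2, hm7, hky] at hb'
      -- An unwritten label is at least `L`, and the edge from layer `L` makes it at most `L`.
      have hlabx : label H M x = L := by
        rcases h.lab x with h1 | h1 <;> omega
      have hlab : ∀ j : Fin n₂, (Function.update (s'.mem 15) x L j = label H M j ∧ label H M j ≤ L) ∨
          (Function.update (s'.mem 15) x L j = 0 ∧ L ≤ label H M j) := by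
        intro j
        by_cases hj : j = x
        · subst hj; simp [hlabx]
        · have : (j : ℕ) ≠ x := fun h => hj (Fin.ext h)
          rw [Function.update_of_ne this]; exact h.lab j
      have hpend : ∀ a j, level H M a = L → (a, j) ∈ H → label H M j = L →
          Function.update (s'.mem 15) x L j = L ∨ (a ∈ rest ∨ (a = i ∧ j ∈ rem')) := by
        intro a j h1 h2 h3
        by_cases hj : j = x
        · subst hj; simp
        · have : (j : ℕ) ≠ x := fun h => hj (Fin.ext h)
          rw [Function.update_of_ne this]
          simpa [hj] using h.pend a j h1 h2 h3
      refine run_block_seq (run_ite (fun hb'' => ?_) fun hb'' => ?_)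
      · simp only [Test.Holds, List.foldl, Instr.run, Function.update_apply] at hb''
        simp [hr2, hm7, hky, h.hk.m2.eq_zero] at hb''
        refine run_block ⟨_, ⟨rem', next, ?_, ?_, hrem', ⟨?_, h.hL, ?_, ?_, ?_, ?_, ?_, ?_, ?_, h.lev,
          h.nd, h.sub, ?_⟩, ?_, rfl⟩, ?_⟩
        · simp [Instr.run, hm6]
        · simp [Instr.run, hm7]
        · exact h.hk.congr (by simp [Instr.run]) (by simp [Instr.run]) (by simp [Instr.run])
        · simp [Instr.run, h.r13]
        · simpa [Instr.run] using h.seg₁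
        · simpa [Instr.run] using h.seg₂
        · simpa [Instr.run, hm7, hky, h.r13] using hlab
        · simpa [Instr.run, hm7, hky, h.r13] using hpend
        · intro a
          rw [h.next_iff]
          refine exists_congr fun j => and_congr_right fun haj => ?_
          have : (j : ℕ) ≠ x := fun h => hb'' a (by rw [← Fin.ext h]; exact haj)
          simp [Instr.run, hm7, hky, this]
        · exact Or.inr ⟨by simp [Instr.run, h.r13], x, hb'', hlabx⟩
        · intro a j haj h0
          have : (j : ℕ) ≠ x := fun h => hb'' a (by rw [← Fin.ext h]; exact haj)
          exact h.unl a j haj (by simpa [Instr.run, hm7, hky, this] using h0)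
        · simpa [Instr.run, hm6] using hl'
        · simp
          omega
      · simp only [Test.Holds, List.foldl, Instr.run, Function.update_apply] at hb''
        simp only [hr2, hm7, hky] at hb''
        obtain ⟨m, hmx, hm⟩ := h.hk.m2.exists_of_ne (j := x) (by simpa using hb'')
        -- A matched node enters the queue only through its partner; `x` was unlabelled, so `m` is
        -- new.
        have hun := h.unl m x hmx hb'
        refine run_block ⟨_, ⟨rem', next ++ [m], ?_, ?_, hrem', ⟨?_, h.hL, ?_, ?_, ?_, ?_, ?_, ?_, ?_,
          h.lev, ?_, ?_, ?_⟩, ?_, rfl⟩, ?_⟩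
        · simp [Instr.run, hm6]
        · simp [Instr.run, hm7]
        · exact h.hk.congr (by simp [Instr.run]) (by simp [Instr.run]) (by simp [Instr.run])
        · simp [Instr.run, h.r13]
        · have := h.seg₁.update (c := s'.reg 15) (v := m) (by have := h.seg₂.length; omega)
          simpa [Instr.run, hm7, hky, hm] using this
        · have := h.seg₂.push m
          simpa [Instr.run, hm7, hky, hm] using this
        · simpa [Instr.run, hm7, hky, h.r13] using hlab
        · simpa [Instr.run, hm7, hky, h.r13] using hpend
        · intro a
          rw [List.mem_append, List.mem_singleton, h.next_iff]
          simp only [List.foldl, Instr.run]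
          simp [hm7, hky, h.r13]
          constructor
          · rintro (⟨j, h1, h2⟩ | rfl)
            · refine ⟨j, h1, ?_⟩
              have : (j : ℕ) ≠ x := fun h3 => by
                rw [h3, hb'] at h2; exact h.hL h2.symm
              simp [this, h2]
            · exact ⟨x, hmx, by simp⟩
          · rintro ⟨j, h1, h2⟩
            by_cases hj : j = x
            · subst hj
              exact Or.inr (h.hk.isM.left_unique h1 hmx)
            · have : (j : ℕ) ≠ x := fun h => hj (Fin.ext h)
              rw [Function.update_of_ne this] at h2
              exact Or.inl ⟨j, h1, h2⟩
        · rcases h.kk with h1 | h1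
          · refine Or.inl ⟨by simp [Instr.run, h1.1], fun j hj => ?_⟩
            have : (j : ℕ) ≠ x := fun h => hj m (by rw [Fin.ext h]; exact hmx)
            simpa [Instr.run, hm7, hky, h.r13, this] using h1.2 j hj
          · exact Or.inr ⟨by simp [Instr.run, h1.1], h1.2⟩
        · rw [← List.append_assoc, List.nodup_append]
          refine ⟨h.nd, by simp, ?_⟩
          rintro a ha b hb rfl
          rw [List.mem_singleton.1 hb] at ha
          exact hun.2 ha
        · intro a ha
          rw [← List.append_assoc, List.mem_append] at ha
          rcases ha with ha | ha
          · exact h.sub a ha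
          · rw [List.mem_singleton.1 ha]; exact hun.1
        · intro a j haj h0
          have : (j : ℕ) ≠ x := fun h1 => by
            have := h.hL
            simp [Instr.run, hm7, hky, h1, h.r13, this] at h0
          have h2 := h.unl a j haj (by simpa [Instr.run, hm7, hky, this] using h0)
          refine ⟨h2.1, ?_⟩
          rw [← List.append_assoc, List.mem_append]
          rintro (h3 | h3)
          · exact h2.2 h3
          · rw [List.mem_singleton.1 h3] at haj
            exact this (by rw [h.hk.isM.right_unique haj hmx])
        · simpa [Instr.run, hm6] using hl'
        · simp
          omega
    · simp only [Test.Holds, List.foldl, Instr.run, Function.update_apply] at hb'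
      simp [hr2, hm7, hky] at hb'
      refine run_block ⟨_, ⟨rem', next, ?_, ?_, hrem', ⟨?_, h.hL, ?_, ?_, ?_, h.lab, ?_, ?_, ?_, h.lev,
          h.nd, h.sub, ?_⟩, ?_, rfl⟩, ?_⟩
      · simp [Instr.run, hm6]
      · simp [Instr.run, hm7]
      · exact h.hk.congr (by simp [Instr.run]) (by simp [Instr.run]) (by simp [Instr.run])
      · simp [Instr.run, h.r13]
      · simpa [Instr.run] using h.seg₁
      · simpa [Instr.run] using h.seg₂
      · intro a j h1 h2 h3
        rcases h.pend a j h1 h2 h3 with h4 | h4 | h4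
        · exact Or.inl h4
        · exact Or.inr (Or.inl h4)
        · rcases List.mem_cons.1 h4.2 with rfl | h5
          · left
            rcases h.lab j with h6 | h6
            · simpa [Instr.run, h3] using h6.1
            · exact absurd h6.1 hb'
          · exact Or.inr (Or.inr ⟨h4.1, h5⟩)
      · exact h.next_iff
      · simpa [Instr.run] using h.kk
      · exact h.unl
      · simpa [Instr.run, hm6] using hl'
      · simp
        omega
  · rintro s' n' t ⟨rem, next, hm6, hm7, hrem, h, hll, rfl⟩ hb ht
    simp only [Test.Holds, h.hk.r2, not_lt, Nat.le_zero] at hb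
    rw [hb] at hll
    have := hll.eq_nil
    simp only [List.map_eq_nil_iff] at this
    subst this
    exact ⟨by omega, next, by simpa using h⟩

/-- Each node taken from the queue leaves `W` and pays for its own list, so the bounds of successive
layers telescope. -/
theorem run_bfsLevel {adj : Fin n₁ → List (Fin n₂)} {act : List (Fin n₁)} (hadj : AdjLists₁ H adj)
    {s : State} {L : ℕ} {rest₀ next : List (Fin n₁)} {W : Finset (Fin n₁)}
    (h : LevelInv H adj act M L rest₀ next W (fun a _ => a ∈ rest₀) s) :
    Run bfsLevel s fun s' t => ∃ W' next', LevelInv H adj act M L [] next' W' (fun _ _ => False) s' ∧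
      W'.card + rest₀.length ≤ W.card ∧
      ∑ i ∈ W', (14 * (adj i).length + 6) + t ≤ ∑ i ∈ W, (14 * (adj i).length + 6) + 1 := by
  refine run_loop (fun s n => ∃ rest next W', LevelInv H adj act M L rest next W' (fun a _ => a ∈ rest) s ∧
    W'.card + rest₀.length ≤ W.card + rest.length ∧ n = ∑ i ∈ W', (14 * (adj i).length + 6))
    (n := ∑ i ∈ W, (14 * (adj i).length + 6)) ⟨rest₀, next, W, h, le_refl _, rfl⟩ ?_ ?_
  · clear h
    rintro s n ⟨rest, next, W', h, hW, rfl⟩ hb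
    cases rest with
    | nil =>
      have := h.seg₁
      simp only [Test.Holds] at hb
      simp only [Seg] at this
      omega
    | cons i rest =>
      obtain ⟨hi, hseg⟩ := h.seg₁
      have hnd : i ∉ rest ++ next ∧ (rest ++ next).Nodup := List.nodup_cons.1 h.nd
      have hiW : i ∈ W' := h.sub i (by simp)
      refine run_block_seq ((run_bfsScan (adj := adj) (act := act) (i := i) (rest := rest) (next := next) (W := W'.erase i)
        (s := runList [.load 17 16 14, .inc 14, .load 4 4 17] s) (rem₀ := adj i) (h.lev i (by simp)) (fun j hj => ((hadj i).2 j).1 hj)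
        ⟨?_, h.hL, ?_, ?_, ?_, h.lab, ?_, h.next_iff, ?_, ?_, hnd.2, ?_, ?_⟩ ?_).mono ?_)
      · exact h.hk.congr (by simp [Instr.run]) (by simp [Instr.run]) (by simp [Instr.run])
      · simp [Instr.run, h.r13]
      · simpa [Instr.run] using hseg
      · simpa [Instr.run] using h.seg₂
      · intro a j h1 h2 h3
        rcases h.pend a j h1 h2 h3 with h4 | h4
        · exact Or.inl h4
        · rcases List.mem_cons.1 h4 with rfl | h4
          · exact Or.inr (Or.inr ⟨rfl, ((hadj a).2 j).2 h2⟩)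
          · exact Or.inr (Or.inl h4)
      · simpa [Instr.run] using h.kk
      · exact fun a ha => h.lev a (List.mem_cons_of_mem _ ha)
      · intro a ha
        refine Finset.mem_erase.2 ⟨?_, h.sub a (List.mem_cons_of_mem _ ha)⟩
        rintro rfl
        exact hnd.1 ha
      · intro a j haj h0
        have h1 := h.unl a j haj h0
        refine ⟨Finset.mem_erase.2 ⟨?_, h1.1⟩, fun h2 => h1.2 (List.mem_cons_of_mem _ h2)⟩
        rintro rfl
        exact h1.2 (by simp)
      · simpa [Instr.run, hi] using h.hk.ll i
      · rintro s' t ⟨ht, next', h'⟩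
        refine ⟨_, ⟨rest, next', _, h', ?_, rfl⟩, ?_⟩
        · have := Finset.card_erase_add_one hiW
          simp at hW
          omega
        · have := Finset.sum_erase_add W' (fun i => 14 * (adj i).length + 6) hiW
          simp only [List.length_cons, List.length_nil]
          omega
  · rintro s' n' t ⟨rest, next, W', h, hW, rfl⟩ hb ht
    have : rest = [] := by
      have := h.seg₁.length
      simp only [Test.Holds] at hb
      exact List.length_eq_zero_iff.1 (by omega)
    subst this
    exact ⟨W', next, by simpa using h, by simpa using hW, by omega⟩

/-- The outcome of the search: the number of the first layer with an unmatched node of `V₂` (or `0`)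
and the labels up to this layer. -/
def Layered (H M : Finset (Fin n₁ × Fin n₂)) (s : State) : Prop :=
  (s.reg 12 = 0 ∧ ∀ j, (∀ i, (i, j) ∉ M) → label H M j = 0) ∨
    (ShortestLabel H M (s.reg 12) ∧
      ∀ j : Fin n₂, s.mem 15 j = if label H M j ≤ s.reg 12 then label H M j else 0)

/-- Layers have no gaps: tracing shortest walks backwards, a label beyond an empty layer would lead
into that layer. -/
theorem label_eq_zero_of_no_level (hM : IsMatching H M) {t : ℕ} (h : ∀ i j, (i, j) ∈ H → level H M i ≠ t + 1)
    {j : Fin n₂} (hj : t < label H M j) : False := by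
  have key : ∀ d j, label H M j ≠ t + 1 + d := by
    intro d
    induction d with
    | zero =>
      intro j hj
      obtain ⟨i, hi, hl⟩ := exists_of_label hM (j := j) (by omega)
      exact h i j hi (by omega)
    | succ d ih =>
      intro j hj
      obtain ⟨i, hi, hl⟩ := exists_of_label hM (j := j) (by omega)
      have hnf : ¬ ∀ j', (i, j') ∉ M := fun h => by rw [← level_eq_one hM] at h; omega
      push Not at hnf
      obtain ⟨j', hj'⟩ := hnf
      have := level_of_mem hM hj'
      split_ifs at this with h0
      · omega
      · exact ih j' (by omega)
  exact key (label H M j - (t + 1)) j (by omega)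

theorem run_bfsProg {adj : Fin n₁ → List (Fin n₂)} {act : List (Fin n₁)} (hLs : Lists H adj act)
    {s : State} (h : HKInv H adj act M s) (hz : ∀ j : Fin n₂, s.mem 15 j ≠ 0 → ∃ i, (i, j) ∈ H) :
    Run bfsProg s fun s' t => t ≤ 10 + 60 * H.card ∧ HKInv H adj act M s' ∧ Layered H M s' ∧
      ∀ j : Fin n₂, s'.mem 15 j ≠ 0 → ∃ i, (i, j) ∈ H := by
  refine run_seq ((run_bfsInit hLs h hz).mono ?_)
  clear h hz
  rintro s t ⟨ht, h, hlab, h12, h13, Q, hQ, hQnd, hQm⟩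
  have hM := h.isM
  -- The extra `10 * W.card` pays the overhead of the layers: each round has a nonempty queue and
  -- takes at least one node out of `W`.
  refine run_loop (fun s n => ∃ L Q W, HKInv H adj act M s ∧ s.reg 13 = L ∧
    Seg (s.mem 16) (s.reg 14) (s.reg 15) Q ∧
    (∀ j : Fin n₂, s.mem 15 j = if label H M j ≤ L then label H M j else 0) ∧
    ((s.reg 12 = 0 ∧ (∀ i, i ∈ Q ↔ level H M i = L + 1 ∧ i ∈ act) ∧
      (∀ j, (∀ i, (i, j) ∉ M) → label H M j ≤ L → label H M j = 0) ∧ Q.Nodup ∧ (∀ i ∈ Q, i ∈ W) ∧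
      (∀ i j, (i, j) ∈ M → s.mem 15 j = 0 → i ∈ W ∧ i ∉ Q)) ∨
      (s.reg 12 = L ∧ Q = [] ∧ ShortestLabel H M L)) ∧
    n = ∑ i ∈ W, (14 * (adj i).length + 6) + 10 * W.card)
    (n := ∑ i ∈ act.toFinset, (14 * (adj i).length + 6) + 10 * act.toFinset.card)
    ⟨0, Q, act.toFinset, h, h13, hQ, ?_, Or.inl ⟨h12, ?_, ?_, hQnd, ?_, ?_⟩, rfl⟩ ?_ ?_
  · intro j
    rw [hlab]
    split_ifs <;> omega
  · intro i
    rw [hQm, zero_add, level_eq_one hM, and_comm]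
  · intro j _ hj
    omega
  · intro i hi
    exact List.mem_toFinset.2 ((hQm i).1 hi).1
  · intro i j hij _
    exact ⟨List.mem_toFinset.2 ((hLs.mem i).2 ⟨j, hM.1 hij⟩), fun hi => ((hQm i).1 hi).2 j hij⟩
  · clear h hlab h12 h13 hQ hQnd hQm ht
    rintro s n ⟨L, Q, W, h, h13, hQ, hlab, hor, rfl⟩ hb
    have hlen := hQ.length
    simp only [Test.Holds] at hb
    rcases hor with ⟨h12, hQm, hfree, hQnd, hQW, hunl⟩ | ⟨-, rfl, -⟩
    swap
    · simp at hlen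
      omega
    have hstart : LevelInv H adj act M (L + 1) Q [] W (fun a _ => a ∈ Q)
        (runList [.copy 16 15, .inc 13] s) := by
      refine ⟨?_, by omega, ?_, ?_, ?_, ?_, ?_, ?_, ?_, ?_, by simpa using hQnd, by simpa using hQW, ?_⟩
      · exact h.congr (by simp [Instr.run]) (by simp [Instr.run]) (by simp [Instr.run])
      · simp [Instr.run, h13]
      · simpa [Instr.run] using hQ
      · simp [Instr.run, Seg]
      · intro j
        have := hlab j
        simp only [List.foldl, Instr.run]
        split_ifs at this <;> omega
      · intro i j h1 h2 _
        exact Or.inr ((hQm i).2 ⟨h1, (hLs.mem i).2 ⟨j, h2⟩⟩)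
      · intro i
        simp only [List.not_mem_nil, false_iff, not_exists, not_and]
        intro j _ hj
        have := hlab j
        simp only [List.foldl, Instr.run] at hj
        split_ifs at this <;> omega
      · refine Or.inl ⟨by simp [Instr.run, h12], fun j _ hj => ?_⟩
        have := hlab j
        simp only [List.foldl, Instr.run] at hj
        split_ifs at this <;> omega
      · exact fun i hi => ((hQm i).1 hi).1
      · intro i j hij h0
        simpa using hunl i j hij (by simpa [Instr.run] using h0)
    refine run_block_seq (run_seq ((run_bfsLevel hLs.adj hstart).mono ?_))
    rintro s' t ⟨W', Q', h', hW', ht⟩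
    have hQpos : 0 < Q.length := by omega
    have hlab' : ∀ j : Fin n₂, s'.mem 15 j = if label H M j ≤ L + 1 then label H M j else 0 := by
      intro j
      rcases h'.lab j with h1 | h1
      · rw [if_pos h1.2, h1.1]
      · split_ifs with h2
        · have hlj : label H M j = L + 1 := by omega
          obtain ⟨i, hi, hl⟩ := exists_of_label hM (j := j) (by omega)
          have := (h'.pend i j (by omega) hi hlj).resolve_right id
          omega
        · exact h1.1
    have hmem' : ∀ j : Fin n₂, s'.mem 15 j = L + 1 ↔ label H M j = L + 1 := by
      intro j
      have := hlab' j
      split_ifs at this <;> omega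
    refine run_ite (fun hb' => ?_) fun hb' => ?_
    · simp only [Test.Holds, h'.hk.r2] at hb'
      have hkk := h'.kk.resolve_left (fun h1 => by omega)
      refine run_block ⟨_, ⟨L + 1, [], W', ?_, ?_, ?_, ?_, Or.inr ⟨?_, rfl, by omega, hkk.2, ?_⟩, rfl⟩, ?_⟩
      · exact h'.hk.congr (by simp [Instr.run]) (by simp [Instr.run]) (by simp [Instr.run])
      · simp [Instr.run, h'.r13]
      · simp [Instr.run, Seg]
      · simpa [Instr.run] using hlab'
      · simp [Instr.run, hkk.1]
      · intro j hj h0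
        have := hfree j hj
        omega
      · simp only [List.length_cons, List.length_nil]
        omega
    · simp only [Test.Holds, h'.hk.r2, not_lt, Nat.le_zero] at hb'
      have hkk := h'.kk.resolve_right (fun h1 => by omega)
      refine run_block ⟨_, ⟨L + 1, Q', W', ?_, ?_, ?_, ?_, Or.inl ⟨?_, ?_, ?_, ?_, ?_, ?_⟩, rfl⟩, ?_⟩
      · exact h'.hk.congr (by simp [Instr.run]) (by simp [Instr.run]) (by simp [Instr.run])
      · simp [Instr.run, h'.r13]
      · have h1 : s'.reg 14 = s'.reg 16 := h'.seg₁
        simpa [Instr.run, h1] using h'.seg₂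
      · simpa [Instr.run] using hlab'
      · simp [Instr.run, hb']
      · intro i
        rw [h'.next_iff]
        constructor
        · rintro ⟨j, hij, hj⟩
          have h1 := level_of_mem hM hij
          rw [hmem'] at hj
          rw [hj] at h1
          exact ⟨by simpa using h1, (hLs.mem i).2 ⟨j, hM.1 hij⟩⟩
        · rintro ⟨h1, -⟩
          have hnf : ¬ ∀ j', (i, j') ∉ M := fun h => by rw [← level_eq_one hM] at h; omega
          push Not at hnf
          obtain ⟨j, hj⟩ := hnf
          have h2 := level_of_mem hM hj
          refine ⟨j, hj, (hmem' j).2 ?_⟩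
          split_ifs at h2 <;> omega
      · intro j hj hle
        by_cases hlj : label H M j = L + 1
        · exact absurd ((hmem' j).2 hlj) (hkk.2 j hj)
        · exact hfree j hj (by omega)
      · simpa using h'.nd
      · simpa using h'.sub
      · simpa [Instr.run] using h'.unl
      · simp only [List.length_cons, List.length_nil]
        omega
  · rintro s' n' t' ⟨L, Q, W, h, h13, hQ, hlab, hor, rfl⟩ hb ht'
    have hsum := hLs.sum_le 14 16
    have hsum' : ∑ i ∈ act.toFinset, (14 * (adj i).length + 16) =
        ∑ i ∈ act.toFinset, (14 * (adj i).length + 6) + 10 * act.toFinset.card := by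
      rw [mul_comm, ← smul_eq_mul, ← Finset.sum_const, ← Finset.sum_add_distrib]
    refine ⟨by omega, h, ?_, fun j hj => ?_⟩
    · rcases hor with ⟨h12, hQm, hfree, -⟩ | ⟨h12, -, hS⟩
      · have hQ0 : Q = [] := by
          have := hQ.length
          simp only [Test.Holds] at hb
          exact List.length_eq_zero_iff.1 (by omega)
        subst hQ0
        refine Or.inl ⟨h12, fun j hj => hfree j hj ?_⟩
        by_contra hlt
        refine label_eq_zero_of_no_level hM (t := L) (fun i j hij hl => ?_) (not_le.1 hlt)
        have := (hQm i).2 ⟨hl, (hLs.mem i).2 ⟨j, hij⟩⟩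
        simp at this
      · rw [← h12] at hS hlab
        exact Or.inr ⟨hS, hlab⟩
    · have := hlab j
      have : label H M j ≠ 0 := by
        intro h0
        rw [h0] at this
        simp at this
        exact hj this
      obtain ⟨i, hi, -⟩ := exists_of_label hM this
      exact ⟨i, hi⟩

end Search


/-! ### Depth first search and augmentation -/

section Phase

/-- Exchange the edges along the path on the stack. -/
def augLoop : Prog :=
  .loop (.lt 2 18) (block [.load 17 17 18, .load 6 9 17, .inc 5, .store 9 17 5, .dec 5,
    .inc 17, .store 10 5 17, .copy 5 6, .dec 5, .dec 18])

/-- The stack height in register 18 equals the layer of the node on top, so `.eq 6 18` asks whether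
the edge is tight. Array 17 is the stack and array 18 keeps the suspended list pointers. Setting a
label to 0 marks a node of V₂ as visited. A height of 0 ends the search, after failure as well as
after `augLoop`. -/
def dfsLoop : Prog :=
  .loop (.lt 2 18) (.ite (.eq 4 2) (block [.dec 18, .load 4 18 18])
    (.seq (block [.load 5 7 4, .load 4 6 4, .load 6 15 5])
      (.ite (.eq 6 18)
        (.seq (block [.store 15 5 2, .load 6 10 5])
          (.ite (.eq 6 2) augLoop
            (block [.store 18 18 4, .inc 18, .dec 6, .store 17 18 6, .load 4 4 6])))
        (block []))))

def rootLoop : Prog :=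
  .loop (.lt 3 11) (.seq (block [.load 17 14 3, .load 6 9 17]) (.seq
    (.ite (.eq 6 2) (.seq (block [.const 18 1, .store 17 18 17, .load 4 4 17]) dfsLoop) (block []))
    (block [.inc 3])))

/-- One phase: depth first searches for disjoint shortest augmenting paths, and the layers for the
next phase. -/
def phaseProg : Prog := .seq (block [.const 3 0]) (.seq rootLoop bfsProg)

theorem run_loop_step {b : Test} {p : Prog} {s : State} {Q : State → ℕ → Prop} (hb : b.Holds s)
    (h : Run p s fun s' t => Run (.loop b p) s' fun s'' t' => Q s'' (1 + t + t')) :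
    Run (.loop b p) s Q := by
  obtain ⟨t, s', he, t', s'', he', hq⟩ := h
  exact ⟨_, _, .loopStep hb he he', hq⟩

theorem run_loop_done {b : Test} {p : Prog} {s : State} {Q : State → ℕ → Prop} (hb : ¬ b.Holds s)
    (h : Q s 1) : Run (.loop b p) s Q :=
  ⟨_, _, .loopDone hb, h⟩

variable {n₁ n₂ : ℕ} {H M : Finset (Fin n₁ × Fin n₂)}

/-- The nodes of `V₁` on the path are on the stack `m`, and `f` gives their partners. -/
def PathMem (m f : ℕ → ℕ) : List (Fin n₁ × Fin n₂) → Prop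
  | [] => True
  | e :: l => m (l.length + 1) = e.1 ∧ (∀ g ∈ l.head?, f e.1 = g.2 + 1) ∧ PathMem m f l

theorem PathMem.congr {m f f' : ℕ → ℕ} {l : List (Fin n₁ × Fin n₂)} (h : PathMem m f l)
    (hf : ∀ e ∈ l, f' e.1 = f e.1) : PathMem m f' l := by
  induction l with
  | nil => trivial
  | cons e l ih =>
    exact ⟨h.1, by rw [hf e (by simp)]; exact h.2.1, ih h.2.2 fun g hg => hf g (List.mem_cons_of_mem _ hg)⟩

/-- The stack stores only nodes of V₁: the old partner of the node being rematched, read before it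
is overwritten, is the V₂-node for the entry below. -/
theorem run_augLoop {l : List (Fin n₁ × Fin n₂)} {s : State} (h18 : s.reg 18 = l.length)
    (h2 : s.reg 2 = 0) (h5 : ∀ e ∈ l.head?, s.reg 5 = e.2) (hm : PathMem (s.mem 17) (s.mem 9) l)
    (hnd₁ : (l.map Prod.fst).Nodup) (hnd₂ : (l.map Prod.snd).Nodup) :
    Run augLoop s fun s' t => t ≤ 1 + 12 * l.length ∧ s'.reg 18 = 0 ∧
      RegFrame [5, 6, 17, 18] s s' ∧ MemFrame [9, 10] s s' ∧
      (∀ e ∈ l, s'.mem 9 e.1 = e.2 + 1 ∧ s'.mem 10 e.2 = e.1 + 1) ∧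
      (∀ i : Fin n₁, (∀ e ∈ l, e.1 ≠ i) → s'.mem 9 i = s.mem 9 i) ∧
      ∀ j : Fin n₂, (∀ e ∈ l, e.2 ≠ j) → s'.mem 10 j = s.mem 10 j := by
  induction l generalizing s with
  | nil =>
    refine run_loop_done ?_ ⟨by omega, h18, RegFrame.refl _ _, MemFrame.refl _ _, by simp, by simp, by simp⟩
    simp [Test.Holds, h2, h18]
  | cons e l ih =>
    obtain ⟨i, j⟩ := e
    obtain ⟨hm1, hm2, hm3⟩ := hm
    have h5 : s.reg 5 = j := h5 (i, j) (by simp)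
    simp only [List.map_cons, List.nodup_cons, List.mem_map, not_exists, not_and] at hnd₁ hnd₂
    simp only [List.length_cons] at h18
    refine run_loop_step (by simp [Test.Holds, h2, h18]) (run_block ((ih ?_ ?_ ?_ ?_ hnd₁.2 hnd₂.2).mono ?_))
    · simp [Instr.run, h18]
    · simp [Instr.run, h2]
    · intro g hg
      have := hm2 g hg
      simp at this
      simp [Instr.run, h18, hm1, this]
    -- The nodes of the path are distinct, so the old partners still to be read are untouched.
    · have : PathMem (s.mem 17) (Function.update (s.mem 9) i (j + 1)) l := by
        refine hm3.congr fun g hg => ?_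
        have : (g.1 : ℕ) ≠ i := fun h => hnd₁.1 g hg (Fin.ext h)
        rw [Function.update_of_ne this]
      simpa [Instr.run, h18, hm1, h5] using this
    · rintro s' t ⟨ht, h18', hrf, hmf, hl, h9, h10⟩
      have hs9 : ∀ x, (runList [.load 17 17 18, .load 6 9 17, .inc 5, .store 9 17 5, .dec 5,
          .inc 17, .store 10 5 17, .copy 5 6, .dec 5, .dec 18] s).mem 9 x =
          Function.update (s.mem 9) i (j + 1) x := fun x => by
        simp [Instr.run, h18, hm1, h5]
      have hs10 : ∀ x, (runList [.load 17 17 18, .load 6 9 17, .inc 5, .store 9 17 5, .dec 5,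
          .inc 17, .store 10 5 17, .copy 5 6, .dec 5, .dec 18] s).mem 10 x =
          Function.update (s.mem 10) j (i + 1) x := fun x => by
        simp [Instr.run, h18, hm1, h5]
      refine ⟨?_, h18', ?_, ?_, ?_, ?_, ?_⟩
      · simp only [List.length_cons, List.length_nil] at ht ⊢
        omega
      · intro r hr
        rw [hrf r hr]
        simp at hr
        simp [Instr.run, hr]
      · intro r hr
        rw [hmf r hr]
        simp at hr
        simp [Instr.run, hr]
      · intro e he
        rcases List.mem_cons.1 he with rfl | he
        · rw [h9 i hnd₁.1, h10 j hnd₂.1, hs9, hs10]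
          simp
        · exact hl e he
      · intro a ha
        have h1 : (a : ℕ) ≠ i := fun h => ha (i, j) (by simp) (Fin.ext h.symm)
        rw [h9 a fun e he => ha e (List.mem_cons_of_mem _ he), hs9, Function.update_of_ne h1]
      · intro a ha
        have h1 : (a : ℕ) ≠ j := fun h => ha (i, j) (by simp) (Fin.ext h.symm)
        rw [h10 a fun e he => ha e (List.mem_cons_of_mem _ he), hs10, Function.update_of_ne h1]

/-- The matching `M` after augmentation along the paths in `Ps`. -/
def augment (M : Finset (Fin n₁ × Fin n₂)) (Ps : Finset (List (Fin n₁ × Fin n₂))) :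
    Finset (Fin n₁ × Fin n₂) :=
  symmDiff M (Ps.biUnion pathEdges)

variable {Ps : Finset (List (Fin n₁ × Fin n₂))}

/-- A matching edge meets an augmenting path with both ends or not at all. -/
theorem IsAugPath.on_left_iff (hM : IsMatching H M) {P : List (Fin n₁ × Fin n₂)} (hP : IsAugPath H M P)
    {i : Fin n₁} {j : Fin n₂} (hij : (i, j) ∈ M) : (∃ e ∈ P, e.1 = i) ↔ ∃ e ∈ P, e.2 = j := by
  constructor
  · rintro ⟨e, he, h⟩
    have := (hP.mem_pathEdges_of_mem hM hij).2 ⟨e, he, Or.inl h.symm⟩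
    rcases mem_pathEdges.1 this with h1 | ⟨k, hk, h1⟩
    · exact ⟨_, h1, rfl⟩
    · exact ⟨P[k], List.getElem_mem _, (Prod.mk.inj h1).2.symm⟩
  · rintro ⟨e, he, h⟩
    have := (hP.mem_pathEdges_of_mem hM hij).2 ⟨e, he, Or.inr h.symm⟩
    rcases mem_pathEdges.1 this with h1 | ⟨k, hk, h1⟩
    · exact ⟨_, h1, rfl⟩
    · exact ⟨P[k + 1], List.getElem_mem _, (Prod.mk.inj h1).1.symm⟩

/-- The program augments path by path, whereas a phase is defined by one symmetric difference with
the original `M`; this bridges the two. -/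
theorem mates₁_augment_insert (hM : IsMatching H M) (hPs : ∀ P ∈ Ps, IsAugPath H M P)
    {P : List (Fin n₁ × Fin n₂)} (hP : IsAugPath H M P) {f f' : ℕ → ℕ}
    (h : Mates₁ (augment M Ps) f) (h1 : ∀ e ∈ P, f' e.1 = e.2 + 1)
    (h2 : ∀ i : Fin n₁, (∀ e ∈ P, e.1 ≠ i) → f' i = f i) : Mates₁ (augment M (insert P Ps)) f' := by
  have hPs' : ∀ Q ∈ insert P Ps, IsAugPath H M Q := fun Q hQ => by
    rcases Finset.mem_insert.1 hQ with rfl | hQ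
    · exact hP
    · exact hPs Q hQ
  intro i
  by_cases hi : ∃ e ∈ P, e.1 = i
  · obtain ⟨e, he, rfl⟩ := hi
    exact Or.inr ⟨e.2, (mem_augment hM hPs').2 (Or.inl ⟨P, by simp, he⟩), h1 e he⟩
  · have hi' : ∀ e ∈ P, e.1 ≠ i := fun e he h => hi ⟨e, he, h⟩
    rw [h2 i hi']
    rcases h i with h3 | ⟨j, hj, h3⟩
    · refine Or.inl ⟨h3.1, fun j hj => h3.2 j ((mem_augment hM hPs).2 ?_)⟩
      rcases (mem_augment hM hPs').1 hj with ⟨Q, hQ, hQe⟩ | h4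
      · rcases Finset.mem_insert.1 hQ with rfl | hQ
        · exact absurd rfl (hi' _ hQe)
        · exact Or.inl ⟨Q, hQ, hQe⟩
      · exact Or.inr ⟨h4.1, fun Q hQ => h4.2 Q (Finset.mem_insert_of_mem hQ)⟩
    · refine Or.inr ⟨j, (mem_augment hM hPs').2 ?_, h3⟩
      rcases (mem_augment hM hPs).1 hj with ⟨Q, hQ, hQe⟩ | h4
      · exact Or.inl ⟨Q, Finset.mem_insert_of_mem hQ, hQe⟩
      · refine Or.inr ⟨h4.1, fun Q hQ => ?_⟩
        rcases Finset.mem_insert.1 hQ with rfl | hQ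
        · rw [hP.on_left_iff hM h4.1] at hi
          exact fun e he => ⟨(hi' e he).symm, fun h => hi ⟨e, he, h.symm⟩⟩
        · exact h4.2 Q hQ

theorem mates₂_augment_insert (hM : IsMatching H M) (hPs : ∀ P ∈ Ps, IsAugPath H M P)
    {P : List (Fin n₁ × Fin n₂)} (hP : IsAugPath H M P) {f f' : ℕ → ℕ}
    (h : Mates₂ (augment M Ps) f) (h1 : ∀ e ∈ P, f' e.2 = e.1 + 1)
    (h2 : ∀ j : Fin n₂, (∀ e ∈ P, e.2 ≠ j) → f' j = f j) : Mates₂ (augment M (insert P Ps)) f' := by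
  have hPs' : ∀ Q ∈ insert P Ps, IsAugPath H M Q := fun Q hQ => by
    rcases Finset.mem_insert.1 hQ with rfl | hQ
    · exact hP
    · exact hPs Q hQ
  intro j
  by_cases hj : ∃ e ∈ P, e.2 = j
  · obtain ⟨e, he, rfl⟩ := hj
    exact Or.inr ⟨e.1, (mem_augment hM hPs').2 (Or.inl ⟨P, by simp, he⟩), h1 e he⟩
  · have hj' : ∀ e ∈ P, e.2 ≠ j := fun e he h => hj ⟨e, he, h⟩
    rw [h2 j hj']
    rcases h j with h3 | ⟨i, hi, h3⟩
    · refine Or.inl ⟨h3.1, fun i hi => h3.2 i ((mem_augment hM hPs).2 ?_)⟩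
      rcases (mem_augment hM hPs').1 hi with ⟨Q, hQ, hQe⟩ | h4
      · rcases Finset.mem_insert.1 hQ with rfl | hQ
        · exact absurd rfl (hj' _ hQe)
        · exact Or.inl ⟨Q, hQ, hQe⟩
      · exact Or.inr ⟨h4.1, fun Q hQ => h4.2 Q (Finset.mem_insert_of_mem hQ)⟩
    · refine Or.inr ⟨i, (mem_augment hM hPs').2 ?_, h3⟩
      rcases (mem_augment hM hPs).1 hi with ⟨Q, hQ, hQe⟩ | h4
      · exact Or.inl ⟨Q, Finset.mem_insert_of_mem hQ, hQe⟩
      · refine Or.inr ⟨h4.1, fun Q hQ => ?_⟩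
        rcases Finset.mem_insert.1 hQ with rfl | hQ
        · rw [← hP.on_left_iff hM h4.1] at hj
          exact fun e he => ⟨fun h => hj ⟨e, he, h.symm⟩, (hj' e he).symm⟩
        · exact h4.2 Q hQ

/-- The searches read partners in the current matching. At nodes off the paths found so far these
are the partners in `M`, to which the layers refer. -/
theorem mem_augment_of_off_right (hM : IsMatching H M) (hPs : ∀ P ∈ Ps, IsAugPath H M P)
    {i : Fin n₁} {j : Fin n₂} (hj : ∀ P ∈ Ps, ∀ e ∈ P, e.2 ≠ j) : (i, j) ∈ augment M Ps ↔ (i, j) ∈ M := by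
  unfold augment
  rw [mem_augment hM hPs]
  constructor
  · rintro (⟨P, hP, he⟩ | h)
    · exact absurd rfl (hj P hP _ he)
    · exact h.1
  · refine fun h => Or.inr ⟨h, fun P hP f hf => ⟨fun h1 => ?_, (hj P hP f hf).symm⟩⟩
    obtain ⟨e, he, h2⟩ := ((hPs P hP).on_left_iff hM h).1 ⟨f, hf, h1.symm⟩
    exact hj P hP e he h2

/-- No edge from `i` to the next layer is left. -/
def Done (H M : Finset (Fin n₁ × Fin n₂)) (f : ℕ → ℕ) (i : Fin n₁) : Prop :=
  ∀ j : Fin n₂, (i, j) ∈ H → label H M j = level H M i → f j = 0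

/-- Invariant of the depth first searches of one phase: the paths in `Ps` have been found, the nodes
of `V₂` with property `S` are on the stack, the nodes in `W` have not been on the stack, the searches
from the nodes with property `R` are finished, and those from the nodes in `rest` are to come. -/
structure DfsInv (H : Finset (Fin n₁ × Fin n₂)) (adj : Fin n₁ → List (Fin n₂)) (act : List (Fin n₁))
    (M : Finset (Fin n₁ × Fin n₂)) (K a : ℕ) (rest : List (Fin n₁)) (R : Fin n₁ → Prop)
    (Ps : Finset (List (Fin n₁ × Fin n₂))) (S : Fin n₂ → Prop) (W : Finset (Fin n₁)) (s : State) :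
    Prop where
  hk : HKInv H adj act (augment M Ps) s
  r3 : s.reg 3 = a
  pth : ∀ P ∈ Ps, IsAugPath H M P ∧ P.length = K
  dis : ∀ P ∈ Ps, ∀ Q ∈ Ps, P ≠ Q → NodeDisjoint P Q
  pvis : ∀ P ∈ Ps, ∀ e ∈ P, s.mem 15 e.2 = 0
  lab : ∀ j : Fin n₂, s.mem 15 j = 0 ∨ (s.mem 15 j = label H M j ∧ label H M j ≤ K)
  vis : ∀ j : Fin n₂, label H M j ≠ 0 → label H M j ≤ K → s.mem 15 j = 0 →
    (∃ P ∈ Ps, ∃ e ∈ P, e.2 = j) ∨ (∃ i, (i, j) ∈ M ∧ Done H M (s.mem 15) i) ∨ S j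
  wm : ∀ i j, (i, j) ∈ M → s.mem 15 j ≠ 0 → i ∈ W
  wr : ∀ i ∈ rest, (∀ j, (i, j) ∉ M) → i ∈ W
  roots : ∀ i, R i → (∃ P ∈ Ps, ∃ e ∈ P, e.1 = i) ∨ Done H M (s.mem 15) i

theorem DfsInv.congr {adj : Fin n₁ → List (Fin n₂)} {act : List (Fin n₁)} {K a : ℕ}
    {rest : List (Fin n₁)} {R : Fin n₁ → Prop} {S : Fin n₂ → Prop} {W : Finset (Fin n₁)} {s s' : State}
    (h : DfsInv H adj act M K a rest R Ps S W s) (hr : ∀ r ∈ [2, 3, 11], s'.reg r = s.reg r)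
    (hm : ∀ a ∈ [4, 6, 7, 9, 10, 14, 15], s'.mem a = s.mem a) :
    DfsInv H adj act M K a rest R Ps S W s' := by
  have h15 := hm 15 (by simp)
  obtain ⟨h1, h2, h3, h4, h5, h6, h7, h8, h9, h10⟩ := h
  refine ⟨h1.congr (hr 2 (by simp)) (hr 11 (by simp)) fun a ha => hm a (by simp at ha ⊢; omega),
    by rw [hr 3 (by simp), h2], h3, h4, ?_, ?_, ?_, ?_, h9, ?_⟩ <;> rwa [h15]

/-- The suspended searches on the stack: a node of `V₁`, the node of `V₂` that was entered from it,
and the neighbours that are still to be looked at. -/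
def Frames (H M : Finset (Fin n₁ × Fin n₂)) (Ps : Finset (List (Fin n₁ × Fin n₂)))
    (m : ℕ → ℕ → ℕ) : List (Fin n₁ × Fin n₂ × List (Fin n₂)) → Prop
  | [] => True
  | g :: G => m 17 (G.length + 1) = g.1 ∧
      IsLinkedList (m 6) (m 7) (m 18 (G.length + 1)) (g.2.2.map Fin.val) ∧
      (∀ x ∈ g.2.2, (g.1, x) ∈ H) ∧
      (∀ j : Fin n₂, (g.1, j) ∈ H → label H M j = level H M g.1 → m 15 j = 0 ∨ j ∈ g.2.2) ∧
      m 15 g.2.1 = 0 ∧ (∀ P ∈ Ps, ∀ e ∈ P, e.1 ≠ g.1 ∧ e.2 ≠ g.2.1) ∧ Frames H M Ps m G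

theorem Frames.congr {m m' : ℕ → ℕ → ℕ} {G : List (Fin n₁ × Fin n₂ × List (Fin n₂))}
    (h : Frames H M Ps m G) (h6 : m' 6 = m 6) (h7 : m' 7 = m 7)
    (hk : ∀ k ≤ G.length, m' 17 k = m 17 k ∧ m' 18 k = m 18 k)
    (h15 : ∀ j : Fin n₂, m 15 j = 0 → m' 15 j = 0) : Frames H M Ps m' G := by
  induction G with
  | nil => trivial
  | cons g G ih =>
    obtain ⟨h1, h2, h3, h4, h5, h8, h9⟩ := h
    have := hk (G.length + 1) (by simp)
    refine ⟨by rw [this.1, h1], by rwa [this.2, h6, h7], h3, fun j h1 h2 => (h4 j h1 h2).imp (h15 j) id,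
      h15 _ h5, h8, ih h9 fun k hk' => hk k (by simp; omega)⟩

/-- The running search: it is at the node `i`, started at `r`, and has still to look at `rem`. -/
structure Top (H M : Finset (Fin n₁ × Fin n₂)) (Ps : Finset (List (Fin n₁ × Fin n₂))) (r i : Fin n₁)
    (rem : List (Fin n₂)) (G : List (Fin n₁ × Fin n₂ × List (Fin n₂))) (s : State) : Prop where
  r18 : s.reg 18 = G.length + 1
  m17 : s.mem 17 (G.length + 1) = i
  ll : IsLinkedList (s.mem 6) (s.mem 7) (s.reg 4) (rem.map Fin.val)
  sub : ∀ x ∈ rem, (i, x) ∈ H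
  cov : ∀ j : Fin n₂, (i, j) ∈ H → label H M j = level H M i → s.mem 15 j = 0 ∨ j ∈ rem
  lev : level H M i = G.length + 1
  link : ∀ g ∈ G.head?, (i, g.2.1) ∈ M
  off : ∀ P ∈ Ps, ∀ e ∈ P, e.1 ≠ i
  stk : AltStack H M (G.map fun g => (g.1, g.2.1))
  fr : Frames H M Ps s.mem G
  root : (i :: G.map fun g => g.1).getLast? = some r

theorem Frames.pathMem (hM : IsMatching H M) (hPs : ∀ P ∈ Ps, IsAugPath H M P) {m : ℕ → ℕ → ℕ}
    {f : ℕ → ℕ} {G : List (Fin n₁ × Fin n₂ × List (Fin n₂))} (h : Frames H M Ps m G)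
    (hN : IsMatching H (augment M Ps)) (hf : Mates₁ (augment M Ps) f)
    (hs : AltStack H M (G.map fun g => (g.1, g.2.1))) :
    PathMem (m 17) f (G.map fun g => (g.1, g.2.1)) := by
  induction G with
  | nil => trivial
  | cons g G ih =>
    obtain ⟨h1, -, -, -, -, -, h9⟩ := h
    obtain ⟨-, -, -, h3, h4⟩ := hs
    refine ⟨by simpa using h1, ?_, ih h9 h4⟩
    intro e he
    have h5 := h3 e he
    cases G with
    | nil => simp at he
    | cons g' G =>
      simp at he
      subst he
      exact hf.eq_of_mem hN ((mem_augment_of_off_right hM hPs fun P hP e he =>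
        (h9.2.2.2.2.2.1 P hP e he).2).2 h5)

theorem Frames.off {m : ℕ → ℕ → ℕ} {G : List (Fin n₁ × Fin n₂ × List (Fin n₂))}
    (h : Frames H M Ps m G) : ∀ g ∈ G, m 15 g.2.1 = 0 ∧ ∀ P ∈ Ps, ∀ e ∈ P, e.1 ≠ g.1 ∧ e.2 ≠ g.2.1 := by
  induction G with
  | nil => simp
  | cons g G ih =>
    intro g' hg'
    rcases List.mem_cons.1 hg' with rfl | hg'
    · exact ⟨h.2.2.2.2.1, h.2.2.2.2.2.1⟩
    · exact ih h.2.2.2.2.2.2 g' hg'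

/-- Labels are only ever erased, so a node found `Done` stays so, and a node is popped only when it
is `Done`. A matched node is pushed only when the label of its partner is erased, hence at most
once, and its list is paid from `W`. The search ends with a popped, `Done` root or with a free node
of V₂, and then the stack is a shortest augmenting path disjoint from the earlier ones. -/
theorem run_dfsLoop {adj : Fin n₁ → List (Fin n₂)} {act : List (Fin n₁)} (hLs : Lists H adj act)
    (hM : IsMatching H M) {K a : ℕ} (hK : ShortestLabel H M K) {rest : List (Fin n₁)}
    {R : Fin n₁ → Prop} {W₀ : Finset (Fin n₁)} {r : Fin n₁} {s : State}
    (h : DfsInv H adj act M K a rest R Ps (fun _ => False) W₀ s) (ht : Top H M Ps r r (adj r) [] s) :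
    Run dfsLoop s fun s' t => ∃ Ps' W,
      DfsInv H adj act M K a rest (fun i => R i ∨ i = r) Ps' (fun _ => False) W s' ∧
      ∑ i ∈ W, (20 * (adj i).length + 20) + t ≤
        ∑ i ∈ W₀, (20 * (adj i).length + 20) + 20 * (adj r).length + 21 := by
  -- First disjunct: a search in progress. Second: a finished one with empty stack. The budget
  -- covers unvisited nodes, the running search and the suspended frames, at 20 per node and per
  -- remaining list cell.
  refine run_loop (fun s n => ∃ Ps W,
    (∃ i rem G, DfsInv H adj act M K a rest R Ps (fun j => ∃ g ∈ G, g.2.1 = j) W s ∧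
      Top H M Ps r i rem G s ∧ n = ∑ i ∈ W, (20 * (adj i).length + 20) + (20 * rem.length + 20) +
        (G.map fun g => 20 * g.2.2.length + 20).sum) ∨
    (DfsInv H adj act M K a rest (fun i => R i ∨ i = r) Ps (fun _ => False) W s ∧ s.reg 18 = 0 ∧
      n = ∑ i ∈ W, (20 * (adj i).length + 20)))
    (n := ∑ i ∈ W₀, (20 * (adj i).length + 20) + (20 * (adj r).length + 20))
    ⟨Ps, W₀, Or.inl ⟨r, adj r, [], by simpa using h, ht, by simp⟩⟩ ?_ ?_
  · clear h ht
    rintro s n ⟨Ps, W, ⟨i, rem, G, h, ht, rfl⟩ | ⟨h, h18, -⟩⟩ hb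
    swap
    · simp [Test.Holds, h.hk.r2, h18] at hb
    have hPs := fun P hP => (h.pth P hP).1
    have hr2 := h.hk.r2
    have hr18 := ht.r18
    refine run_ite (fun hb' => ?_) fun hb' => ?_
    · simp only [Test.Holds, hr2] at hb'
      have hll := ht.ll
      rw [hb'] at hll
      have := hll.eq_nil
      simp only [List.map_eq_nil_iff] at this
      subst this
      have hdone : Done H M (s.mem 15) i := fun j h1 h2 => by simpa using ht.cov j h1 h2
      have hdfs := h.congr (s' := runList [.dec 18, .load 4 18 18] s) (by simp [Instr.run])
        (by simp [Instr.run])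
      cases G with
      | nil =>
        have hir : i = r := by simpa using ht.root
        subst hir
        refine run_block ⟨_, ⟨Ps, W, Or.inr ⟨⟨hdfs.hk, hdfs.r3, hdfs.pth, hdfs.dis, hdfs.pvis,
          hdfs.lab, ?_, hdfs.wm, hdfs.wr, ?_⟩, ?_, rfl⟩⟩, ?_⟩
        · simpa using hdfs.vis
        · rintro i' (hi' | rfl)
          · exact hdfs.roots i' hi'
          · exact Or.inr (by simpa [Instr.run] using hdone)
        · simp [Instr.run, hr18]
        · simp
      | cons g G =>
        obtain ⟨f1, f2, f3, f4, f5, f6, f7⟩ := ht.fr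
        obtain ⟨k1, k2, k3, k4, k5⟩ := ht.stk
        simp only [List.length_map] at k2 k3
        refine run_block ⟨_, ⟨Ps, W, Or.inl ⟨g.1, g.2.2, G, ⟨hdfs.hk, hdfs.r3, hdfs.pth, hdfs.dis,
          hdfs.pvis, hdfs.lab, ?_, hdfs.wm, hdfs.wr, hdfs.roots⟩, ⟨?_, ?_, ?_, f3, ?_, ?_, ?_, ?_, k5,
          ?_, ?_⟩, rfl⟩⟩, ?_⟩
        · intro j h1 h2 h3
          rcases hdfs.vis j h1 h2 h3 with h4 | h4 | ⟨g', hg', h4⟩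
          · exact Or.inl h4
          · exact Or.inr (Or.inl h4)
          · rcases List.mem_cons.1 hg' with rfl | hg'
            · refine Or.inr (Or.inl ⟨i, ?_, by simpa [Instr.run] using hdone⟩)
              rw [← h4]
              exact ht.link g' (by simp)
            · exact Or.inr (Or.inr ⟨g', hg', h4⟩)
        · simp [Instr.run, hr18]
        · simpa [Instr.run] using f1
        · simpa [Instr.run, hr18] using f2
        · simpa [Instr.run] using f4
        · exact k2
        · intro g' hg'
          exact k4 (g'.1, g'.2.1) (by rw [List.head?_map, Option.mem_def.1 hg']; rfl)
        · exact fun P hP e he => (f6 P hP e he).1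
        · exact f7.congr (by simp [Instr.run]) (by simp [Instr.run]) (by simp [Instr.run])
            (by simp [Instr.run])
        · have := ht.root
          rwa [List.map_cons, List.getLast?_cons_cons] at this
        · simp
          omega
    · simp only [Test.Holds, hr2] at hb'
      obtain ⟨x, rem', rfl, hky, hl'⟩ := ht.ll.exists_cons hb'
      have hx := ht.sub x (by simp)
      have hsub' : ∀ y ∈ rem', (i, y) ∈ H := fun y hy => ht.sub y (List.mem_cons_of_mem _ hy)
      have hlx := label_le_level hM hx (by rw [ht.lev]; omega)
      rw [ht.lev] at hlx
      refine run_block_seq (run_ite (fun hb'' => ?_) fun hb'' => ?_)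
      · simp only [Test.Holds, List.foldl, Instr.run, Function.update_apply] at hb''
        simp [hky, hr18] at hb''
        have hvx : s.mem 15 x ≠ 0 := by omega
        have hlabx : label H M x = G.length + 1 ∧ G.length + 1 ≤ K := by
          rcases h.lab x with h1 | h1 <;> omega
        have hoffx : ∀ P ∈ Ps, ∀ e ∈ P, e.2 ≠ x := fun P hP e he h1 =>
          hvx (by rw [← h1]; exact h.pvis P hP e he)
        have hmono : ∀ j : Fin n₂, s.mem 15 j = 0 → Function.update (s.mem 15) x 0 j = 0 := by
          intro j hj
          rw [Function.update_apply]
          split_ifs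
          · rfl
          · exact hj
        have hmono' : ∀ j : Fin n₂, Function.update (s.mem 15) x 0 j ≠ 0 → s.mem 15 j ≠ 0 ∧ j ≠ x := by
          intro j hj
          refine ⟨fun h1 => hj (hmono j h1), ?_⟩
          rintro rfl
          simp at hj
        have hlab' : ∀ j : Fin n₂, Function.update (s.mem 15) x 0 j = 0 ∨
            (Function.update (s.mem 15) x 0 j = label H M j ∧ label H M j ≤ K) := by
          intro j
          by_cases hj : j = x
          · subst hj; simp
          · have : (j : ℕ) ≠ x := fun h => hj (Fin.ext h)
            rw [Function.update_of_ne this]; exact h.lab j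
        have hvis' : ∀ j : Fin n₂, label H M j ≠ 0 → label H M j ≤ K →
            Function.update (s.mem 15) x 0 j = 0 → (∃ P ∈ Ps, ∃ e ∈ P, e.2 = j) ∨
            (∃ i, (i, j) ∈ M ∧ Done H M (Function.update (s.mem 15) x 0) i) ∨
            (j = x ∨ ∃ g ∈ G, g.2.1 = j) := by
          intro j h1 h2 h3
          by_cases hj : j = x
          · exact Or.inr (Or.inr (Or.inl hj))
          · have : (j : ℕ) ≠ x := fun h => hj (Fin.ext h)
            rw [Function.update_of_ne this] at h3
            rcases h.vis j h1 h2 h3 with h4 | ⟨i', h4, h5⟩ | h4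
            · exact Or.inl h4
            · exact Or.inr (Or.inl ⟨i', h4, fun j' h6 h7 => hmono j' (h5 j' h6 h7)⟩)
            · exact Or.inr (Or.inr (Or.inr h4))
        have hroots' : ∀ i', R i' → (∃ P ∈ Ps, ∃ e ∈ P, e.1 = i') ∨
            Done H M (Function.update (s.mem 15) x 0) i' := fun i' hi' =>
          (h.roots i' hi').imp id fun h5 j' h6 h7 => hmono j' (h5 j' h6 h7)
        have hstk : AltStack H M ((i, x) :: G.map fun g => (g.1, g.2.1)) := by
          refine ⟨hx, by simpa using ht.lev, by simpa using hlabx.1, ?_, ht.stk⟩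
          intro f hf
          rw [List.head?_map] at hf
          simp only [Option.map_eq_some_iff, Option.mem_def] at hf
          obtain ⟨g, hg, rfl⟩ := hf
          exact ht.link g hg
        refine run_block_seq (run_ite (fun hb3 => ?_) fun hb3 => ?_)
        · simp only [Test.Holds, List.foldl, Instr.run, Function.update_apply] at hb3
          simp [hky, hr2, h.hk.m2.eq_zero] at hb3
          have hfx : ∀ i', (i', x) ∉ M := fun i' h1 =>
            hb3 i' ((mem_augment_of_off_right hM hPs hoffx).2 h1)
          -- A free node has label at least `K`, and labels above `K` are not stored.
          have hKx : G.length + 1 = K := by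
            have := hK.2.2 x hfx (by omega)
            omega
          set fs := (i, x) :: G.map fun g => (g.1, g.2.1) with hfs
          have hP : IsAugPath H M fs.reverse := hstk.isAugPath hM hfx
          have hPlen : fs.reverse.length = K := by simp [hfs, hKx]
          have hfsoff : ∀ e ∈ fs, ∀ P ∈ Ps, ∀ f ∈ P, f.1 ≠ e.1 ∧ f.2 ≠ e.2 := by
            intro e he P hP f hf
            rcases List.mem_cons.1 he with rfl | he
            · exact ⟨ht.off P hP f hf, hoffx P hP f hf⟩
            · obtain ⟨g, hg, rfl⟩ := List.mem_map.1 he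
              exact (ht.fr.off g hg).2 P hP f hf
          have hfsvis : ∀ e ∈ fs, Function.update (s.mem 15) x 0 e.2 = 0 := by
            intro e he
            rcases List.mem_cons.1 he with rfl | he
            · simp
            · obtain ⟨g, hg, rfl⟩ := List.mem_map.1 he
              exact hmono _ (ht.fr.off g hg).1
          have hpm : PathMem (s.mem 17) (s.mem 9) fs := by
            refine ⟨by simpa using ht.m17, ?_, ht.fr.pathMem hM hPs h.hk.isM h.hk.m1 ht.stk⟩
            intro f hf
            rw [List.head?_map] at hf
            simp only [Option.map_eq_some_iff, Option.mem_def] at hf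
            obtain ⟨g, hg, rfl⟩ := hf
            have hg' : g ∈ G := List.mem_of_mem_head? hg
            exact h.hk.m1.eq_of_mem h.hk.isM ((mem_augment_of_off_right hM hPs fun P hP e he =>
              ((ht.fr.off g hg').2 P hP e he).2).2 (ht.link g hg))
          refine (run_augLoop (l := fs) (s := runList [.store 15 5 2, .load 6 10 5]
            (runList [.load 5 7 4, .load 4 6 4, .load 6 15 5] s)) ?_ ?_ ?_ ?_ ?_ ?_).mono ?_
          · simp [Instr.run, hr18, hfs]
          · simp [Instr.run, hr2]
          · simp [Instr.run, hfs, hky]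
          · simpa [Instr.run] using hpm
          · have := hP.2.1
            rwa [List.map_reverse, List.nodup_reverse] at this
          · have := hP.2.2.1
            rwa [List.map_reverse, List.nodup_reverse] at this
          rintro s' t ⟨ht', h18', hrf, hmf, hall, h9, h10⟩
          have h15' : s'.mem 15 = Function.update (s.mem 15) x 0 := by
            rw [hmf 15 (by simp)]
            simp [Instr.run, hky, hr2]
          have hm : ∀ a ∈ [4, 6, 7, 14], s'.mem a = s.mem a := by
            intro a ha
            rw [hmf a (by simp at ha ⊢; omega)]
            have : a ≠ 15 := by simp at ha; omega
            simp [Instr.run, this]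
          have hr : ∀ r ∈ [2, 3, 11], s'.reg r = s.reg r := by
            intro a ha
            rw [hrf a (by simp at ha ⊢; omega)]
            simp at ha
            rcases ha with rfl | rfl | rfl <;> simp [Instr.run]
          have hPs' : ∀ Q ∈ insert fs.reverse Ps, IsAugPath H M Q ∧ Q.length = K := by
            intro Q hQ
            rcases Finset.mem_insert.1 hQ with rfl | hQ
            · exact ⟨hP, hPlen⟩
            · exact h.pth Q hQ
          have hdis' : ∀ P ∈ insert fs.reverse Ps, ∀ Q ∈ insert fs.reverse Ps, P ≠ Q →
              NodeDisjoint P Q := by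
            have key : ∀ Q ∈ Ps, NodeDisjoint fs.reverse Q := fun Q hQ e he f hf => by
              have := hfsoff e (List.mem_reverse.1 he) Q hQ f hf
              exact ⟨this.1.symm, this.2.symm⟩
            intro P hP Q hQ hPQ
            rcases Finset.mem_insert.1 hP with rfl | hP <;> rcases Finset.mem_insert.1 hQ with rfl | hQ
            · exact absurd rfl hPQ
            · exact key Q hQ
            · exact (key P hP).symm
            · exact h.dis P hP Q hQ hPQ
          refine ⟨_, ⟨insert fs.reverse Ps, W, Or.inr ⟨⟨⟨?_, ?_, ?_, ?_, ?_, ?_⟩, ?_, hPs', hdis', ?_, ?_,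
            ?_, ?_, h.wr, ?_⟩, h18', rfl⟩⟩, ?_⟩
          · exact hM.augment (fun Q hQ => (hPs' Q hQ).1) hdis'
          · rw [hr 2 (by simp), hr2]
          · rw [hm 4 (by simp), hm 6 (by simp), hm 7 (by simp)]; exact h.hk.ll
          · rw [hm 14 (by simp), hr 11 (by simp)]; exact h.hk.ac
          · refine mates₁_augment_insert hM hPs hP h.hk.m1 (fun e he => (hall e (List.mem_reverse.1 he)).1)
              fun a ha => ?_
            rw [h9 a fun e he => ha e (List.mem_reverse.2 he)]
            simp [Instr.run]
          · refine mates₂_augment_insert hM hPs hP h.hk.m2 (fun e he => (hall e (List.mem_reverse.1 he)).2)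
              fun a ha => ?_
            rw [h10 a fun e he => ha e (List.mem_reverse.2 he)]
            simp [Instr.run]
          · rw [hr 3 (by simp), h.r3]
          · intro P hP e he
            rw [h15']
            rcases Finset.mem_insert.1 hP with rfl | hP
            · exact hfsvis e (List.mem_reverse.1 he)
            · exact hmono _ (h.pvis P hP e he)
          · rw [h15']; exact hlab'
          · rw [h15']
            intro j h1 h2 h3
            rcases hvis' j h1 h2 h3 with ⟨P, hP, h4⟩ | h4 | rfl | ⟨g, hg, h4⟩
            · exact Or.inl ⟨P, Finset.mem_insert_of_mem hP, h4⟩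
            · exact Or.inr (Or.inl h4)
            · exact Or.inl ⟨_, Finset.mem_insert_self _ _, (i, j), by simp [hfs], rfl⟩
            · exact Or.inl ⟨_, Finset.mem_insert_self _ _, (g.1, g.2.1),
                List.mem_reverse.2 (List.mem_cons_of_mem _ (List.mem_map.2 ⟨g, hg, rfl⟩)), h4⟩
          · rw [h15']
            exact fun i' j' h1 h2 => h.wm i' j' h1 (hmono' j' h2).1
          · rw [h15']
            rintro i' (hi' | rfl)
            · exact (hroots' i' hi').imp (fun ⟨P, hP, h4⟩ => ⟨P, Finset.mem_insert_of_mem hP, h4⟩) id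
            · refine Or.inl ⟨_, Finset.mem_insert_self _ _, ?_⟩
              have h5 : i' ∈ fs.map Prod.fst := by
                have := List.mem_of_getLast? ht.root
                simpa [hfs, List.map_map, Function.comp_def] using this
              obtain ⟨e, he, h6⟩ := List.mem_map.1 h5
              exact ⟨e, List.mem_reverse.2 he, h6⟩
          -- Exchanging the edges costs 12 steps per node on the stack, less than the 20 reserved
          -- for each frame.
          · have hsum : 20 * G.length ≤ (G.map fun g => 20 * g.2.2.length + 20).sum := by
              simp [mul_comm]
            have : fs.length = G.length + 1 := by simp [hfs]
            rw [this] at ht'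
            simp only [List.length_cons, List.length_nil]
            omega
        · simp only [Test.Holds, List.foldl, Instr.run, Function.update_apply] at hb3
          simp only [hky, hr2] at hb3
          obtain ⟨m, hmx', hm⟩ := h.hk.m2.exists_of_ne (j := x) (by simpa using hb3)
          have hmx := (mem_augment_of_off_right hM hPs hoffx).1 hmx'
          -- The label of `x` was still present, so its partner `m` has never been on the stack.
          have hmW : m ∈ W := h.wm m x hmx hvx
          have hmoff : ∀ P ∈ Ps, ∀ e ∈ P, e.1 ≠ m := fun P hP e he h1 => by
            obtain ⟨f, hf, h2⟩ := ((hPs P hP).on_left_iff hM hmx).1 ⟨e, he, h1⟩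
            exact hoffx P hP f hf h2
          have hml := level_of_mem hM hmx
          rw [if_neg hlx.1] at hml
          refine run_block ⟨_, ⟨Ps, W.erase m, Or.inl ⟨m, adj m, (i, x, rem') :: G, ⟨?_, ?_, h.pth, h.dis,
            ?_, ?_, ?_, ?_, ?_, ?_⟩, ⟨?_, ?_, ?_, fun y hy => ((hLs.adj m).2 y).1 hy, ?_, ?_, ?_, hmoff,
            hstk, ⟨?_, ?_, hsub', ?_, ?_, ?_, ?_⟩, ?_⟩, rfl⟩⟩, ?_⟩
          · exact h.hk.congr (by simp [Instr.run]) (by simp [Instr.run]) (by simp [Instr.run])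
          · simp [Instr.run, h.r3]
          · intro P hP e he
            have := hmono e.2 (h.pvis P hP e he)
            simpa [Instr.run, hky, hr2] using this
          · simpa [Instr.run, hky, hr2] using hlab'
          · simpa [Instr.run, hky, hr2, eq_comm] using hvis'
          · intro i' j' h1 h2
            have h3 := hmono' j' (by simpa [Instr.run, hky, hr2] using h2)
            refine Finset.mem_erase.2 ⟨?_, h.wm i' j' h1 h3.1⟩
            rintro rfl
            exact h3.2 (hM.right_unique h1 hmx)
          · intro i' h1 h2
            refine Finset.mem_erase.2 ⟨?_, h.wr i' h1 h2⟩
            rintro rfl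
            exact h2 x hmx
          · simpa [Instr.run, hky, hr2] using hroots'
          · simp [Instr.run, hr18]
          · simp [Instr.run, hr18, hky, hm]
          · simpa [Instr.run, hky, hm] using h.hk.ll m
          · exact fun j h1 h2 => Or.inr (((hLs.adj m).2 j).2 h1)
          · simp [hml, hlabx.1]
          · simpa using hmx
          · have := ht.m17
            simpa [Instr.run, hr18, hky, hm] using this
          · simpa [Instr.run, hr18] using hl'
          · intro j h1 h2
            by_cases hj : j = x
            · subst hj
              simp [Instr.run, hky, hr2]
            · have hj' : (j : ℕ) ≠ x := fun h => hj (Fin.ext h)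
              simpa [Instr.run, hky, hr2, hj, hj'] using ht.cov j h1 h2
          · simp [Instr.run, hky, hr2]
          · exact fun P hP e he => ⟨ht.off P hP e he, hoffx P hP e he⟩
          · refine ht.fr.congr (by simp [Instr.run]) (by simp [Instr.run]) (fun k hk => ?_) ?_
            · have h1 : k ≠ G.length + 1 := by omega
              have h2 : k ≠ G.length + 2 := by omega
              simp [Instr.run, hr18, h1, h2]
            · simpa [Instr.run, hky, hr2] using hmono
          · have := ht.root
            rwa [List.map_cons, List.getLast?_cons_cons]
          · have := Finset.sum_erase_add W (fun i => 20 * (adj i).length + 20) hmW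
            simp only [List.length_cons, List.length_nil, List.map_cons, List.sum_cons]
            omega
      · simp only [Test.Holds, List.foldl, Instr.run, Function.update_apply] at hb''
        simp [hky, hr18] at hb''
        refine run_block ⟨_, ⟨Ps, W, Or.inl ⟨i, rem', G, ?_, ⟨?_, ?_, ?_, hsub', ?_, ht.lev, ht.link, ht.off,
          ht.stk, ?_, ht.root⟩, rfl⟩⟩, ?_⟩
        · exact h.congr (by simp [Instr.run]) (by simp [Instr.run])
        · simp [Instr.run, hr18]
        · simpa [Instr.run] using ht.m17
        · simpa [Instr.run] using hl'
        · intro j h1 h2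
          rcases ht.cov j h1 h2 with h3 | h3
          · exact Or.inl h3
          · rcases List.mem_cons.1 h3 with rfl | h3
            · left
              rcases h.lab j with h4 | h4
              · exact h4
              · exact absurd (by rw [h4.1, h2, ht.lev]) hb''
            · exact Or.inr h3
        · exact ht.fr.congr (by simp [Instr.run]) (by simp [Instr.run]) (by simp [Instr.run])
            (by simp [Instr.run])
        · simp only [List.length_cons, List.length_nil]
          omega
  · rintro s' n' t ⟨Ps, W, ⟨i, rem, G, h, ht, rfl⟩ | ⟨h, h18, rfl⟩⟩ hb hn
    · simp [Test.Holds, h.hk.r2, ht.r18] at hb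
    · exact ⟨Ps, W, h, by omega⟩

end Phase


/-! ### Phases, their number and the start of the algorithm -/

section HopcroftKarp

variable {n₁ n₂ : ℕ} {H M : Finset (Fin n₁ × Fin n₂)}

theorem Seg.drop {n : ℕ} {m : ℕ → ℕ} {a b : ℕ} {l : List (Fin n)} (h : Seg m a b l) {k : ℕ}
    (hk : k ≤ l.length) : Seg m (a + k) b (l.drop k) := by
  induction l generalizing a k with
  | nil =>
    simp at hk
    subst hk
    exact h
  | cons x l ih =>
    cases k with
    | zero => exact h
    | succ k =>
      have := ih h.2 (k := k) (by simpa using hk)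
      rwa [show a + 1 + k = a + (k + 1) by omega] at this

theorem DfsInv.advance {adj : Fin n₁ → List (Fin n₂)} {act : List (Fin n₁)} {K a a' : ℕ}
    {rest rest' : List (Fin n₁)} {R R' : Fin n₁ → Prop} {Ps : Finset (List (Fin n₁ × Fin n₂))}
    {S : Fin n₂ → Prop} {W : Finset (Fin n₁)} {s s' : State}
    (h : DfsInv H adj act M K a rest R Ps S W s) (h2 : s'.reg 2 = s.reg 2)
    (h11 : s'.reg 11 = s.reg 11) (h3 : s'.reg 3 = a')
    (hm : ∀ a ∈ [4, 6, 7, 9, 10, 14, 15], s'.mem a = s.mem a)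
    (hrest : ∀ i ∈ rest', i ∈ rest)
    (hR : ∀ i, R' i → (∃ P ∈ Ps, ∃ e ∈ P, e.1 = i) ∨ Done H M (s.mem 15) i) :
    DfsInv H adj act M K a' rest' R' Ps S W s' := by
  have h15 := hm 15 (by simp)
  refine ⟨h.hk.congr h2 h11 fun a ha => hm a (by simp at ha ⊢; omega),
    h3, h.pth, h.dis, ?_, ?_, ?_, ?_, fun i hi => h.wr i (hrest i hi), ?_⟩
  · rw [h15]; exact h.pvis
  · rw [h15]; exact h.lab
  · rw [h15]; exact h.vis
  · rw [h15]; exact h.wm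
  · rw [h15]; exact hR

/-- Suppose a shortest path Q avoids all paths found. Its head is a `Done` root. From a `Done` node
the tight edge of Q leads to a visited node of V₂ off the found paths, whose partner is then `Done`
too. Following Q, its free end would get a partner. -/
theorem DfsInv.hkPhase {adj : Fin n₁ → List (Fin n₂)} {act : List (Fin n₁)} (hLs : Lists H adj act)
    (hM : IsMatching H M) {K a : ℕ} (hK : ShortestLabel H M K) {rest : List (Fin n₁)}
    {Ps : Finset (List (Fin n₁ × Fin n₂))} {W : Finset (Fin n₁)} {s : State}
    (h : DfsInv H adj act M K a rest (fun i => i ∈ act ∧ ∀ j, (i, j) ∉ M) Ps (fun _ => False) W s) :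
    HKPhase H M (augment M Ps) := by
  have hmax : ∀ Q, IsShortestAugPath H M Q → ∃ P ∈ Ps, ¬ NodeDisjoint P Q := by
    intro Q hQ
    by_contra hcon
    push Not at hcon
    obtain ⟨hQ, hlen⟩ := (hK.isShortest_iff hM).1 hQ
    have hoff : ∀ P ∈ Ps, ∀ e ∈ P, ∀ k (hk : k < Q.length), e.1 ≠ Q[k].1 ∧ e.2 ≠ Q[k].2 :=
      fun P hP e he k hk => hcon P hP e he _ (List.getElem_mem hk)
    have hvis : ∀ k (hk : k < Q.length), Done H M (s.mem 15) Q[k].1 →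
        ∃ i, (i, Q[k].2) ∈ M ∧ Done H M (s.mem 15) i := by
      intro k hk hd
      have hl := hK.levels hM hQ hlen k hk
      rcases h.vis Q[k].2 (by omega) (by omega)
        (hd _ (hQ.edge (List.getElem_mem hk)).1 (by omega)) with ⟨P, hP, e, he, h1⟩ | h1 | h1
      · exact absurd h1 (hoff P hP e he k hk).2
      · exact h1
      · exact h1.elim
    have hdone : ∀ k (hk : k < Q.length), Done H M (s.mem 15) Q[k].1 := by
      intro k
      induction k with
      | zero =>
        intro hk
        rcases h.roots Q[0].1 ⟨(hLs.mem _).2 ⟨_, (hQ.edge (List.getElem_mem hk)).1⟩, hQ.head_free⟩ with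
          ⟨P, hP, e, he, h1⟩ | h1
        · exact absurd h1 (hoff P hP e he 0 hk).1
        · exact h1
      | succ k ih =>
        intro hk
        obtain ⟨i, hi, hd⟩ := hvis k (by omega) (ih (by omega))
        rwa [← hM.left_unique hi (hQ.chain_get hk)]
    obtain ⟨i, hi, -⟩ := hvis (Q.length - 1) (Nat.sub_lt hQ.length_pos one_pos) (hdone _ _)
    exact hQ.last_free i hi
  refine ⟨Ps, ?_, fun P hP => (hK.isShortest_iff hM).2 (h.pth P hP), h.dis, hmax, rfl⟩
  obtain ⟨Q, hQ⟩ := hK.exists_path hM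
  obtain ⟨P, hP, -⟩ := hmax Q ((hK.isShortest_iff hM).2 hQ)
  exact ⟨P, hP⟩

theorem run_rootLoop {adj : Fin n₁ → List (Fin n₂)} {act : List (Fin n₁)} (hLs : Lists H adj act)
    (hM : IsMatching H M) {K : ℕ} (hK : ShortestLabel H M K) {s : State} (h : HKInv H adj act M s)
    (hlab : ∀ j : Fin n₂, s.mem 15 j = if label H M j ≤ K then label H M j else 0)
    (h3 : s.reg 3 = 0) :
    Run rootLoop s fun s' t => t ≤ 1 + 55 * H.card ∧ ∃ M', HKPhase H M M' ∧ HKInv H adj act M' s' ∧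
      ∀ j : Fin n₂, s'.mem 15 j ≠ 0 → ∃ i, (i, j) ∈ H := by
  refine run_loop (fun s n => ∃ a Ps W, a ≤ act.length ∧
    DfsInv H adj act M K a (act.drop a) (fun i => i ∈ act.take a ∧ ∀ j, (i, j) ∉ M) Ps
      (fun _ => False) W s ∧
    n = ∑ i ∈ W, (20 * (adj i).length + 20) + 15 * (act.drop a).length)
    (n := ∑ i ∈ act.toFinset, (20 * (adj i).length + 20) + 15 * (act.drop 0).length)
    ⟨0, ∅, act.toFinset, by omega, ⟨?_, h3, by simp, by simp, by simp, ?_, ?_, ?_, ?_, by simp⟩, rfl⟩ ?_ ?_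
  · rwa [show augment M ∅ = M by ext e; simp [augment, Finset.mem_symmDiff]]
  · intro j
    rw [hlab]
    split_ifs with h1
    · exact Or.inr ⟨rfl, h1⟩
    · exact Or.inl rfl
  · intro j h1 h2 h3
    rw [hlab, if_pos h2] at h3
    exact absurd h3 h1
  · exact fun i j hij _ => List.mem_toFinset.2 ((hLs.mem i).2 ⟨j, hM.1 hij⟩)
  · exact fun i hi _ => List.mem_toFinset.2 (by simpa using hi)
  · clear h hlab h3
    rintro s n ⟨a, Ps, W, ha, h, rfl⟩ hb
    have hPs := fun P hP => (h.pth P hP).1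
    have hlen := h.hk.ac.length
    simp only [Test.Holds, h.r3] at hb
    have halt : a < act.length := by omega
    have hdrop := List.drop_eq_getElem_cons halt
    set r := act[a] with hr
    have hseg := h.hk.ac.drop ha
    rw [hdrop, zero_add] at hseg
    have har : s.mem 14 a = r := hseg.1
    have hnd : (act.drop a).Nodup := hLs.nd.sublist (List.drop_sublist a act)
    rw [hdrop] at hnd
    have hnd := List.nodup_cons.1 hnd
    have hrest : ∀ i ∈ act.drop (a + 1), i ∈ act.drop a := fun i hi => by
      rw [hdrop]; exact List.mem_cons_of_mem _ hi
    have htake : ∀ i, i ∈ act.take (a + 1) → i ∈ act.take a ∨ i = r := by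
      intro i hi
      rw [List.take_add_one, List.getElem?_eq_getElem halt] at hi
      simpa only [Option.toList_some, List.mem_append, List.mem_singleton] using hi
    have hlen' : (act.drop a).length = (act.drop (a + 1)).length + 1 := by rw [hdrop]; rfl
    refine run_block_seq (run_seq (run_ite (fun hb' => ?_) fun hb' => ?_))
    · simp only [Test.Holds, List.foldl, Instr.run, Function.update_apply] at hb'
      simp [h.r3, har, h.hk.r2, h.hk.m1.eq_zero] at hb'
      -- `r` is free in the current matching, while every V₁-node of a found path is matched along
      -- it.
      have hoff : ∀ P ∈ Ps, ∀ e ∈ P, e.1 ≠ r := fun P hP e he h1 =>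
        hb' e.2 ((mem_augment hM hPs).2 (Or.inl ⟨P, hP, by rw [← h1]; exact he⟩))
      have hfree : ∀ j, (r, j) ∉ M := by
        intro j hj
        refine hb' j ((mem_augment hM hPs).2 (Or.inr ⟨hj, fun P hP f hf => ⟨(hoff P hP f hf).symm, ?_⟩⟩))
        intro h1
        obtain ⟨e, he, h2⟩ := ((hPs P hP).on_left_iff hM hj).2 ⟨f, hf, h1.symm⟩
        exact hoff P hP e he h2
      have hrW : r ∈ W := h.wr r (by rw [hdrop]; simp) hfree
      have h1 : DfsInv H adj act M K a (act.drop (a + 1))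
          (fun i => i ∈ act.take a ∧ ∀ j, (i, j) ∉ M) Ps (fun _ => False) (W.erase r) s := by
        refine ⟨h.hk, h.r3, h.pth, h.dis, h.pvis, h.lab, h.vis, ?_, ?_, h.roots⟩
        · intro i j hij h0
          refine Finset.mem_erase.2 ⟨?_, h.wm i j hij h0⟩
          rintro rfl
          exact hfree j hij
        · intro i hi hfi
          refine Finset.mem_erase.2 ⟨?_, h.wr i (hrest i hi) hfi⟩
          rintro rfl
          exact hnd.1 hi
      refine run_block_seq ((run_dfsLoop hLs hM hK (r := r) (Ps := Ps) (W₀ := W.erase r)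
        (h1.congr ?_ ?_) ⟨?_, ?_, ?_, fun x hx => ((hLs.adj r).2 x).1 hx,
          fun j hj _ => Or.inr (((hLs.adj r).2 j).2 hj), by simpa using level_of_free hfree, by simp,
          hoff, trivial, trivial, rfl⟩).mono ?_)
      · simp [Instr.run]
      · simp [Instr.run]
      · simp [Instr.run]
      · simp [Instr.run, h.r3, har]
      · simpa [Instr.run, h.r3, har] using h.hk.ll r
      rintro s' t ⟨Ps', W', h', ht⟩
      refine run_block ⟨_, ⟨a + 1, Ps', W', halt, h'.advance ?_ ?_ ?_ ?_ (fun i hi => hi) ?_, rfl⟩, ?_⟩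
      · simp [Instr.run]
      · simp [Instr.run]
      · simp [Instr.run, h'.r3]
      · simp [Instr.run]
      · rintro i ⟨hi, hfi⟩
        rcases htake i hi with hi | rfl
        · exact h'.roots i (Or.inl ⟨hi, hfi⟩)
        · exact h'.roots r (Or.inr rfl)
      · have := Finset.sum_erase_add W (fun i => 20 * (adj i).length + 20) hrW
        simp only [List.length_cons, List.length_nil]
        omega
    · simp only [Test.Holds, List.foldl, Instr.run, Function.update_apply] at hb'
      simp [h.r3, har, h.hk.r2, h.hk.m1.eq_zero] at hb'
      obtain ⟨j, hj⟩ := hb'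
      refine run_block (run_block ⟨_, ⟨a + 1, Ps, W, halt, h.advance ?_ ?_ ?_ ?_ hrest ?_, rfl⟩, ?_⟩)
      · simp [Instr.run]
      · simp [Instr.run]
      · simp [Instr.run, h.r3]
      · simp [Instr.run]
      · rintro i ⟨hi, hfi⟩
        rcases htake i hi with hi | rfl
        · exact h.roots i ⟨hi, hfi⟩
        · rcases (mem_augment hM hPs).1 hj with ⟨P, hP, h1⟩ | h1
          · exact Or.inl ⟨P, hP, _, h1, rfl⟩
          · exact absurd h1.1 (hfi j)
      · simp only [List.length_cons, List.length_nil]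
        omega
  · rintro s' n' t ⟨a, Ps, W, ha, h, rfl⟩ hb ht
    have hlen := h.hk.ac.length
    simp only [Test.Holds, h.r3] at hb
    have haa : a = act.length := by omega
    have hsum := hLs.sum_le 20 35
    have hsum' : ∑ i ∈ act.toFinset, (20 * (adj i).length + 35) =
        ∑ i ∈ act.toFinset, (20 * (adj i).length + 20) + 15 * act.length := by
      rw [← List.toFinset_card_of_nodup hLs.nd, mul_comm 15, ← smul_eq_mul, ← Finset.sum_const,
        ← Finset.sum_add_distrib]
    rw [List.drop_zero] at ht
    refine ⟨by omega, augment M Ps, ?_, h.hk, fun j hj => ?_⟩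
    · subst haa
      rw [List.take_length] at h
      exact h.hkPhase hLs hM hK
    · have h1 := (h.lab j).resolve_left hj
      obtain ⟨i, hi, -⟩ := exists_of_label hM (j := j) (by rw [← h1.1]; exact hj)
      exact ⟨i, hi⟩

theorem run_phaseProg {adj : Fin n₁ → List (Fin n₂)} {act : List (Fin n₁)} (hLs : Lists H adj act)
    {s : State} (h : HKInv H adj act M s) (hK : ShortestLabel H M (s.reg 12))
    (hlab : ∀ j : Fin n₂, s.mem 15 j = if label H M j ≤ s.reg 12 then label H M j else 0) :
    Run phaseProg s fun s' t => t ≤ 15 + 115 * H.card ∧ ∃ M', HKPhase H M M' ∧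
      HKInv H adj act M' s' ∧ Layered H M' s' := by
  refine run_block_seq (run_seq ((run_rootLoop hLs h.isM hK (h.congr ?_ ?_ ?_) ?_ ?_).mono ?_))
  · simp [Instr.run]
  · simp [Instr.run]
  · simp [Instr.run]
  · simpa [Instr.run] using hlab
  · simp [Instr.run]
  rintro s' t ⟨ht, M', hph, h', hz⟩
  refine (run_bfsProg hLs h' hz).mono ?_
  rintro s'' t' ⟨ht', h'', hl, -⟩
  refine ⟨?_, M', hph, h'', hl⟩
  simp only [List.length_cons, List.length_nil]
  omega

/-- A reason why at most `N` more phases follow: a maximum matching has at most `N` edges more, or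
the paths are still shorter than `q`. -/
def PhaseBound (H M : Finset (Fin n₁ × Fin n₂)) (q K N : ℕ) : Prop :=
  (∀ M', IsMatching H M' → M'.card ≤ M.card + N) ∨ (K ≤ q ∧ 2 * q + 1 ≤ K + N)

/-- Once K > q, the deficit d satisfies q d ≤ (K - 1) d ≤ |M| ≤ q², hence d ≤ q. -/
theorem phaseBound_of_le (hM : IsMatching H M) {q K N : ℕ} (hq : q ≠ 0) (hK : ShortestLabel H M K)
    (hc : ∀ M', IsMatching H M' → M'.card ≤ q * q) (hN : q ≤ N) (hKN : 2 * q + 1 ≤ K + N) :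
    PhaseBound H M q K N := by
  by_cases hKq : K ≤ q
  · exact Or.inr ⟨hKq, hKN⟩
  · refine Or.inl fun M' hM' => ?_
    have h1 := hK.mul_deficit_le hM hM'
    have h2 : q * (M'.card - M.card) ≤ q * q :=
      (Nat.mul_le_mul_right _ (by omega)).trans (h1.trans (hc M hM))
    have := Nat.le_of_mul_le_mul_left h2 (Nat.pos_of_ne_zero hq)
    omega

/-- A phase lowers `N` by one and keeps a reason for the bound: either the matching has grown, or K
has; when K passes `q`, at least `q` phases are still allowed and the deficit takes over. -/
theorem exec_hkLoop {adj : Fin n₁ → List (Fin n₂)} {act : List (Fin n₁)} (hLs : Lists H adj act)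
    {q : ℕ} (hq : q ≠ 0) (hc : ∀ M', IsMatching H M' → M'.card ≤ q * q) (N : ℕ)
    (M : Finset (Fin n₁ × Fin n₂)) (s : State) (h : HKInv H adj act M s) (hl : Layered H M s)
    (hN : s.reg 12 ≠ 0 → PhaseBound H M q (s.reg 12) N) :
    ∃ s' M' t, Exec (.loop (.lt 2 12) phaseProg) s t s' ∧ HKTrace H 9 (.lt 2 12) phaseProg s M s' M' ∧
      IsMatching H M' ∧ (∀ P, ¬ IsAugPath H M' P) ∧ HoldsMatching 9 M' s' ∧
      t ≤ 1 + N * (16 + 115 * H.card) := by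
  induction N generalizing M s with
  | zero =>
    rcases hl with ⟨h12, hno⟩ | ⟨hK, hlab⟩
    · have hb : ¬ (Test.lt 2 12).Holds s := by simp [Test.Holds, h12]
      have hno := no_augPath_of_label h.isM hno
      exact ⟨s, M, 1, .loopDone hb, .done h.m1 hb hno, h.isM, hno, h.m1, by omega⟩
    · exfalso
      -- With `N = 0` the matching is already maximum, against the existence of an augmenting path,
      -- or K ≤ q and 2q + 1 ≤ K, which is absurd.
      rcases hN hK.1 with h1 | h1
      · obtain ⟨Q, hQ, hlen⟩ := hK.exists_path h.isM
        have hQs : ∀ P ∈ ({Q} : Finset (List (Fin n₁ × Fin n₂))), IsAugPath H M P := by simpa using hQ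
        have hm := h.isM.augment hQs (by simp +contextual)
        have hcard := h1 _ hm
        have := h.isM.card_lt_augment hQs (by simp +contextual) ⟨Q, by simp⟩
        omega
      · omega
  | succ N ih =>
    rcases hl with ⟨h12, hno⟩ | ⟨hK, hlab⟩
    · have hb : ¬ (Test.lt 2 12).Holds s := by simp [Test.Holds, h12]
      have hno := no_augPath_of_label h.isM hno
      exact ⟨s, M, 1, .loopDone hb, .done h.m1 hb hno, h.isM, hno, h.m1, by omega⟩
    · have hb : (Test.lt 2 12).Holds s := by
        simp only [Test.Holds, h.r2]
        exact Nat.pos_of_ne_zero hK.1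
      obtain ⟨t, s₁, he, ht, M₁, hph, h₁, hl₁⟩ := run_phaseProg hLs h hK hlab
      have hcard := hph.card_lt h.isM
      obtain ⟨s', M', t', he', htr, hm, hno, hho, ht'⟩ := ih M₁ s₁ h₁ hl₁ (fun h0 => by
        have hK₁ : ShortestLabel H M₁ (s₁.reg 12) :=
          (hl₁.resolve_left fun h => h0 h.1).1
        have hlt := hph.shortestLabel_lt h.isM hK hK₁
        rcases hN hK.1 with h1 | h1
        · refine Or.inl fun M' hM' => ?_
          have := h1 M' hM'
          omega
        · exact phaseBound_of_le h₁.isM hq hK₁ hc (by omega) (by omega))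
      refine ⟨s', M', _, .loopStep hb he he', .phase h.m1 hb he hph htr, hm, hno, hho, ?_⟩
      have : (N + 1) * (16 + 115 * H.card) = N * (16 + 115 * H.card) + (16 + 115 * H.card) := by ring
      omega

/-- List the active nodes of `V₁` and compute the layers for the first phase. -/
def startProg : Prog :=
  .seq (block [.const 3 0, .const 11 0]) (.seq
    (.loop (.lt 3 0) (.seq (block [.load 4 4 3]) (.seq
      (.ite (.eq 4 2) (block []) (block [.store 14 11 3, .inc 11])) (block [.inc 3])))) bfsProg)

theorem run_startProg {s : State} {adj : Fin n₁ → List (Fin n₂)} (hadj : AdjLists₁ H adj)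
    (hll : ∀ i : Fin n₁, IsLinkedList (s.mem 6) (s.mem 7) (s.mem 4 i) ((adj i).map Fin.val))
    (h0 : s.reg 0 = n₁) (h2 : s.reg 2 = 0) (hz : ∀ a ∈ [9, 10, 15], ∀ i, s.mem a i = 0) :
    Run startProg s fun s' t => t ≤ 14 + 9 * n₁ + 60 * H.card ∧ ∃ act, Lists H adj act ∧
      HKInv H adj act ∅ s' ∧ Layered H ∅ s' := by
  refine run_block_seq (run_seq (run_for (N := n₁) (fun a s' => s'.reg 3 = a ∧
    RegFrame [3, 4, 11] s s' ∧ MemFrame [14] s s' ∧ ∃ act : List (Fin n₁),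
      Seg (s'.mem 14) 0 (s'.reg 11) act ∧ act.Nodup ∧ ∀ i, i ∈ act ↔ i < a ∧ ∃ j, (i, j) ∈ H)
    (fun _ => 8) ?_ ?_ ?_ ?_))
  · refine ⟨by simp [Instr.run], ?_, ?_, [], ?_, by simp, by simp⟩
    · intro r hr
      simp at hr
      simp [Instr.run, hr]
    · intro a ha
      simp [Instr.run]
    · simp [Instr.run, Seg]
  · rintro a s' ha ⟨h3, hrf, -⟩
    simp only [Test.Holds, h3, hrf 0 (by simp), h0]
  · rintro i s' ⟨h3, hrf, hmf, act, hseg, hnd, hact⟩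
    have hm4 : s'.mem 4 = s.mem 4 := hmf 4 (by simp)
    have hr2 : s'.reg 2 = 0 := by rw [hrf 2 (by simp), h2]
    have hi : i ∉ act := fun hi => lt_irrefl _ ((hact i).1 hi).1
    have hlt : ∀ a : Fin n₁, (a : ℕ) < i + 1 ↔ (a : ℕ) < i ∨ a = i := fun a => by
      rw [Fin.ext_iff]; omega
    refine run_block_seq (run_seq (run_ite (fun hb => ?_) fun hb => ?_))
    · simp only [Test.Holds, List.foldl, Instr.run, Function.update_apply] at hb
      simp [h3, hm4, hr2] at hb
      refine run_block (run_block ⟨⟨?_, ?_, ?_, act, ?_, hnd, ?_⟩, ?_⟩)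
      · simp [Instr.run, h3]
      · intro r hr
        rw [← hrf r hr]
        simp at hr
        simp [Instr.run, hr]
      · intro r hr
        rw [← hmf r hr]
        simp [Instr.run]
      · simpa [Instr.run] using hseg
      · intro a
        rw [hact, hlt]
        constructor
        · exact fun h => ⟨Or.inl h.1, h.2⟩
        · rintro ⟨h1 | rfl, j, hj⟩
          · exact ⟨h1, j, hj⟩
          · have hl := hll a
            rw [hb] at hl
            have := hl.eq_nil
            simp only [List.map_eq_nil_iff] at this
            have hj' := ((hadj a).2 j).2 hj
            rw [this] at hj'
            simp at hj'
      · simp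
    · simp only [Test.Holds, List.foldl, Instr.run, Function.update_apply] at hb
      simp [h3, hm4, hr2] at hb
      obtain ⟨x, l, hx, -⟩ := (hll i).exists_cons hb
      refine run_block (run_block ⟨⟨?_, ?_, ?_, act ++ [i], ?_, ?_, ?_⟩, ?_⟩)
      · simp [Instr.run, h3]
      · intro r hr
        rw [← hrf r hr]
        simp at hr
        simp [Instr.run, hr]
      · intro r hr
        rw [← hmf r hr]
        simp at hr
        simp [Instr.run, hr]
      · simpa [Instr.run, h3] using hseg.push i
      · rw [List.nodup_append]
        refine ⟨hnd, by simp, ?_⟩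
        rintro a ha b hb rfl
        rw [List.mem_singleton.1 hb] at ha
        exact hi ha
      · intro a
        rw [List.mem_append, List.mem_singleton, hact, hlt]
        constructor
        · rintro (h1 | rfl)
          · exact ⟨Or.inl h1.1, h1.2⟩
          · exact ⟨Or.inr rfl, x, ((hadj a).2 x).1 (by rw [hx]; simp)⟩
        · rintro ⟨h1 | h1, h2⟩
          · exact Or.inl ⟨h1, h2⟩
          · exact Or.inr h1
      · simp
  · rintro s' t ⟨h3, hrf, hmf, act, hseg, hnd, hact⟩ ht
    have hLs : Lists H adj act := ⟨hadj, hnd, fun i => by rw [hact]; simp⟩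
    have h' : HKInv H adj act ∅ s' := by
      refine ⟨IsMatching.empty, by rw [hrf 2 (by simp), h2], ?_, hseg, ?_, ?_⟩
      · rw [hmf 4 (by simp), hmf 6 (by simp), hmf 7 (by simp)]; exact hll
      · exact fun i => Or.inl ⟨by rw [hmf 9 (by simp), hz 9 (by simp)], by simp⟩
      · exact fun i => Or.inl ⟨by rw [hmf 10 (by simp), hz 10 (by simp)], by simp⟩
    refine (run_bfsProg hLs h' fun j hj => ?_).mono ?_
    · rw [hmf 15 (by simp), hz 15 (by simp)] at hj
      exact absurd rfl hj
    · rintro s'' t' ⟨ht', h'', hl, -⟩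
      refine ⟨?_, act, hLs, h'', hl⟩
      simp only [Finset.sum_const, Finset.card_univ, Fintype.card_fin, smul_eq_mul] at ht
      simp only [List.length_cons, List.length_nil]
      omega

end HopcroftKarp


/-! ### Bounds for the sums of the scan lengths and for the size of G* -/

section Cost

variable {n₁ n₂ : ℕ} {E Mg Es : Finset (Fin n₁ × Fin n₂)}

theorem matchingNumber_pos {e : Fin n₁ × Fin n₂} (he : e ∈ E) : 0 < matchingNumber E := by
  have : IsMatching E {e} := ⟨by simpa using he, by simp⟩
  have h := this.card_le_matchingNumber
  rwa [Finset.card_singleton] at h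

theorem degree_inr_le (j : Fin n₂) : (edgesAt E (Sum.inr j)).card ≤ n₁ := by
  have := Finset.card_le_card_of_injOn (s := edgesAt E (Sum.inr j)) (t := Finset.univ) Prod.fst
    (fun _ _ => Finset.mem_coe.2 (Finset.mem_univ _)) fun e he f hf h =>
      Prod.ext h ((mem_edgesAt_inr.1 he).2.trans (mem_edgesAt_inr.1 hf).2.symm)
  simpa using this

/-- Isolated nodes contribute 0; if a node has an edge, then κ ≥ 1 and cκ + 1 ≤ (c + 1)κ. -/
theorem sum_min_card_edgesAt_le (c : ℕ) :
    ∑ i, min (edgesAt E (Sum.inl i)).card (c * matchingNumber E + 1) ≤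
      (c + 1) * min E.card (n₁ * matchingNumber E) := by
  have hi : ∀ i : Fin n₁, min (edgesAt E (Sum.inl i)).card (c * matchingNumber E + 1) ≤
      (c + 1) * matchingNumber E := by
    intro i
    rcases (edgesAt E (Sum.inl i)).eq_empty_or_nonempty with h | ⟨e, he⟩
    · simp [h]
    · have := matchingNumber_pos (mem_edgesAt.1 he).1
      rw [add_mul]
      omega
  have h1 : ∑ i, min (edgesAt E (Sum.inl i)).card (c * matchingNumber E + 1) ≤ E.card :=
    (Finset.sum_le_sum fun i _ => min_le_left _ _).trans (sum_card_edgesAt_inl _)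
  have h2 := Finset.sum_le_card_nsmul Finset.univ _ _ fun i _ => hi i
  rw [Finset.card_univ, Fintype.card_fin, smul_eq_mul, Nat.mul_left_comm] at h2
  rcases min_choice E.card (n₁ * matchingNumber E) with h | h <;> rw [h]
  · exact h1.trans (Nat.le_mul_of_pos_left _ c.succ_pos)
  · exact h2

/-- Distinct matching edges have distinct ends in V₂, and each of the at most κ ends has degree at
most n₁. -/
theorem sum_card_edgesAt_matched_le (hM : IsMatching E Mg) :
    ∑ i, ∑ e ∈ Mg with e.1 = i, (edgesAt E (Sum.inr e.2)).card ≤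
      min E.card (n₁ * matchingNumber E) := by
  classical
  rw [Finset.sum_fiberwise]
  refine le_min ?_ ?_
  · rw [← Finset.sum_image (f := fun j => (edgesAt E (Sum.inr j)).card) hM.injOn_snd]
    exact sum_card_edgesAt_inr _
  · refine (Finset.sum_le_card_nsmul _ _ n₁ fun e _ => degree_inr_le _).trans ?_
    rw [smul_eq_mul, mul_comm]
    exact Nat.mul_le_mul_left _ hM.card_le_matchingNumber

/-- At most 2κ_g nodes are matched, and each contributes at most 2κ_g edges. -/
theorem IsReducedGraph.card_le (h : IsReducedGraph E Mg Es) :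
    Es.card ≤ 2 * Mg.card * (2 * Mg.card) := by
  classical
  obtain ⟨S, hS, hEs⟩ := h
  let V : Finset (Fin n₁ ⊕ Fin n₂) :=
    Mg.image (fun e => Sum.inl e.1) ∪ Mg.image (fun e => Sum.inr e.2)
  have hV : ∀ v, v ∈ V ↔ Covered Mg v := by
    intro v
    simp only [V, Finset.mem_union, Finset.mem_image, Covered, Inc]
    grind
  have hVc : V.card ≤ 2 * Mg.card := by
    have h1 := Finset.card_union_le (Mg.image fun e => (Sum.inl e.1 : Fin n₁ ⊕ Fin n₂))
      (Mg.image fun e => Sum.inr e.2)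
    have h2 := Finset.card_image_le (s := Mg) (f := fun e => (Sum.inl e.1 : Fin n₁ ⊕ Fin n₂))
    have h3 := Finset.card_image_le (s := Mg) (f := fun e => (Sum.inr e.2 : Fin n₁ ⊕ Fin n₂))
    exact h1.trans (by omega)
  have hsub : Es ⊆ V.biUnion S := fun e he => by
    obtain ⟨v, hv, h1⟩ := (hEs e).1 he
    exact Finset.mem_biUnion.2 ⟨v, (hV v).2 hv, h1⟩
  refine (Finset.card_le_card hsub).trans ((Finset.card_biUnion_le_card_mul _ _ (2 * Mg.card)
    fun v hv => ?_).trans (Nat.mul_le_mul_right _ hVc))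
  obtain ⟨h1, h2⟩ := hS v ((hV v).1 hv)
  rcases le_or_gt (edgesAt E v).card (2 * Mg.card) with h3 | h3
  · rwa [h1 h3]
  · exact (h2 h3).2.2.le

end Cost

/-! ### The total number of steps -/

section Total

variable {n₁ n₂ : ℕ} {E : Finset (Fin n₁ × Fin n₂)}

/-- The number of steps of the loop that carries out the phases. -/
theorem exec_hkLoop_of_card_le {H : Finset (Fin n₁ × Fin n₂)} {adj : Fin n₁ → List (Fin n₂)}
    {act : List (Fin n₁)} (hLs : Lists H adj act) (hHE : H ⊆ E)
    (hHc : H.card ≤ 4 * min E.card (matchingNumber E ^ 2)) {s : State} (h : HKInv H adj act ∅ s)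
    (hl : Layered H ∅ s) :
    ∃ s' M' t, Exec (.loop (.lt 2 12) phaseProg) s t s' ∧ HKTrace H 9 (.lt 2 12) phaseProg s ∅ s' M' ∧
      IsMatching H M' ∧ (∀ P, ¬ IsAugPath H M' P) ∧ HoldsMatching 9 M' s' ∧
      (t : ℝ) ≤ 1 + 2096 * (√(matchingNumber E : ℝ) * (min E.card (matchingNumber E ^ 2) : ℕ)) := by
  set κ := matchingNumber E with hκ
  have hm : ∀ M', IsMatching H M' → M'.card ≤ κ := fun M' hM' =>
    IsMatching.card_le_matchingNumber ⟨hM'.1.trans hHE, hM'.2⟩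
  rcases H.eq_empty_or_nonempty with rfl | ⟨e, he⟩
  · obtain ⟨s', M', t, h1, h2, h3, h4, h5, h6⟩ := exec_hkLoop hLs (q := 1) one_ne_zero
      (fun M' hM' => by simp [Finset.subset_empty.1 hM'.1]) 0 ∅ s h hl
      (fun _ => Or.inl fun M' hM' => by simp [Finset.subset_empty.1 hM'.1])
    refine ⟨s', M', t, h1, h2, h3, h4, h5, ?_⟩
    have : (t : ℝ) ≤ 1 := by exact_mod_cast (show t ≤ 1 by omega)
    have : (0 : ℝ) ≤ √(κ : ℝ) * (min E.card (κ ^ 2) : ℕ) := by positivity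
    linarith
  · have hpos : 0 < κ := matchingNumber_pos (hHE he)
    have hH1 : 1 ≤ H.card := Finset.card_pos.2 ⟨e, he⟩
    -- The threshold q is ⌊√κ⌋ + 1, and 2q phases are allowed; 2q ≤ 4√κ since κ ≥ 1.
    have hq : κ ≤ (Nat.sqrt κ + 1) * (Nat.sqrt κ + 1) := (Nat.lt_succ_sqrt κ).le
    obtain ⟨s', M', t, h1, h2, h3, h4, h5, h6⟩ := exec_hkLoop hLs (q := Nat.sqrt κ + 1)
      (Nat.succ_ne_zero _) (fun M' hM' => (hm M' hM').trans hq) (2 * (Nat.sqrt κ + 1)) ∅ s h hl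
      (fun h12 => by
        rcases hl with ⟨h13, -⟩ | ⟨hK, -⟩
        · exact absurd h13 h12
        · exact phaseBound_of_le IsMatching.empty (Nat.succ_ne_zero _) hK
            (fun M' hM' => (hm M' hM').trans hq) (by omega) (by omega))
    refine ⟨s', M', t, h1, h2, h3, h4, h5, ?_⟩
    have hs1 : (1 : ℝ) ≤ √(κ : ℝ) := Real.one_le_sqrt.2 (by exact_mod_cast hpos)
    have hs2 : (Nat.sqrt κ : ℝ) ≤ √(κ : ℝ) := Real.nat_sqrt_le_real_sqrt
    have h7 : (t : ℝ) ≤ 1 + 2 * (Nat.sqrt κ + 1) * (16 + 115 * H.card) := by exact_mod_cast h6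
    -- 524 = 4 · (16 + 115), as `H` has at least one edge.
    have h8 : (16 + 115 * H.card : ℝ) ≤ 524 * (min E.card (κ ^ 2) : ℕ) := by
      exact_mod_cast (show 16 + 115 * H.card ≤ 524 * min E.card (κ ^ 2) by omega)
    have h9 : (2 * (Nat.sqrt κ + 1) : ℝ) * (16 + 115 * H.card) ≤
        4 * √(κ : ℝ) * (524 * (min E.card (κ ^ 2) : ℕ)) :=
      mul_le_mul (by linarith) h8 (by positivity) (by positivity)
    linarith

/-- The whole algorithm with a bound for its number of steps. -/
theorem exec_algorithm {s₀ : State} (hs₀ : IsInput E s₀) :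
    ∃ (Mg Es M : Finset (Fin n₁ × Fin n₂)) (s₁ s₂ s₃ s₄ : State) (t₁ t₂ t₃ t₄ : ℕ),
      (Exec greedyProg s₀ t₁ s₁ ∧ Maximal (IsMatching E) Mg ∧ HoldsMatching 8 Mg s₁) ∧
      (Exec buildProg s₁ t₂ s₂ ∧ IsReducedGraph E Mg Es ∧ HoldsGraph 4 Es s₂) ∧
      (Exec startProg s₂ t₃ s₃ ∧ Exec (.loop (.lt 2 12) phaseProg) s₃ t₄ s₄ ∧
        HKTrace Es 9 (.lt 2 12) phaseProg s₃ ∅ s₄ M) ∧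
      (IsMaximumMatching E M ∧ HoldsMatching 9 M s₄) ∧
      ((t₁ + t₂ + t₃ + t₄ : ℕ) : ℝ) ≤ 24 + 39 * n₁ + 183 * (min E.card (n₁ * matchingNumber E) : ℕ) +
        2336 * (√(matchingNumber E : ℝ) * (min E.card (matchingNumber E ^ 2) : ℕ)) := by
  obtain ⟨adj₁, ha₁, hl₁⟩ := hs₀.2.2.2.1.exists_adj₁
  obtain ⟨adj₂, ha₂, hl₂⟩ := hs₀.2.2.2.1.exists_adj₂
  obtain ⟨t₁, s₁, hx₁, ht₁, Mg, hMg, hg⟩ := run_greedyProg ha₁ hs₀ hl₁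
  obtain ⟨t₂, s₂, hx₂, ht₂, Es, hEs, hb⟩ := run_buildProg hs₀ hMg hg ha₁ (adj₂ := adj₂)
    (by rwa [hg.mf 0 (by simp), hg.mf 2 (by simp), hg.mf 3 (by simp)]) ha₂
    (by rwa [hg.mf 1 (by simp), hg.mf 2 (by simp), hg.mf 3 (by simp)])
  have hG := hb.gr.holdsGraph
  obtain ⟨adj, ha, hl⟩ := hG.exists_adj₁
  obtain ⟨t₃, s₃, hx₃, ht₃, act, hLs, hK, hLay⟩ := run_startProg ha hl hb.r0 hb.r2 (by
    intro a haz i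
    simp only [List.mem_cons, List.not_mem_nil, or_false] at haz
    rw [hb.mf a (by rcases haz with rfl | rfl | rfl <;> simp),
      hg.mf a (by rcases haz with rfl | rfl | rfl <;> simp)]
    exact hs₀.2.2.2.2 a (by omega) i)
  have hcMg := hMg.1.card_le_matchingNumber
  have hEsE : Es.card ≤ E.card := Finset.card_le_card hb.sub
  have hEsc : Es.card ≤ 4 * min E.card (matchingNumber E ^ 2) := by
    have h1 := hEs.card_le
    have h2 := Nat.mul_le_mul (Nat.mul_le_mul_left 2 hcMg) (Nat.mul_le_mul_left 2 hcMg)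
    have h3 : 2 * matchingNumber E * (2 * matchingNumber E) = 4 * matchingNumber E ^ 2 := by ring
    omega
  obtain ⟨s₄, M, t₄, hx₄, htr, hM, hno, hhm, ht₄⟩ := exec_hkLoop_of_card_le hLs hb.sub hEsc hK hLay
  refine ⟨Mg, Es, M, s₁, s₂, s₃, s₄, t₁, t₂, t₃, t₄, ⟨hx₁, hMg, hg.m1⟩, ⟨hx₂, hEs, hG⟩,
    ⟨hx₃, hx₄, htr⟩, ⟨hEs.isMaximumMatching hMg hM hno, hhm⟩, ?_⟩
  -- The first search costs up to 60 |E*| steps outside the phases; it is charged to the term with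
  -- √κ.
  have hE60 : (Es.card : ℝ) ≤
      4 * (√(matchingNumber E : ℝ) * (min E.card (matchingNumber E ^ 2) : ℕ)) := by
    have h1 : (Es.card : ℝ) ≤ 4 * (min E.card (matchingNumber E ^ 2) : ℕ) := by exact_mod_cast hEsc
    rcases Es.eq_empty_or_nonempty with h2 | ⟨e, he⟩
    · rw [h2, Finset.card_empty, Nat.cast_zero]; positivity
    · have h3 : (1 : ℝ) ≤ √(matchingNumber E : ℝ) :=
        Real.one_le_sqrt.2 (by exact_mod_cast matchingNumber_pos (hb.sub he))
      have h4 := le_mul_of_one_le_left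
        (Nat.cast_nonneg (α := ℝ) (min E.card (matchingNumber E ^ 2))) h3
      linarith
  have hS1 := sum_min_card_edgesAt_le (E := E) 1
  have hS2 := sum_card_edgesAt_matched_le hMg.1
  have hS3 : ∑ i, min (edgesAt E (Sum.inl i)).card (3 * Mg.card + 1) ≤ _ :=
    (Finset.sum_le_sum fun i _ => min_le_min_left _ (by omega)).trans
      (sum_min_card_edgesAt_le (E := E) 3)
  simp only [ha₁.length, Finset.sum_add_distrib, ← Finset.mul_sum, Finset.sum_const,
    Finset.card_univ, Fintype.card_fin, smul_eq_mul] at ht₁ ht₂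
  rw [one_mul] at hS1
  -- 39 = 6 + 13 + 11 + 9 collects the loops over V₁, and 183 = 15 · 2 + 49 + 26 · 4 the scans of
  -- the input lists.
  have h123 : t₁ + t₂ + t₃ ≤ 23 + 39 * n₁ + 183 * min E.card (n₁ * matchingNumber E) +
      60 * Es.card := by omega
  have h123' : (t₁ + t₂ + t₃ : ℝ) ≤ 23 + 39 * n₁ +
      183 * (min E.card (n₁ * matchingNumber E) : ℕ) + 60 * Es.card := by exact_mod_cast h123
  push_cast at h123' ht₄ hE60 ⊢
  linarith

end Total

end BipMatching

open BipMatching in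
theorem mainTheorem5 :
    (∀ (n₁ n₂ : ℕ) (E Mg Es M : Finset (Fin n₁ × Fin n₂)),
      Maximal (IsMatching E) Mg → IsReducedGraph E Mg Es → IsHKResult Es M →
        IsMaximumMatching E M) ∧
    ∃ (greedy build start phase : Prog) (test : Test) (C : ℝ),
      ∀ (n₁ n₂ : ℕ) (E : Finset (Fin n₁ × Fin n₂)) (s₀ : State), n₁ ≤ n₂ → IsInput E s₀ →
        ∃ (Mg Es M : Finset (Fin n₁ × Fin n₂)) (s₁ s₂ s₃ s₄ : State) (t₁ t₂ t₃ t₄ : ℕ),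
          (Exec greedy s₀ t₁ s₁ ∧ Maximal (IsMatching E) Mg ∧ HoldsMatching 8 Mg s₁) ∧
          (Exec build s₁ t₂ s₂ ∧ IsReducedGraph E Mg Es ∧ HoldsGraph 4 Es s₂) ∧
          (Exec start s₂ t₃ s₃ ∧ Exec (.loop test phase) s₃ t₄ s₄ ∧
            HKTrace Es 9 test phase s₃ ∅ s₄ M) ∧
          (IsMaximumMatching E M ∧ HoldsMatching 9 M s₄) ∧
          (((t₁ + t₂ + t₃ + t₄ : ℕ) : ℝ) ≤
            C * (1 + n₁ + min (E.card : ℝ) (n₁ * matchingNumber E)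
              + √(matchingNumber E : ℝ) * min (E.card : ℝ) ((matchingNumber E : ℝ) ^ 2))) ∧
          (1 ≤ E.card → n₁ ≤ E.card →
            ((t₁ + t₂ + t₃ + t₄ : ℕ) : ℝ) ≤
              C * (min (E.card : ℝ) (n₁ * matchingNumber E)
                + √(matchingNumber E : ℝ) *
                  min (E.card : ℝ) ((matchingNumber E : ℝ) ^ 2))) := by
  refine ⟨fun _ _ _ _ _ _ hg h hM => IsHKResult.isMaximumMatching hg h hM,
    greedyProg, buildProg, startProg, phaseProg, .lt 2 12, 3000, fun n₁ n₂ E s₀ _ hs₀ => ?_⟩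
  obtain ⟨Mg, Es, M, s₁, s₂, s₃, s₄, t₁, t₂, t₃, t₄, h1, h2, h3, h4, h5⟩ := exec_algorithm hs₀
  have hA : (0 : ℝ) ≤ (min E.card (n₁ * matchingNumber E) : ℕ) := Nat.cast_nonneg _
  have hB : (0 : ℝ) ≤ √(matchingNumber E : ℝ) * (min E.card (matchingNumber E ^ 2) : ℕ) := by
    positivity
  refine ⟨Mg, Es, M, s₁, s₂, s₃, s₄, t₁, t₂, t₃, t₄, h1, h2, h3, h4, ?_, fun hm hn => ?_⟩
  · have hn : (0 : ℝ) ≤ n₁ := Nat.cast_nonneg _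
    push_cast at h5 hA hB ⊢
    linarith
  · obtain ⟨e, he⟩ := Finset.card_pos.1 hm
    have hκ := matchingNumber_pos he
    have hn₁ : 1 ≤ n₁ := e.1.pos
    -- An edge gives κ ≥ 1, so with n₁ ≤ m the first minimum absorbs both the constant and the n₁
    -- term; 24 + 39 + 183 and 2336 stay below 3000.
    have hnA : n₁ ≤ min E.card (n₁ * matchingNumber E) := le_min hn (Nat.le_mul_of_pos_right _ hκ)
    have hA1 : (1 : ℝ) ≤ (min E.card (n₁ * matchingNumber E) : ℕ) := by
      exact_mod_cast hn₁.trans hnA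
    have hAn : (n₁ : ℝ) ≤ (min E.card (n₁ * matchingNumber E) : ℕ) := by exact_mod_cast hnA
    push_cast at h5 hA hB hA1 hAn ⊢
    linarith
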